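/- Let $d\in\{2,3\}$, let $k\ge 1$ be an integer, and let $\rho_v,\rho_e,\theta,\sigma,\delta>0$. Then there are constants $C_1,C_2>0$, depending only on these data, such that the following holds. Let $\Omega\subset\mathbb R^d$ be a bounded domain and $\mathcal T_h$ a finite partition of $\overline\Omega$ into closed, possibly non-convex, polytopal elements $T$ with flat $(d-1)$-dimensional edges/faces $e$; write $h_T,h_e$ for the diameters of $T,e$ and $|T|,|e|$ for their $d$- and $(d-1)$-dimensional measures. Assume that $\mathcal T_h$ is shape regular: for every $T\in\mathcal T_h$ and every edge/face $e$ of $T$, (i) $\rho_v h_T^d\le |T|$ and $\rho_e h_e^{d-1}\le |e|$; (ii) $\theta h_T\le h_e$; (iii) $T$ contains a pyramid with base $e$, apex in $T$ and height at least $\sigma h_T$; (iv) for every other edge/face $e'\neq e$ of $T$, some point of $e$ has distance at least $\delta h_T$ from the hyperplane containing $e'$. Let $V_h$ be the space of pairs $v=\{v_0,v_b\}$ with $v_0|_T\in[P_k(T)]^d$ for each element $T$ and $v_b|_e\in[P_k(e)]^d$ for each edge/face $e$ of the partition ($v_b$ single-valued on each $e$). For an element $T$ with $N$ edges/faces let $r=2N+k-1$,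 or, if $T$ is convex, alternatively $r=N+k-1$, and let the discrete weak gradient $\nabla_w v|_T\in[P_r(T)]^{d\times d}$ be the unique polynomial with $$(\nabla_w v,\varphi)_T=-(v_0,\nabla\cdot\varphi)_T+\langle v_b,\varphi\, n\rangle_{\partial T}\qquad\text{for all }\varphi\in[P_r(T)]^{d\times d},$$ where $n$ is the outward unit normal. Let $\kappa$ be a constant symmetric positive definite $d\times d$ matrix, and put $$|||v|||=\Big(\sum_{T\in\mathcal T_h}\|\nabla_w v\|_T^2+(\kappa^{-1}v_0,v_0)_T\Big)^{1/2},$$ $$\|v\|_{1,h}=\Big(\sum_{T\in\mathcal T_h}\|\nabla v_0\|_T^2+(\kappa^{-1}v_0,v_0)_T+h_T^{-1}\|v_0-v_b\|_{\partial T}^2\Big)^{1/2}.$$ Then, for all $v\in V_h$, $$C_1\|v\|_{1,h}\le |||v|||\le C_2\|v\|_{1,h}.$$ In particular $C_1,C_2$ do not depend on the mesh size $h$, on $\Omega$ or on $\kappa$. -/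

import Mathlib

open MeasureTheory Module

noncomputable section

namespace WG

/-- Points of `ℝ^d`, with the Euclidean metric. -/
abbrev Pt (d : ℕ) := EuclideanSpace ℝ (Fin d)

/-- Real polynomials in `d` variables. -/
abbrev Poly (d : ℕ) := MvPolynomial (Fin d) ℝ

/-- The value of a polynomial at a point. -/
def pval {d : ℕ} (p : Poly d) (x : Pt d) : ℝ := MvPolynomial.eval (fun i => x i) p

/-! ### Polytopal geometry -/

/-- A (not necessarily convex) polytopal set: a finite union of convex hulls of finite sets. -/
def IsPolytopal {d : ℕ} (P : Set (Pt d)) : Prop :=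
  ∃ S : Finset (Finset (Pt d)), P = ⋃ s ∈ S, convexHull ℝ (s : Set (Pt d))

/-- A polytopal element: a polytopal set that is the closure of its connected, nonempty
interior.  No convexity is asked for. -/
structure IsElement {d : ℕ} (T : Set (Pt d)) : Prop where
  polytopal : IsPolytopal T
  connected : IsConnected (interior T)
  regular : closure (interior T) = T

/-- A flat `(d-1)`-dimensional polytopal set (an edge if `d = 2`, a flat face if `d = 3`):
it spans a hyperplane and is the closure of its connected, nonempty relative interior. -/
structure IsFlatFace {d : ℕ} (e : Set (Pt d)) : Prop where
  polytopal : IsPolytopal e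
  hyperplane : finrank ℝ (vectorSpan ℝ e) + 1 = d
  connected : IsConnected (intrinsicInterior ℝ e)
  regular : closure (intrinsicInterior ℝ e) = e

/-- `ν` is the outward unit normal of `T` along the flat face `e`: a unit vector orthogonal to
`e` such that, from each relative interior point of `e`, one leaves `T` along `ν` and enters `T`
along `-ν`. -/
structure IsOutwardNormal {d : ℕ} (T e : Set (Pt d)) (ν : Pt d) : Prop where
  unit : ‖ν‖ = 1
  orthogonal : ∀ w ∈ vectorSpan ℝ e, inner ℝ ν w = 0
  outside : ∀ x ∈ intrinsicInterior ℝ e, ∃ ε > 0, ∀ t : ℝ, 0 < t → t < ε → x + t • ν ∉ T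
  inside : ∀ x ∈ intrinsicInterior ℝ e, ∃ ε > 0, ∀ t : ℝ, 0 < t → t < ε → x - t • ν ∈ T

/-- The outward unit normal of `T` along `e` (unique when it exists, and part of the definition
of a mesh is that it exists). -/
def outwardNormal {d : ℕ} (T e : Set (Pt d)) : Pt d := Classical.epsilon (IsOutwardNormal T e)

open Classical in
/-- The members of a collection `F` of flat faces that lie on the boundary of `T`. -/
def facesOn {d : ℕ} (F : Finset (Set (Pt d))) (T : Set (Pt d)) : Finset (Set (Pt d)) :=
  F.filter fun e => e ⊆ frontier T

/-- A finite partition of the domain `Ω` into polytopal elements, with its set of edges/faces. -/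
structure Mesh (d : ℕ) (Ω : Set (Pt d)) where
  /-- the elements -/
  cells : Finset (Set (Pt d))
  /-- the edges or flat faces -/
  faces : Finset (Set (Pt d))
  isElement : ∀ T ∈ cells, IsElement T
  cover : ⋃ T ∈ cells, T = closure Ω
  cells_disjoint : ∀ T ∈ cells, ∀ T' ∈ cells, T ≠ T' → Disjoint (interior T) (interior T')
  isFlatFace : ∀ e ∈ faces, IsFlatFace e
  faces_disjoint : ∀ e ∈ faces, ∀ e' ∈ faces, e ≠ e' →
    Disjoint (intrinsicInterior ℝ e) (intrinsicInterior ℝ e')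
  face_of_cell : ∀ e ∈ faces, ∃ T ∈ cells, e ∈ facesOn faces T
  boundary : ∀ T ∈ cells, frontier T = ⋃ e ∈ facesOn faces T, e
  normal : ∀ T ∈ cells, ∀ e ∈ facesOn faces T, ∃ ν, IsOutwardNormal T e ν

namespace Mesh

variable {d : ℕ} {Ω : Set (Pt d)}

/-- The edges/faces of the element `T`. -/
def facesOf (M : Mesh d Ω) (T : Set (Pt d)) : Finset (Set (Pt d)) := facesOn M.faces T

/-- The number `N` of edges/faces of the element `T`. -/
def numFaces (M : Mesh d Ω) (T : Set (Pt d)) : ℕ := (M.facesOf T).card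

/-- Shape regularity of a polytopal mesh; `h_T` is the diameter of `T` and `h_e` that of `e`.
The height of a pyramid is the distance of its apex to the hyperplane of its base.  Since
`|x - A| ≤ h_T` on `T`, the height bound already forces the angle between `x - A`, `x ∈ e`, and
the outward normal to be at most `arccos σ < π / 2`. -/
structure ShapeRegular (M : Mesh d Ω) (ρv ρe θ σ : ℝ) : Prop where
  /-- `ρv h_T^d ≤ |T|` -/
  volume_ge : ∀ T ∈ M.cells, ρv * Metric.diam T ^ d ≤ volume.real T
  /-- `ρe h_e^(d-1) ≤ |e|` -/
  area_ge : ∀ T ∈ M.cells, ∀ e ∈ M.facesOf T,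
    ρe * Metric.diam e ^ (d - 1) ≤ (μHE[d - 1] : Measure (Pt d)).real e
  /-- `θ h_T ≤ h_e` -/
  diam_ge : ∀ T ∈ M.cells, ∀ e ∈ M.facesOf T, θ * Metric.diam T ≤ Metric.diam e
  /-- a pyramid with base `e`, apex `A ∈ T` and height at least `σ h_T` is contained in `T` -/
  pyramid : ∀ T ∈ M.cells, ∀ e ∈ M.facesOf T, ∃ A ∈ T,
    convexJoin ℝ {A} e ⊆ T ∧
      σ * Metric.diam T ≤ Metric.infDist A (affineSpan ℝ e : Set (Pt d))

/-- Two distinct edges/faces of an element do not (nearly) lie in a common hyperplane: for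
`e ≠ e'`, some point of `e` has distance at least `δ h_T` from the hyperplane of `e'`.
If `l'` is the linear function vanishing on `e'`, scaled by `h_T`, this says
`|l'| ≥ δ` somewhere on `e`; without it the face bubble function of `e`, the product of the `l'^2`,
vanishes on `e` or has no uniform positive lower bound on a part of `e`. -/
def NoncoplanarFaces (M : Mesh d Ω) (δ : ℝ) : Prop :=
  ∀ T ∈ M.cells, ∀ e ∈ M.facesOf T, ∀ e' ∈ M.facesOf T, e ≠ e' →
    ∃ x ∈ e, δ * Metric.diam T ≤ Metric.infDist x (affineSpan ℝ e' : Set (Pt d))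

/-- Admissible degrees `r_T` of the discrete weak gradient: `2N + k - 1` on any element, where on
convex elements `N + k - 1` may be taken instead (`N` is the number of edges/faces of `T`). -/
def AdmissibleDegree (M : Mesh d Ω) (k : ℕ) (r : Set (Pt d) → ℕ) : Prop :=
  ∀ T ∈ M.cells, r T = 2 * M.numFaces T + k - 1 ∨ (Convex ℝ T ∧ r T = M.numFaces T + k - 1)

end Mesh

/-! ### Weak functions and the discrete weak gradient -/

/-- A pair `{v₀, v_b}`: `v₀` is given on each element and `v_b` on each edge/face (hence is
single-valued across interior faces).  Both are piecewise polynomial vector fields; the values on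
an element, resp. face, are those of the polynomial there, and only these values are used. -/
structure WeakFunction (d : ℕ) where
  /-- the interior part `v₀` on an element -/
  inner : Set (Pt d) → Fin d → Poly d
  /-- the boundary part `v_b` on an edge/face -/
  bdry : Set (Pt d) → Fin d → Poly d

/-- The weak finite element space `V_h`: `v₀ ∈ [P_k(T)]^d` for each element `T` and
`v_b ∈ [P_k(e)]^d` for each edge/face `e`, where `P_k(e)` is the space of restrictions to `e` of
polynomials of total degree at most `k`. -/
structure MemVh {d : ℕ} {Ω : Set (Pt d)} (M : Mesh d Ω) (k : ℕ) (v : WeakFunction d) : Prop where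
  inner_deg : ∀ T ∈ M.cells, ∀ i, (v.inner T i).totalDegree ≤ k
  bdry_deg : ∀ e ∈ M.faces, ∀ i, (v.bdry e i).totalDegree ≤ k

/-- `G ∈ [P_r(T)]^{d×d}` is a discrete weak gradient of `v` on `T`:
`(G, φ)_T = -(v₀, ∇·φ)_T + ⟨v_b, φ n⟩_{∂T}` for all `φ ∈ [P_r(T)]^{d×d}`. -/
structure IsWeakGradient {d : ℕ} {Ω : Set (Pt d)} (M : Mesh d Ω) (r : ℕ) (T : Set (Pt d))
    (v : WeakFunction d) (G : Fin d → Fin d → Poly d) : Prop where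
  deg : ∀ i j, (G i j).totalDegree ≤ r
  eq : ∀ φ : Fin d → Fin d → Poly d, (∀ i j, (φ i j).totalDegree ≤ r) →
    ∫ x in T, ∑ i, ∑ j, pval (G i j) x * pval (φ i j) x =
      -(∫ x in T, ∑ i, pval (v.inner T i) x * ∑ j, pval (MvPolynomial.pderiv j (φ i j)) x)
      + ∑ e ∈ M.facesOf T, ∫ x in e,
          ∑ i, pval (v.bdry e i) x * (∑ j, pval (φ i j) x * outwardNormal T e j) ∂μHE[d - 1]

/-- The discrete weak gradient `∇_{w,r,T} v`, the unique polynomial matrix above. -/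
def weakGradient {d : ℕ} {Ω : Set (Pt d)} (M : Mesh d Ω) (r : ℕ) (T : Set (Pt d))
    (v : WeakFunction d) : Fin d → Fin d → Poly d :=
  Classical.epsilon (IsWeakGradient M r T v)

/-! ### The two norms -/

/-- `(κ⁻¹ v₀, v₀)_T` -/
def reaction {d : ℕ} (κ : Matrix (Fin d) (Fin d) ℝ) (T : Set (Pt d)) (v : WeakFunction d) : ℝ :=
  ∫ x in T, κ⁻¹.mulVec (fun i => pval (v.inner T i) x) ⬝ᵥ (fun i => pval (v.inner T i) x)

/-- The energy norm `|||v|||`. -/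
def energyNorm {d : ℕ} {Ω : Set (Pt d)} (M : Mesh d Ω) (κ : Matrix (Fin d) (Fin d) ℝ)
    (r : Set (Pt d) → ℕ) (v : WeakFunction d) : ℝ :=
  √(∑ T ∈ M.cells,
    ((∫ x in T, ∑ i, ∑ j, pval (weakGradient M (r T) T v i j) x ^ 2) + reaction κ T v))

/-- The discrete `H¹` norm `‖v‖_{1,h}`. -/
def discreteH1Norm {d : ℕ} {Ω : Set (Pt d)} (M : Mesh d Ω) (κ : Matrix (Fin d) (Fin d) ℝ)
    (v : WeakFunction d) : ℝ :=
  √(∑ T ∈ M.cells,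
    ((∫ x in T, ∑ i, ∑ j, pval (MvPolynomial.pderiv j (v.inner T i)) x ^ 2)
      + reaction κ T v
      + (Metric.diam T)⁻¹ * ∑ e ∈ M.facesOf T,
          ∫ x in e, ∑ i, (pval (v.inner T i) x - pval (v.bdry e i) x) ^ 2 ∂μHE[d - 1]))

end WG

end

/-!
Integration by parts turns the equation for `∇_w v` into the following: tested against a polynomial
`ψ`, the `(i, j)` entry of `∇_w v - ∇v₀` is `∑ₑ nⱼ ⟨v_b - v₀, ψ⟩ₑ`. The two norms contain the same
reaction term, so they are compared entry by entry on each element.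

The upper bound takes `ψ` to be the entry itself and uses a trace inequality. For the lower bound,
let `lₑ` be the signed distance to the plane of the face `e`, divided by `h_T`, and let `s = 2`, or
`s = 1` when `T` is convex, so that `lₑ ^ s ≥ 0` on `T`. The product of all the `lₑ ^ s` vanishes on
the boundary, so testing with it times `∂ⱼ v₀` controls `∇v₀`; the product over the other faces,
times the jump on `e` extended constantly along the normal, controls that jump. These test functions
have degree at most `s N + k - 1`, which is why `r` has this value.

The constants come from one inequality: by compactness, the `L²` norm of a polynomial of bounded
degree on a subset of the unit ball whose measure is bounded below controls its supremum on the
ball. Hence each `lₑ` is small only on a small part of `T`. The number of faces is bounded by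
packing their planes, so the products above are bounded below on a subset of `T`, respectively of
`e`, of comparable measure.
-/

noncomputable section

namespace WG

/-! ### Polynomials as functions -/

section Polynomial

variable {d m : ℕ}

@[simp] lemma pval_add (p q : Poly d) (x : Pt d) : pval (p + q) x = pval p x + pval q x := by
  simp [pval]

@[simp] lemma pval_sub (p q : Poly d) (x : Pt d) : pval (p - q) x = pval p x - pval q x := by
  simp [pval]

@[simp] lemma pval_mul (p q : Poly d) (x : Pt d) : pval (p * q) x = pval p x * pval q x := by
  simp [pval]

@[simp] lemma pval_pow (p : Poly d) (n : ℕ) (x : Pt d) : pval (p ^ n) x = pval p x ^ n := by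
  simp [pval]

@[simp] lemma pval_C (c : ℝ) (x : Pt d) : pval (MvPolynomial.C c : Poly d) x = c := by
  simp [pval]

@[simp] lemma pval_zero (x : Pt d) : pval (0 : Poly d) x = 0 := by
  simp [pval]

@[simp] lemma pval_smul (c : ℝ) (p : Poly d) (x : Pt d) : pval (c • p) x = c * pval p x := by
  simp [pval, MvPolynomial.smul_eval]

lemma pval_sum {ι : Type*} (s : Finset ι) (f : ι → Poly d) (x : Pt d) :
    pval (∑ i ∈ s, f i) x = ∑ i ∈ s, pval (f i) x := by
  simp [pval, map_sum]

lemma pval_prod {ι : Type*} (s : Finset ι) (f : ι → Poly d) (x : Pt d) :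
    pval (∏ i ∈ s, f i) x = ∏ i ∈ s, pval (f i) x := by
  simp [pval, map_prod]

@[fun_prop]
lemma contDiff_pval (p : Poly d) {n : WithTop ℕ∞} : ContDiff ℝ n (pval p) := by
  have hp : AnalyticOnNhd ℝ (pval p) Set.univ :=
    AnalyticOnNhd.aeval_mvPolynomial
      (fun i => (EuclideanSpace.proj i : Pt d →L[ℝ] ℝ).analyticOnNhd Set.univ) p
  exact contDiffOn_univ.1 (hp.contDiffOn uniqueDiffOn_univ)

@[fun_prop]
lemma continuous_pval (p : Poly d) : Continuous (pval p) := (contDiff_pval p (n := 0)).continuous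

lemma fderiv_pval_single (p : Poly d) (x : Pt d) (j : Fin d) :
    fderiv ℝ (pval p) x (EuclideanSpace.single j 1) = pval (MvPolynomial.pderiv j p) x := by
  have hdiff (q : Poly d) : DifferentiableAt ℝ (pval q) x :=
    (contDiff_pval q (n := 1)).differentiable one_ne_zero x
  induction p using MvPolynomial.induction_on with
  | C a =>
    have h : pval (MvPolynomial.C a : Poly d) = fun _ => a := funext (pval_C a)
    simp [h]
  | add p q hp hq =>
    have h : pval (p + q) = fun x => pval p x + pval q x := funext (pval_add p q)
    rw [h, fderiv_fun_add (hdiff p) (hdiff q)]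
    simp [hp, hq]
  | mul_X p i hp =>
    have h : pval (p * MvPolynomial.X i) = fun x => pval p x * x i :=
      funext fun x => by simp [pval]
    have hx : HasFDerivAt (fun y : Pt d => y i) (EuclideanSpace.proj i : Pt d →L[ℝ] ℝ) x :=
      (EuclideanSpace.proj i : Pt d →L[ℝ] ℝ).hasFDerivAt
    rw [h, ((hdiff p).hasFDerivAt.fun_mul hx).fderiv]
    obtain rfl | hij := eq_or_ne i j
    · simp [hp, pval]
    · simp [hp, pval, MvPolynomial.pderiv_X_of_ne hij, hij]

lemma totalDegree_pderiv_le {σ R : Type*} [CommSemiring R] (p : MvPolynomial σ R) (j : σ) :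
    (MvPolynomial.pderiv j p).totalDegree ≤ p.totalDegree - 1 := by
  refine Finset.sup_le fun s hs => ?_
  have hcoeff : MvPolynomial.coeff (s + Finsupp.single j 1) p ≠ 0 := by
    rw [MvPolynomial.mem_support_iff, MvPolynomial.coeff_pderiv] at hs
    exact left_ne_zero_of_mul hs
  have hdeg := MvPolynomial.le_totalDegree (MvPolynomial.mem_support_iff.2 hcoeff)
  rw [Finsupp.sum_add_index' (fun _ => rfl) (fun _ _ _ => rfl), Finsupp.sum_single_index rfl]
    at hdeg
  exact Nat.le_sub_one_of_lt hdeg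

lemma totalDegree_bind₁_le {σ τ R : Type*} [CommSemiring R] {g : σ → MvPolynomial τ R} {n : ℕ}
    (hg : ∀ i, (g i).totalDegree ≤ n) (p : MvPolynomial σ R) :
    (MvPolynomial.bind₁ g p).totalDegree ≤ n * p.totalDegree := by
  conv_lhs => rw [p.as_sum, map_sum]
  refine MvPolynomial.totalDegree_finsetSum_le fun s hs => ?_
  rw [MvPolynomial.bind₁_monomial]
  calc (MvPolynomial.C (p.coeff s) * ∏ i ∈ s.support, g i ^ s i).totalDegree
      ≤ (MvPolynomial.C (p.coeff s) : MvPolynomial τ R).totalDegree +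
          (∏ i ∈ s.support, g i ^ s i).totalDegree := MvPolynomial.totalDegree_mul _ _
    _ ≤ ∑ i ∈ s.support, (g i ^ s i).totalDegree := by
        rw [MvPolynomial.totalDegree_C, zero_add]
        exact MvPolynomial.totalDegree_finsetProd _ _
    _ ≤ ∑ i ∈ s.support, n * s i := Finset.sum_le_sum fun i _ =>
        (MvPolynomial.totalDegree_pow _ _).trans <| by rw [mul_comm]; gcongr; exact hg i
    _ = n * ∑ i ∈ s.support, s i := (Finset.mul_sum ..).symm
    _ ≤ n * p.totalDegree := by gcongr; exact MvPolynomial.le_totalDegree hs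

/-- The polynomial `y ↦ p (x₀ + A y)`. -/
def affComp (p : Poly d) (x₀ : Pt d) (A : Pt m →ₗ[ℝ] Pt d) : Poly m :=
  MvPolynomial.bind₁ (fun i => MvPolynomial.C (x₀ i) +
    ∑ j, MvPolynomial.C (A (EuclideanSpace.single j 1) i) * MvPolynomial.X j) p

lemma pval_affComp (p : Poly d) (x₀ : Pt d) (A : Pt m →ₗ[ℝ] Pt d) (y : Pt m) :
    pval (affComp p x₀ A) y = pval p (x₀ + A y) := by
  have hA (i : Fin d) : A y i = ∑ j, A (EuclideanSpace.single j 1) i * y j := by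
    conv_lhs => rw [← (EuclideanSpace.basisFun (Fin m) ℝ).sum_repr y]
    simp [map_sum, mul_comm]
  simp only [pval, affComp]
  rw [← MvPolynomial.coe_aeval_eq_eval, ← MvPolynomial.coe_aeval_eq_eval, RingHom.coe_coe,
    RingHom.coe_coe, MvPolynomial.aeval_bind₁]
  congr 2
  ext i
  simp [hA]

lemma totalDegree_affComp_le (p : Poly d) (x₀ : Pt d) (A : Pt m →ₗ[ℝ] Pt d) :
    (affComp p x₀ A).totalDegree ≤ p.totalDegree := by
  refine (totalDegree_bind₁_le (n := 1) (fun i => ?_) p).trans_eq (one_mul _)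
  refine (MvPolynomial.totalDegree_add _ _).trans (max_le (by simp) ?_)
  exact MvPolynomial.totalDegree_finsetSum_le fun j _ =>
    (MvPolynomial.totalDegree_mul _ _).trans (by simp)

lemma volume_setOf_eval_eq_zero {n : ℕ} {p : MvPolynomial (Fin n) ℝ} (hp : p ≠ 0) :
    volume {x : Fin n → ℝ | MvPolynomial.eval x p = 0} = 0 := by
  induction n with
  | zero =>
    obtain ⟨c, rfl⟩ := MvPolynomial.C_surjective (Fin 0) p
    have hc : c ≠ 0 := by rintro rfl; simp at hp
    simp [hc]
  | succ n ih =>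
    have hsplit := (volume_preserving_piFinSuccAbove (fun _ : Fin (n + 1) => ℝ) 0).symm
    have hm : MeasurableSet {x : Fin (n + 1) → ℝ | MvPolynomial.eval x p = 0} :=
      (isClosed_eq (MvPolynomial.continuous_eval p) continuous_const).measurableSet
    rw [← hsplit.measure_preimage_equiv, Measure.volume_eq_prod,
      Measure.measure_prod_null (hsplit.measurable hm)]
    set P := MvPolynomial.finSuccEquiv ℝ n p
    have hP : P ≠ 0 := by simpa [P] using hp
    have hroots : {y : ℝ | Polynomial.eval (MvPolynomial.C y) P = 0}.Finite :=
      (Polynomial.finite_setOfPred_isRoot hP).preimage (MvPolynomial.C_injective (Fin n) ℝ).injOn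
    have hae : ∀ᵐ y : ℝ, Polynomial.eval (MvPolynomial.C y) P ≠ 0 :=
      (measure_eq_zero_iff_ae_notMem (s := {y | _})).1 (hroots.measure_zero volume)
    filter_upwards [hae] with y hy
    refine (congrArg volume ?_).trans (ih hy)
    ext s
    have hcons : MvPolynomial.eval s (Polynomial.eval (MvPolynomial.C y) P) =
        MvPolynomial.eval (Fin.cons y s : Fin (n + 1) → ℝ) p := by
      rw [MvPolynomial.eval_eq_eval_mv_eval', Polynomial.eval_map, Polynomial.eval,
        Polynomial.hom_eval₂]
      simp [P]
    simp [hcons, Fin.insertNthEquiv, Fin.insertNth_zero']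

lemma volume_setOf_pval_eq_zero {p : Poly d} (hp : p ≠ 0) :
    volume {x : Pt d | pval p x = 0} = 0 := by
  have hm : MeasurableSet {x : Fin d → ℝ | MvPolynomial.eval x p = 0} :=
    (isClosed_eq (MvPolynomial.continuous_eval p) continuous_const).measurableSet
  exact ((PiLp.volume_preserving_ofLp (Fin d)).measure_preimage hm.nullMeasurableSet).trans
    (volume_setOf_eval_eq_zero hp)

end Polynomial

/-! ### Remez inequalities -/

section Remez

variable {X : Type*} [MeasurableSpace X] {μ : Measure X} [IsFiniteMeasure μ] {ρ : ℝ}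

lemma exists_measureReal_abs_le_le {f : X → ℝ} (hf : Measurable f) (hf₀ : μ {x | f x = 0} = 0)
    (hρ : 0 < ρ) : ∃ ε > 0, μ.real {x | |f x| ≤ ε} ≤ ρ := by
  have hlim := tendsto_measure_biInter_gt (μ := μ) (s := fun ε : ℝ => {x | |f x| ≤ ε}) (a := 0)
    (fun ε _ => (measurableSet_le hf.abs measurable_const).nullMeasurableSet)
    (fun ε ε' _ h x hx => hx.trans h) ⟨1, one_pos, measure_ne_top _ _⟩
  have hinter : ⋂ ε > (0 : ℝ), {x | |f x| ≤ ε} = {x | f x = 0} := by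
    ext x
    simp only [Set.mem_iInter, Set.mem_ofPred_eq]
    exact ⟨fun h => abs_nonpos_iff.1 (le_of_forall_gt_imp_ge_of_dense h),
      fun h ε hε => by simpa [h] using hε.le⟩
  rw [hinter, hf₀] at hlim
  obtain ⟨ε, hsmall, hε⟩ := ((hlim.eventually (gt_mem_nhds (ENNReal.ofReal_pos.2 hρ))).and
    self_mem_nhdsWithin).exists
  exact ⟨ε, hε, ENNReal.toReal_le_of_le_ofReal hρ.le hsmall.le⟩

variable [TopologicalSpace X] [CompactSpace X] [OpensMeasurableSpace X]
  (V : Submodule ℝ C(X, ℝ)) [FiniteDimensional ℝ V]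

lemma exists_forall_measureReal_abs_le_le (hV : ∀ f ∈ V, f ≠ 0 → μ {x | f x = 0} = 0)
    (hρ : 0 < ρ) : ∃ ε > 0, ∀ f ∈ V, ‖f‖ = 1 → μ.real {x | |f x| ≤ ε} ≤ ρ := by
  have : ProperSpace V := FiniteDimensional.proper ℝ V
  suffices ∃ ε > 0, ∀ f ∈ Metric.sphere (0 : V) 1, μ.real {x | |f.1 x| ≤ ε} ≤ ρ by
    obtain ⟨ε, hε, h⟩ := this
    exact ⟨ε, hε, fun f hf hf1 => h ⟨f, hf⟩ (mem_sphere_zero_iff_norm.2 hf1)⟩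
  refine (isCompact_sphere (0 : V) 1).induction_on
    (p := fun S => ∃ ε > 0, ∀ f ∈ S, μ.real {x | |f.1 x| ≤ ε} ≤ ρ) ⟨1, one_pos, by simp⟩
    (fun s t hst ⟨ε, hε, h⟩ => ⟨ε, hε, fun f hf => h f (hst hf)⟩) ?_ fun f hf => ?_
  · rintro s t ⟨ε, hε, hs⟩ ⟨ε', hε', ht⟩
    refine ⟨min ε ε', lt_min hε hε', fun f hf => ?_⟩
    obtain hf | hf := hf
    · exact (measureReal_mono (s₂ := {x | |f.1 x| ≤ ε})
        fun x (hx : |f.1 x| ≤ min ε ε') => hx.trans (min_le_left _ _)).trans (hs f hf)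
    · exact (measureReal_mono (s₂ := {x | |f.1 x| ≤ ε'})
        fun x (hx : |f.1 x| ≤ min ε ε') => hx.trans (min_le_right _ _)).trans (ht f hf)
  · have hf₀ : f.1 ≠ 0 := by
      rw [ne_eq, Submodule.coe_eq_zero]
      exact ne_zero_of_mem_unit_sphere ⟨f, hf⟩
    obtain ⟨ε, hε, hsmall⟩ :=
      exists_measureReal_abs_le_le (μ := μ) f.1.measurable (hV f f.2 hf₀) hρ
    refine ⟨Metric.ball f (ε / 2), mem_nhdsWithin_of_mem_nhds (Metric.ball_mem_nhds f (by simpa)),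
      ε / 2, half_pos hε, fun g hg => (measureReal_mono fun x hx => ?_).trans hsmall⟩
    have hdist : |f.1 x - g.1 x| < ε / 2 :=
      (ContinuousMap.dist_apply_le_dist x).trans_lt (Metric.mem_ball'.1 hg)
    have hgx : |g.1 x| ≤ ε / 2 := hx
    have := abs_sub_abs_le_abs_sub (f.1 x) (g.1 x)
    simp only [Set.mem_ofPred_eq]
    linarith

lemma exists_norm_sq_le_setIntegral (hV : ∀ f ∈ V, f ≠ 0 → μ {x | f x = 0} = 0) (hρ : 0 < ρ) :
    ∃ C > 0, ∀ f ∈ V, ∀ E, MeasurableSet E → ρ ≤ μ.real E →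
      ‖f‖ ^ 2 ≤ C * ∫ x in E, f x ^ 2 ∂μ := by
  obtain ⟨ε, hε, hsmall⟩ := exists_forall_measureReal_abs_le_le V hV (half_pos hρ)
  refine ⟨(ε ^ 2 * (ρ / 2))⁻¹, by positivity, fun f hf E hE hEρ => ?_⟩
  rw [← div_eq_inv_mul, le_div_iff₀ (by positivity)]
  obtain rfl | hf₀ := eq_or_ne f 0
  · simp
  set D := {x | |(‖f‖⁻¹ • f) x| ≤ ε}
  have hD : MeasurableSet D :=
    measurableSet_le (‖f‖⁻¹ • f).continuous.abs.measurable measurable_const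
  have hDsmall : μ.real D ≤ ρ / 2 := hsmall _ (V.smul_mem _ hf) (norm_smul_inv_norm hf₀)
  have hED : ρ / 2 ≤ μ.real (E \ D) := by
    have := le_measureReal_sdiff (μ := μ) (s₁ := E) (s₂ := D)
    linarith
  have hlarge (x : X) (hx : x ∉ D) : (‖f‖ * ε) ^ 2 ≤ f x ^ 2 := by
    have hx' : ε < ‖f‖⁻¹ * |f x| := by simpa [D, abs_mul] using hx
    rw [← sq_abs (f x)]
    gcongr
    rw [← div_eq_inv_mul, lt_div_iff₀ (norm_pos_iff.2 hf₀)] at hx'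
    linarith
  have hint : Integrable (fun x => f x ^ 2) μ :=
    Integrable.of_bound (f.continuous.pow 2).aestronglyMeasurable (‖f‖ ^ 2)
      (Filter.Eventually.of_forall fun x => by
        rw [norm_pow]; gcongr; exact f.norm_coe_le_norm x)
  calc ‖f‖ ^ 2 * (ε ^ 2 * (ρ / 2)) = (‖f‖ * ε) ^ 2 * (ρ / 2) := by ring
    _ ≤ (‖f‖ * ε) ^ 2 * μ.real (E \ D) := by gcongr
    _ = ∫ _ in E \ D, (‖f‖ * ε) ^ 2 ∂μ := by simp [mul_comm]
    _ ≤ ∫ x in E \ D, f x ^ 2 ∂μ :=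
        setIntegral_mono_on (integrable_const _) hint.integrableOn (hE.diff hD)
          fun x hx => hlarge x hx.2
    _ ≤ ∫ x in E, f x ^ 2 ∂μ :=
        setIntegral_mono_set hint.integrableOn (Filter.Eventually.of_forall fun x => sq_nonneg _)
          (Filter.Eventually.of_forall Set.sdiff_subset)

end Remez

section PolynomialRemez

open scoped Pointwise

lemma exists_sq_le_setIntegral_unitBall (m k : ℕ) {ρ : ℝ} (hρ : 0 < ρ) :
    ∃ C > 0, ∀ p : Poly m, p.totalDegree ≤ k → ∀ E ⊆ Metric.closedBall (0 : Pt m) 1,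
      MeasurableSet E → ρ ≤ volume.real E → ∀ x ∈ Metric.closedBall (0 : Pt m) 1,
        pval p x ^ 2 ≤ C * ∫ y in E, pval p y ^ 2 := by
  set B := Metric.closedBall (0 : Pt m) 1
  have hB : MeasurableSet B := Metric.isClosed_closedBall.measurableSet
  have hemb := MeasurableEmbedding.subtype_coe hB
  have : CompactSpace B := isCompact_iff_compactSpace.1 (isCompact_closedBall 0 1)
  let μ : Measure B := volume.comap Subtype.val
  have : IsFiniteMeasure μ := ⟨by
    rw [hemb.comap_apply, Set.image_univ, Subtype.range_coe]
    exact measure_closedBall_lt_top⟩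
  let restr : Poly m →ₗ[ℝ] C(B, ℝ) :=
    { toFun p := ⟨fun x => pval p x, by fun_prop⟩
      map_add' p q := by ext; simp
      map_smul' c p := by ext; simp }
  let V := (MvPolynomial.restrictTotalDegree (Fin m) ℝ k).map restr
  have hV : ∀ f ∈ V, f ≠ 0 → μ {x | f x = 0} = 0 := by
    rintro _ ⟨p, -, rfl⟩ hp
    have hp₀ : p ≠ 0 := by rintro rfl; exact hp (map_zero restr)
    rw [hemb.comap_apply]
    exact measure_mono_null (by rintro _ ⟨x, hx, rfl⟩; exact hx) (volume_setOf_pval_eq_zero hp₀)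
  obtain ⟨C, hC, hle⟩ := exists_norm_sq_le_setIntegral V hV hρ
  refine ⟨C, hC, fun p hp E hEB hE hEρ x hx => ?_⟩
  have hvol : μ.real (Subtype.val ⁻¹' E) = volume.real E := by
    rw [Measure.real, hemb.comap_apply, Subtype.image_preimage_coe, Set.inter_eq_right.2 hEB,
      Measure.real]
  have hint : ∫ y in Subtype.val ⁻¹' E, restr p y ^ 2 ∂μ = ∫ y in E, pval p y ^ 2 := by
    rw [← Measure.restrict_restrict_of_subset hEB, ← map_comap_subtype_coe hB,
      hemb.setIntegral_map]
    rfl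
  rw [← hint]
  have hpV : restr p ∈ V := ⟨p, (MvPolynomial.mem_restrictTotalDegree _ _ _).2 hp, rfl⟩
  refine le_trans ?_ (hle (restr p) hpV _ (hE.preimage measurable_subtype_coe)
    (hEρ.trans_eq hvol.symm))
  rw [← sq_abs]
  gcongr
  exact (restr p).norm_coe_le_norm ⟨x, hx⟩

lemma exists_sq_le_setIntegral_closedBall (m k : ℕ) {ρ : ℝ} (hρ : 0 < ρ) :
    ∃ C > 0, ∀ h > 0, ∀ p : Poly m, p.totalDegree ≤ k →
      ∀ E ⊆ Metric.closedBall (0 : Pt m) h, MeasurableSet E → ρ * h ^ m ≤ volume.real E →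
        ∀ x ∈ Metric.closedBall (0 : Pt m) h,
          pval p x ^ 2 * h ^ m ≤ C * ∫ y in E, pval p y ^ 2 := by
  obtain ⟨C, hC, hunit⟩ := exists_sq_le_setIntegral_unitBall m k hρ
  refine ⟨C, hC, fun h hh p hp E hEB hE hEρ x hx => ?_⟩
  have hpow : 0 < h ^ m := pow_pos hh m
  let q : Poly m := affComp p 0 (h • LinearMap.id)
  have hq (y : Pt m) : pval q y = pval p (h • y) := by simp [q, pval_affComp]
  have hball (y : Pt m) : h • y ∈ Metric.closedBall (0 : Pt m) h ↔
      y ∈ Metric.closedBall (0 : Pt m) 1 := by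
    simp [norm_smul, abs_of_pos hh, hh]
  have hx_eq : h • h⁻¹ • x = x := smul_inv_smul₀ hh.ne' x
  have hvol : ρ ≤ volume.real ((h • ·) ⁻¹' E) := by
    rwa [Measure.real, Measure.addHaar_preimage_smul volume hh.ne', finrank_euclideanSpace_fin,
      ENNReal.toReal_mul, ENNReal.toReal_ofReal (abs_nonneg _), abs_of_pos (inv_pos.2 hpow),
      ← div_eq_inv_mul, le_div_iff₀ hpow]
  have hint : ∫ y in (h • ·) ⁻¹' E, pval q y ^ 2 = (h ^ m)⁻¹ * ∫ y in E, pval p y ^ 2 := by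
    simp only [hq]
    rw [Measure.setIntegral_comp_smul_of_pos volume (fun y => pval p y ^ 2) _ hh,
      finrank_euclideanSpace_fin, Set.preimage_smul₀ hh.ne', smul_inv_smul₀ hh.ne', smul_eq_mul]
  have hle := hunit q ((totalDegree_affComp_le p 0 _).trans hp) ((h • ·) ⁻¹' E)
    (fun y hy => (hball y).1 (hEB hy)) (measurable_const_smul h hE) hvol (h⁻¹ • x)
    ((hball _).1 (by rwa [hx_eq]))
  rw [hq, hx_eq, hint] at hle
  calc pval p x ^ 2 * h ^ m ≤ C * ((h ^ m)⁻¹ * ∫ y in E, pval p y ^ 2) * h ^ m := by gcongr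
    _ = C * ∫ y in E, pval p y ^ 2 := by field_simp

end PolynomialRemez

/-! ### Flat patches -/

section Patch

variable {d m : ℕ}

/-- The affine isometry `y ↦ x₀ + ι y` parametrizing an `m`-plane. -/
def chart (x₀ : Pt d) (ι : Pt m →ₗᵢ[ℝ] Pt d) (y : Pt m) : Pt d := x₀ + ι y

/-- The closed disc of radius `h` about `x₀` in the plane `x₀ + range ι`. -/
def disc (x₀ : Pt d) (ι : Pt m →ₗᵢ[ℝ] Pt d) (h : ℝ) : Set (Pt d) :=
  Metric.closedBall x₀ h ∩ Set.range (chart x₀ ι)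

lemma isometry_chart (x₀ : Pt d) (ι : Pt m →ₗᵢ[ℝ] Pt d) : Isometry (chart x₀ ι) :=
  (IsometryEquiv.addLeft x₀).isometry.comp ι.isometry

lemma measurableEmbedding_chart (x₀ : Pt d) (ι : Pt m →ₗᵢ[ℝ] Pt d) :
    MeasurableEmbedding (chart x₀ ι) :=
  (isometry_chart x₀ ι).isClosedEmbedding.measurableEmbedding

lemma restrict_eq_map_chart (x₀ : Pt d) (ι : Pt m →ₗᵢ[ℝ] Pt d) {S : Set (Pt d)}
    (hS : S ⊆ Set.range (chart x₀ ι)) :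
    (μHE[m] : Measure (Pt d)).restrict S =
      (volume.restrict (chart x₀ ι ⁻¹' S)).map (chart x₀ ι) := by
  rw [← (measurableEmbedding_chart x₀ ι).restrict_map,
    ← EuclideanSpace.euclideanHausdorffMeasure_eq_volume,
    (isometry_chart x₀ ι).map_euclideanHausdorffMeasure, Measure.restrict_restrict_of_subset hS]

lemma setIntegral_chart (x₀ : Pt d) (ι : Pt m →ₗᵢ[ℝ] Pt d) {S : Set (Pt d)}
    (hS : S ⊆ Set.range (chart x₀ ι)) (f : Pt d → ℝ) :
    ∫ x in S, f x ∂μHE[m] = ∫ y in chart x₀ ι ⁻¹' S, f (chart x₀ ι y) := by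
  rw [restrict_eq_map_chart x₀ ι hS, (measurableEmbedding_chart x₀ ι).integral_map]

lemma measure_chart (x₀ : Pt d) (ι : Pt m →ₗᵢ[ℝ] Pt d) {S : Set (Pt d)}
    (hS : S ⊆ Set.range (chart x₀ ι)) :
    (μHE[m] : Measure (Pt d)) S = volume (chart x₀ ι ⁻¹' S) := by
  rw [← EuclideanSpace.euclideanHausdorffMeasure_eq_volume,
    (isometry_chart x₀ ι).euclideanHausdorffMeasure_preimage, Set.inter_eq_left.2 hS]

lemma chart_mem_closedBall {x₀ : Pt d} {ι : Pt m →ₗᵢ[ℝ] Pt d} {h : ℝ} {y : Pt m} :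
    chart x₀ ι y ∈ Metric.closedBall x₀ h ↔ y ∈ Metric.closedBall (0 : Pt m) h := by
  simp [chart]

lemma measure_disc_lt_top (x₀ : Pt d) (ι : Pt m →ₗᵢ[ℝ] Pt d) (h : ℝ) :
    (μHE[m] : Measure (Pt d)) (disc x₀ ι h) < ⊤ := by
  rw [measure_chart x₀ ι (S := disc x₀ ι h) Set.inter_subset_right]
  refine (measure_mono (t := Metric.closedBall 0 h) fun y hy => ?_).trans_lt
    measure_closedBall_lt_top
  exact chart_mem_closedBall.1 hy.1

/-- The volume of the unit ball. -/
def ballVol (m : ℕ) : ℝ := volume.real (Metric.closedBall (0 : Pt m) 1)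

lemma ballVol_nonneg (m : ℕ) : 0 ≤ ballVol m := measureReal_nonneg

lemma measureReal_le_of_subset_disc {x₀ : Pt d} {ι : Pt m →ₗᵢ[ℝ] Pt d} {h : ℝ} (hh : 0 ≤ h)
    {S : Set (Pt d)} (hS : S ⊆ disc x₀ ι h) :
    (μHE[m] : Measure (Pt d)).real S ≤ ballVol m * h ^ m := by
  rw [Measure.real, measure_chart x₀ ι (hS.trans Set.inter_subset_right)]
  have := Measure.addHaar_real_closedBall' (volume : Measure (Pt m)) 0 hh
  rw [finrank_euclideanSpace_fin] at this
  rw [ballVol, mul_comm, ← this]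
  exact measureReal_mono (fun y hy => chart_mem_closedBall.1 (hS hy).1)
    measure_closedBall_lt_top.ne

lemma integrableOn_of_subset_disc {x₀ : Pt d} {ι : Pt m →ₗᵢ[ℝ] Pt d} {h : ℝ} {S : Set (Pt d)}
    (hS : S ⊆ disc x₀ ι h) {f : Pt d → ℝ} (hf : Continuous f) : IntegrableOn f S μHE[m] := by
  obtain ⟨K, hK⟩ := (isCompact_closedBall x₀ h).exists_bound_of_continuousOn hf.continuousOn
  have : IntegrableOn f (disc x₀ ι h) μHE[m] := by
    refine Measure.integrableOn_of_bounded (M := K) (measure_disc_lt_top x₀ ι h).ne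
      hf.aestronglyMeasurable ?_
    refine (ae_restrict_iff' ?_).2 (Filter.Eventually.of_forall fun x hx => hK x hx.1)
    exact (Metric.isClosed_closedBall.inter
      (isometry_chart x₀ ι).isClosedEmbedding.isClosed_range).measurableSet
  exact this.mono_set hS

lemma exists_sq_le_setIntegral_disc (m k : ℕ) {ρ : ℝ} (hρ : 0 < ρ) :
    ∃ C > 0, ∀ (d : ℕ) (x₀ : Pt d) (ι : Pt m →ₗᵢ[ℝ] Pt d), ∀ h > 0, ∀ p : Poly d,
      p.totalDegree ≤ k → ∀ S ⊆ disc x₀ ι h, MeasurableSet S →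
        ρ * h ^ m ≤ (μHE[m] : Measure (Pt d)).real S → ∀ x ∈ disc x₀ ι h,
          pval p x ^ 2 * h ^ m ≤ C * ∫ y in S, pval p y ^ 2 ∂μHE[m] := by
  obtain ⟨C, hC, hball⟩ := exists_sq_le_setIntegral_closedBall m k hρ
  refine ⟨C, hC, ?_⟩
  rintro d x₀ ι h hh p hp S hS hSm hSρ x ⟨hx, y, rfl⟩
  have hS_range : S ⊆ Set.range (chart x₀ ι) := hS.trans Set.inter_subset_right
  rw [Measure.real, measure_chart x₀ ι hS_range] at hSρ
  have hle := hball h hh (affComp p x₀ ι.toLinearMap) ((totalDegree_affComp_le _ _ _).trans hp)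
    (chart x₀ ι ⁻¹' S) (fun z hz => chart_mem_closedBall.1 (hS hz).1)
    ((measurableEmbedding_chart x₀ ι).measurable hSm) hSρ y (chart_mem_closedBall.1 hx)
  simp only [pval_affComp] at hle
  rwa [setIntegral_chart x₀ ι hS_range]

lemma exists_measureReal_abs_pval_le_le (m k : ℕ) {ρ α : ℝ} (hρ : 0 < ρ) (hα : 0 < α) :
    ∃ ε > 0, ∀ (d : ℕ) (x₀ : Pt d) (ι : Pt m →ₗᵢ[ℝ] Pt d), ∀ h > 0, ∀ p : Poly d,
      p.totalDegree ≤ k → (∃ x ∈ disc x₀ ι h, α ≤ |pval p x|) →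
        ∀ S ⊆ disc x₀ ι h, MeasurableSet S →
          (μHE[m] : Measure (Pt d)).real (S ∩ {x | |pval p x| ≤ ε}) ≤ ρ * h ^ m := by
  obtain ⟨C, hC, hdisc⟩ := exists_sq_le_setIntegral_disc m k hρ
  set V := ballVol m
  have hV : 0 ≤ V := ballVol_nonneg m
  refine ⟨√(α ^ 2 / (1 + C * V)), by positivity, ?_⟩
  rintro d x₀ ι h hh p hp ⟨x, hx, hαx⟩ S hS hSm
  set ε := √(α ^ 2 / (1 + C * V))
  set D := S ∩ {x | |pval p x| ≤ ε}
  have hD : D ⊆ disc x₀ ι h := Set.inter_subset_left.trans hS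
  have hDm : MeasurableSet D :=
    hSm.inter (measurableSet_le (continuous_pval p).abs.measurable measurable_const)
  have hpow : 0 < h ^ m := pow_pos hh m
  by_contra! hlarge
  have hint : ∫ y in D, pval p y ^ 2 ∂μHE[m] ≤ ε ^ 2 * (V * h ^ m) :=
    calc ∫ y in D, pval p y ^ 2 ∂μHE[m] ≤ ε ^ 2 * (μHE[m] : Measure (Pt d)).real D := by
          refine (Real.le_norm_self _).trans (norm_setIntegral_le_of_norm_le_const
            ((measure_mono hD).trans_lt (measure_disc_lt_top x₀ ι h)) fun y hy => ?_)
          rw [norm_pow]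
          exact pow_le_pow_left₀ (norm_nonneg _) hy.2 2
      _ ≤ ε ^ 2 * (V * h ^ m) := by gcongr; exact measureReal_le_of_subset_disc hh.le hD
  have hα_le : α ^ 2 ≤ C * V * ε ^ 2 := le_of_mul_le_mul_right
    (calc α ^ 2 * h ^ m ≤ pval p x ^ 2 * h ^ m := by rw [← sq_abs (pval p x)]; gcongr
      _ ≤ C * ∫ y in D, pval p y ^ 2 ∂μHE[m] := hdisc d x₀ ι h hh p hp D hD hDm hlarge.le x hx
      _ ≤ C * (ε ^ 2 * (V * h ^ m)) := by gcongr
      _ = C * V * ε ^ 2 * h ^ m := by ring) hpow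
  have hε : ε ^ 2 * (1 + C * V) = α ^ 2 := by
    rw [Real.sq_sqrt (by positivity)]
    field_simp
  have : 0 < ε ^ 2 := by positivity
  linarith

lemma exists_le_prod_sq_on_large_subset (m k N : ℕ) {ρ α : ℝ} (hρ : 0 < ρ) (hα : 0 < α) :
    ∃ ε > 0, ∀ (d : ℕ) (x₀ : Pt d) (ι : Pt m →ₗᵢ[ℝ] Pt d), ∀ h > 0,
      ∀ S ⊆ disc x₀ ι h, MeasurableSet S → ρ * h ^ m ≤ (μHE[m] : Measure (Pt d)).real S →
      ∀ {J : Type*} (I : Finset J) (l : J → Poly d), I.card ≤ N →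
        (∀ i ∈ I, (l i).totalDegree ≤ k ∧ ∃ x ∈ disc x₀ ι h, α ≤ |pval (l i) x|) →
        ∃ E ⊆ S, MeasurableSet E ∧ ρ / 2 * h ^ m ≤ (μHE[m] : Measure (Pt d)).real E ∧
          ∀ y ∈ E, ε ≤ ∏ i ∈ I, pval (l i) y ^ 2 := by
  set ρ' : ℝ := ρ / (2 * (N + 1))
  obtain ⟨ε, hε, hsmall⟩ := exists_measureReal_abs_pval_le_le m k (ρ := ρ') (by positivity) hα
  refine ⟨min 1 ε ^ (2 * N), by positivity, ?_⟩
  intro d x₀ ι h hh S hS hSm hSρ J I l hI hl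
  set μ : Measure (Pt d) := μHE[m]
  set D : J → Set (Pt d) := fun i => S ∩ {x | |pval (l i) x| ≤ ε}
  set U : Set (Pt d) := ⋃ i ∈ I, D i
  have hU : MeasurableSet U := I.measurableSet_biUnion fun i _ =>
    hSm.inter (measurableSet_le (continuous_pval (l i)).abs.measurable measurable_const)
  have hU_small : μ.real U ≤ ρ / 2 * h ^ m :=
    calc μ.real U ≤ ∑ i ∈ I, μ.real (D i) := measureReal_biUnion_finset_le _ _
      _ ≤ ∑ _ ∈ I, ρ' * h ^ m := Finset.sum_le_sum fun i hi =>
          hsmall d x₀ ι h hh (l i) (hl i hi).1 (hl i hi).2 S hS hSm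
      _ = I.card * (ρ' * h ^ m) := by simp
      _ ≤ (N + 1) * (ρ' * h ^ m) := by
          gcongr
          exact_mod_cast hI.trans (Nat.le_succ N)
      _ = ρ / 2 * h ^ m := by simp only [ρ']; field_simp
  have hU_fin : μ U ≠ ⊤ := ((measure_mono
    ((Set.iUnion₂_subset fun _ _ => Set.inter_subset_left).trans hS)).trans_lt
      (measure_disc_lt_top x₀ ι h)).ne
  refine ⟨S \ U, Set.sdiff_subset, hSm.diff hU, ?_, fun y hy => ?_⟩
  · have := le_measureReal_sdiff (μ := μ) (s₁ := S) (s₂ := U) hU_fin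
    linarith
  · calc min 1 ε ^ (2 * N) ≤ min 1 ε ^ (2 * I.card) :=
          pow_le_pow_of_le_one (by positivity) (min_le_left _ _) (by lia)
      _ = ∏ _ ∈ I, min 1 ε ^ 2 := by rw [Finset.prod_const, pow_mul]
      _ ≤ ∏ i ∈ I, pval (l i) y ^ 2 := by
          refine Finset.prod_le_prod (fun _ _ => by positivity) fun i hi => ?_
          have hlt : ε < |pval (l i) y| := not_le.1 fun hle =>
            hy.2 (Set.mem_iUnion₂.2 ⟨i, hi, hy.1, hle⟩)
          rw [← sq_abs (pval (l i) y)]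
          exact pow_le_pow_left₀ (by positivity) ((min_le_right _ _).trans hlt.le) 2

lemma exists_sq_le_setIntegral_weight (m n k N : ℕ) {ρ α : ℝ} (hρ : 0 < ρ) (hα : 0 < α) :
    ∃ c > 0, ∀ (d : ℕ) (x₀ : Pt d) (ι : Pt m →ₗᵢ[ℝ] Pt d), ∀ h > 0,
      ∀ S ⊆ disc x₀ ι h, MeasurableSet S → ρ * h ^ m ≤ (μHE[m] : Measure (Pt d)).real S →
      ∀ {J : Type*} (I : Finset J) (l : J → Poly d), I.card ≤ N →
        (∀ i ∈ I, (l i).totalDegree ≤ n ∧ ∃ x ∈ disc x₀ ι h, α ≤ |pval (l i) x|) →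
      ∀ Φ : Pt d → ℝ, Continuous Φ → (∀ x ∈ S, ∏ i ∈ I, pval (l i) x ^ 2 ≤ Φ x) →
      ∀ q : Poly d, q.totalDegree ≤ k → ∀ x ∈ disc x₀ ι h,
        c * (pval q x ^ 2 * h ^ m) ≤ ∫ y in S, Φ y * pval q y ^ 2 ∂μHE[m] := by
  obtain ⟨ε, hε, hprod⟩ := exists_le_prod_sq_on_large_subset m n N hρ hα
  obtain ⟨C, hC, hremez⟩ := exists_sq_le_setIntegral_disc m k (half_pos hρ)
  refine ⟨ε / C, by positivity, ?_⟩
  intro d x₀ ι h hh S hS hSm hSρ J I l hI hl Φ hΦ hlΦ q hq x hx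
  obtain ⟨E, hES, hEm, hEρ, hE⟩ := hprod d x₀ ι h hh S hS hSm hSρ I l hI hl
  have hΦ₀ : ∀ y ∈ S, 0 ≤ Φ y * pval q y ^ 2 := fun y hy =>
    mul_nonneg ((Finset.prod_nonneg fun i _ => sq_nonneg _).trans (hlΦ y hy)) (sq_nonneg _)
  have hint : IntegrableOn (fun y => Φ y * pval q y ^ 2) S μHE[m] :=
    integrableOn_of_subset_disc hS (by fun_prop)
  calc ε / C * (pval q x ^ 2 * h ^ m)
      ≤ ε / C * (C * ∫ y in E, pval q y ^ 2 ∂μHE[m]) := by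
        refine mul_le_mul_of_nonneg_left ?_ (by positivity)
        exact hremez d x₀ ι h hh q hq E (hES.trans hS) hEm hEρ x hx
    _ = ∫ y in E, ε * pval q y ^ 2 ∂μHE[m] := by rw [integral_const_mul]; field_simp
    _ ≤ ∫ y in E, Φ y * pval q y ^ 2 ∂μHE[m] := by
        refine setIntegral_mono_on (integrableOn_of_subset_disc (hES.trans hS) (by fun_prop))
          (hint.mono_set hES) hEm fun y hy => ?_
        exact mul_le_mul_of_nonneg_right ((hE y hy).trans (hlΦ y (hES hy))) (sq_nonneg _)
    _ ≤ ∫ y in S, Φ y * pval q y ^ 2 ∂μHE[m] := setIntegral_mono_set hint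
        ((ae_restrict_iff' hSm).2 (Filter.Eventually.of_forall hΦ₀))
        (Filter.Eventually.of_forall hES)

end Patch

/-! ### Oblique Fubini decomposition along a hyperplane -/

section Oblique

variable {m : ℕ}

/-- `ν` is a unit normal of the hyperplanes with direction space `range ι`. -/
structure IsUnitNormal (ι : Pt m →ₗᵢ[ℝ] Pt (m + 1)) (ν : Pt (m + 1)) : Prop where
  unit : ‖ν‖ = 1
  orthogonal : ∀ y, inner ℝ ν (ι y) = 0

/-- The coordinates `(y, u) ↦ x₀ + ι y + u w` adapted to the lines of direction `w` crossing the
plane `x₀ + range ι`. -/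
def oblique (x₀ : Pt (m + 1)) (ι : Pt m →ₗᵢ[ℝ] Pt (m + 1)) (w : Pt (m + 1)) (z : Pt m × ℝ) :
    Pt (m + 1) := chart x₀ ι z.1 + z.2 • w

/-- The points from which one meets `e` when moving in the direction `-w`. -/
def halfCylinder (e : Set (Pt m)) (w : Pt m) : Set (Pt m) := {x | ∃ u ≤ (0 : ℝ), x + u • w ∈ e}

variable {ι : Pt m →ₗᵢ[ℝ] Pt (m + 1)} {ν w : Pt (m + 1)}

/-- The orthogonal splitting `(u, y) ↦ u ν + ι y` of the space into normal and tangential part. -/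
def IsUnitNormal.splitting (hν : IsUnitNormal ι ν) : WithLp 2 (ℝ × Pt m) ≃ₗᵢ[ℝ] Pt (m + 1) :=
  LinearIsometry.toLinearIsometryEquiv
    { toLinearMap :=
        (LinearMap.toSpanSingleton ℝ (Pt (m + 1)) ν ∘ₗ LinearMap.fst ℝ ℝ (Pt m) +
          ι.toLinearMap ∘ₗ LinearMap.snd ℝ ℝ (Pt m)) ∘ₗ
          (WithLp.linearEquiv 2 ℝ (ℝ × Pt m)).toLinearMap
      norm_map' := fun z => by
        change ‖z.fst • ν + ι z.snd‖ = _
        rw [← sq_eq_sq₀ (norm_nonneg _) (norm_nonneg _), WithLp.prod_norm_sq_eq_of_L2,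
          norm_add_sq_real, inner_smul_left, hν.orthogonal, norm_smul, hν.unit, ι.norm_map]
        simp }
    (by simp [(WithLp.linearEquiv 2 ℝ (ℝ × Pt m)).finrank_eq, add_comm])

lemma IsUnitNormal.splitting_apply (hν : IsUnitNormal ι ν) (u : ℝ) (y : Pt m) :
    hν.splitting (WithLp.toLp 2 (u, y)) = u • ν + ι y := rfl

lemma IsUnitNormal.exists_eq_inner_smul_add (hν : IsUnitNormal ι ν) (w : Pt (m + 1)) :
    ∃ b, w = inner ℝ ν w • ν + ι b := by
  obtain ⟨z, rfl⟩ := hν.splitting.surjective w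
  obtain ⟨⟨u, b⟩, rfl⟩ := (WithLp.toLp_surjective 2) z
  refine ⟨b, ?_⟩
  rw [hν.splitting_apply, inner_add_right, inner_smul_right, hν.orthogonal,
    real_inner_self_eq_norm_sq, hν.unit]
  simp

lemma IsUnitNormal.measurePreserving_oblique (hν : IsUnitNormal ι ν) (x₀ : Pt (m + 1))
    (hw : inner ℝ ν w ≠ 0) :
    MeasurePreserving (oblique x₀ ι w) (volume.prod volume)
      (ENNReal.ofReal |(inner ℝ ν w)⁻¹| • volume) := by
  obtain ⟨b, hb⟩ := hν.exists_eq_inner_smul_add w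
  set c : ℝ := inner ℝ ν w
  have hscale : MeasurePreserving (fun u : ℝ => c * u) volume (ENNReal.ofReal |c⁻¹| • volume) :=
    ⟨by fun_prop, Real.map_volume_mul_left hw⟩
  have hshear : MeasurePreserving (fun z : ℝ × Pt m => (c * z.1, z.2 + z.1 • b))
      (volume.prod volume) (ENNReal.ofReal |c⁻¹| • volume.prod volume) := by
    rw [← Measure.prod_smul_left]
    exact hscale.skew_product (by fun_prop)
      (.of_forall fun u => (measurePreserving_add_right volume (u • b)).map_eq)
  have hsplit : MeasurePreserving (fun z : ℝ × Pt m => x₀ + hν.splitting (WithLp.toLp 2 z))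
      (volume.prod volume) volume :=
    (measurePreserving_add_left volume x₀).comp
      (hν.splitting.measurePreserving.comp (WithLp.volume_preserving_toLp ℝ (Pt m)))
  convert ((hsplit.smul_measure (ENNReal.ofReal |c⁻¹|)).comp hshear).comp
    (Measure.measurePreserving_swap (μ := (volume : Measure (Pt m)))
      (ν := (volume : Measure ℝ))) using 1
  ext1 ⟨y, u⟩
  simp only [Function.comp_apply, Prod.swap, hν.splitting_apply, oblique, chart, map_add, map_smul]
  conv_lhs => rw [hb]
  rw [smul_add, smul_smul, mul_comm u c]
  abel

lemma IsUnitNormal.measurableEmbedding_oblique (hν : IsUnitNormal ι ν) (x₀ : Pt (m + 1))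
    (hw : inner ℝ ν w ≠ 0) : MeasurableEmbedding (oblique x₀ ι w) := by
  have hcont : Continuous (oblique x₀ ι w) := by
    have := (isometry_chart x₀ ι).continuous
    unfold oblique
    fun_prop
  refine hcont.measurableEmbedding ?_
  rintro ⟨y, u⟩ ⟨y', u'⟩ h
  simp only [oblique, chart, add_assoc, add_right_inj] at h
  have hinner := congrArg (inner ℝ ν) h
  simp only [inner_add_right, hν.orthogonal, inner_smul_right, zero_add] at hinner
  obtain rfl : u = u' := mul_right_cancel₀ hw hinner
  rw [ι.injective (add_right_cancel h)]

lemma IsUnitNormal.volume_eq_smul_map_oblique (hν : IsUnitNormal ι ν) (x₀ : Pt (m + 1))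
    (hw : inner ℝ ν w ≠ 0) :
    (volume : Measure (Pt (m + 1))) =
      ENNReal.ofReal |inner ℝ ν w| • (volume.prod volume).map (oblique x₀ ι w) := by
  rw [(hν.measurePreserving_oblique x₀ hw).map_eq, smul_smul,
    ← ENNReal.ofReal_mul (abs_nonneg _), ← abs_mul, mul_inv_cancel₀ hw]
  simp

lemma IsUnitNormal.ae_forall_add_smul_notMem (hν : IsUnitNormal ι ν) {x₀ : Pt (m + 1)}
    (hw : inner ℝ ν w ≠ 0) {Z : Set (Pt (m + 1))} (hZ : Z ⊆ Set.range (chart x₀ ι))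
    (hnull : volume (chart x₀ ι ⁻¹' Z) = 0) : ∀ᵐ x, ∀ u : ℝ, x + u • w ∉ Z := by
  have hemb := hν.measurableEmbedding_oblique x₀ hw
  have hcylinder : volume (oblique x₀ ι w '' ((chart x₀ ι ⁻¹' Z) ×ˢ Set.univ)) = 0 := by
    rw [hν.volume_eq_smul_map_oblique x₀ hw, Measure.smul_apply, hemb.map_apply,
      Set.preimage_image_eq _ hemb.injective, Measure.prod_prod, hnull, zero_mul, smul_zero]
  filter_upwards [measure_eq_zero_iff_ae_notMem.1 hcylinder] with x hx u hu
  obtain ⟨y, hy⟩ := hZ hu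
  exact hx ⟨(y, -u), ⟨by rwa [Set.mem_preimage, hy], trivial⟩, by simp [oblique, hy]⟩

lemma halfCylinder_eq_image_oblique {x₀ : Pt (m + 1)} {e : Set (Pt (m + 1))}
    (he : e ⊆ Set.range (chart x₀ ι)) :
    halfCylinder e w = oblique x₀ ι w '' ((chart x₀ ι ⁻¹' e) ×ˢ Set.Ici 0) := by
  ext x
  constructor
  · rintro ⟨u, hu0, hu⟩
    obtain ⟨y, hy⟩ := he hu
    exact ⟨(y, -u), ⟨by rwa [Set.mem_preimage, hy], by simpa using hu0⟩, by simp [oblique, hy]⟩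
  · rintro ⟨⟨y, u⟩, ⟨hy, hu⟩, rfl⟩
    exact ⟨-u, by simpa using hu, by simpa [oblique] using hy⟩

lemma IsUnitNormal.measurableSet_halfCylinder (hν : IsUnitNormal ι ν) {x₀ : Pt (m + 1)}
    (hw : inner ℝ ν w ≠ 0) {e : Set (Pt (m + 1))} (he : e ⊆ Set.range (chart x₀ ι))
    (hem : MeasurableSet e) : MeasurableSet (halfCylinder e w) := by
  rw [halfCylinder_eq_image_oblique he]
  exact (hν.measurableEmbedding_oblique x₀ hw).measurableSet_image.2
    (((measurableEmbedding_chart x₀ ι).measurable hem).prod measurableSet_Ici)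

lemma isClosedEmbedding_add_smul {E : Type*} [NormedAddCommGroup E] [NormedSpace ℝ E] (x : E)
    {w : E} (hw : w ≠ 0) : Topology.IsClosedEmbedding fun u : ℝ => x + u • w :=
  (Homeomorph.addLeft x).isClosedEmbedding.comp (isClosedEmbedding_smul_left hw)

section Derivative

variable {E : Type*} [NormedAddCommGroup E] [NormedSpace ℝ E] {f : E → ℝ}

lemma continuous_fderiv_apply (hf : ContDiff ℝ 1 f) (w : E) :
    Continuous fun x => fderiv ℝ f x w :=
  (hf.continuous_fderiv one_ne_zero).clm_apply continuous_const

lemma integrable_fderiv_apply [MeasurableSpace E] [OpensMeasurableSpace E] {μ : Measure E}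
    [IsFiniteMeasureOnCompacts μ] (hf : ContDiff ℝ 1 f) (hfs : HasCompactSupport f) (w : E) :
    Integrable (fun x => fderiv ℝ f x w) μ :=
  (continuous_fderiv_apply hf w).integrable_of_hasCompactSupport
    ((hfs.fderiv ℝ).comp_left (g := fun L : E →L[ℝ] ℝ => L w) (by simp))

lemma integral_Ioi_fderiv_add_smul (hf : ContDiff ℝ 1 f) (hfs : HasCompactSupport f) {w : E}
    (hw : w ≠ 0) (x : E) : ∫ u in Set.Ioi (0 : ℝ), fderiv ℝ f (x + u • w) w = -f x := by
  have hline : ContDiff ℝ 1 fun u : ℝ => f (x + u • w) := hf.comp (by fun_prop)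
  have hderiv : ∀ u : ℝ, fderiv ℝ f (x + u • w) w = deriv (fun u : ℝ => f (x + u • w)) u := by
    intro u
    have hmove : HasDerivAt (fun u : ℝ => x + u • w) w u := by
      simpa using ((hasDerivAt_id u).smul_const w).const_add x
    exact ((hf.differentiable one_ne_zero (x + u • w)).hasFDerivAt.comp_hasDerivAt u
      hmove).deriv.symm
  simp only [hderiv]
  rw [HasCompactSupport.integral_Ioi_deriv_eq hline
    (hfs.comp_isClosedEmbedding (isClosedEmbedding_add_smul x hw))]
  simp

end Derivative

lemma IsUnitNormal.setIntegral_halfCylinder_fderiv (hν : IsUnitNormal ι ν) {x₀ : Pt (m + 1)}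
    (hw : inner ℝ ν w ≠ 0) {e : Set (Pt (m + 1))} (he : e ⊆ Set.range (chart x₀ ι))
    {f : Pt (m + 1) → ℝ} (hf : ContDiff ℝ 1 f) (hfs : HasCompactSupport f) :
    ∫ x in halfCylinder e w, fderiv ℝ f x w = -(|inner ℝ ν w| * ∫ x in e, f x ∂μHE[m]) := by
  have hemb := hν.measurableEmbedding_oblique x₀ hw
  have hw0 : w ≠ 0 := by rintro rfl; simp at hw
  have hint : Integrable (fun z => fderiv ℝ f (oblique x₀ ι w z) w)
      ((volume : Measure (Pt m)).prod volume) := by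
    have hmap := (integrable_fderiv_apply (μ := volume) hf hfs w).smul_measure
      (c := ENNReal.ofReal |(inner ℝ ν w)⁻¹|) ENNReal.ofReal_ne_top
    rw [← (hν.measurePreserving_oblique x₀ hw).map_eq] at hmap
    exact hemb.integrable_map_iff.1 hmap
  have hfiber : ∀ y, ∫ u in Set.Ici (0 : ℝ), fderiv ℝ f (oblique x₀ ι w (y, u)) w =
      -f (chart x₀ ι y) := fun y => by
    rw [integral_Ici_eq_integral_Ioi]
    exact integral_Ioi_fderiv_add_smul hf hfs hw0 (chart x₀ ι y)
  rw [halfCylinder_eq_image_oblique he, hν.volume_eq_smul_map_oblique x₀ hw,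
    Measure.restrict_smul, integral_smul_measure, hemb.restrict_map, hemb.integral_map,
    Set.preimage_image_eq _ hemb.injective, setIntegral_prod _ hint.integrableOn,
    ENNReal.toReal_ofReal (abs_nonneg _), smul_eq_mul, setIntegral_chart x₀ ι he]
  simp only [hfiber, integral_neg, mul_neg]

end Oblique

/-! ### Charts of flat faces -/

section FaceChart

variable {m : ℕ}

lemma exists_affineMap_eq_chart {d : ℕ} (x₀ : Pt d) (ι : Pt m →ₗᵢ[ℝ] Pt d) :
    ∃ A : Pt m →ᵃ[ℝ] Pt d, ⇑A = chart x₀ ι :=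
  ⟨AffineMap.const ℝ (Pt m) x₀ + ι.toLinearMap.toAffineMap, funext fun y => by simp [chart]⟩

/-- The chart `y ↦ x₀ + ι y` parametrizes the hyperplane spanned by `e`, and `x₀` is a relative
interior point of `e`. -/
structure IsFaceChart (e : Set (Pt (m + 1))) (x₀ : Pt (m + 1))
    (ι : Pt m →ₗᵢ[ℝ] Pt (m + 1)) : Prop where
  base : x₀ ∈ intrinsicInterior ℝ e
  range_eq : Set.range (chart x₀ ι) = (affineSpan ℝ e : Set (Pt (m + 1)))

lemma IsFlatFace.exists_isFaceChart {e : Set (Pt (m + 1))} (he : IsFlatFace e) :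
    ∃ x₀ ι, IsFaceChart e x₀ ι := by
  obtain ⟨x₀, hx₀⟩ := he.connected.nonempty
  have hdim : finrank ℝ (vectorSpan ℝ e) = m := by have := he.hyperplane; omega
  let L : Pt m ≃ₗᵢ[ℝ] vectorSpan ℝ e :=
    ((stdOrthonormalBasis ℝ (vectorSpan ℝ e)).reindex (finCongr hdim)).repr.symm
  have hx : x₀ ∈ affineSpan ℝ e := subset_affineSpan ℝ e (intrinsicInterior_subset hx₀)
  refine ⟨x₀, (vectorSpan ℝ e).subtypeₗᵢ.comp L.toLinearIsometry, hx₀, Set.ext fun x => ?_⟩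
  rw [SetLike.mem_coe, ← AffineSubspace.vsub_right_mem_direction_iff_mem hx, direction_affineSpan]
  constructor
  · rintro ⟨y, rfl⟩
    simp [chart]
  · intro hxe
    exact ⟨L.symm ⟨x -ᵥ x₀, hxe⟩, by simp [chart]⟩

lemma IsFlatFace.isClosed {d : ℕ} {e : Set (Pt d)} (he : IsFlatFace e) : IsClosed e :=
  he.regular ▸ isClosed_closure

lemma IsOutwardNormal.affineSpan_ne_top {d : ℕ} {T e : Set (Pt d)} {ν : Pt d}
    (hν : IsOutwardNormal T e ν) : affineSpan ℝ e ≠ ⊤ := by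
  intro htop
  have hself := hν.orthogonal ν (by
    rw [← direction_affineSpan, htop, AffineSubspace.direction_top]; trivial)
  rw [real_inner_self_eq_norm_sq, hν.unit] at hself
  norm_num at hself

variable {e : Set (Pt (m + 1))} {x₀ : Pt (m + 1)} {ι : Pt m →ₗᵢ[ℝ] Pt (m + 1)}

lemma IsFaceChart.subset_range (h : IsFaceChart e x₀ ι) : e ⊆ Set.range (chart x₀ ι) := by
  rw [h.range_eq]
  exact subset_affineSpan ℝ e

lemma IsFaceChart.base_mem (h : IsFaceChart e x₀ ι) : x₀ ∈ e := intrinsicInterior_subset h.base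

lemma IsFaceChart.isUnitNormal (h : IsFaceChart e x₀ ι) {T : Set (Pt (m + 1))} {ν : Pt (m + 1)}
    (hν : IsOutwardNormal T e ν) : IsUnitNormal ι ν where
  unit := hν.unit
  orthogonal y := hν.orthogonal _ <| by
    have hy : chart x₀ ι y ∈ affineSpan ℝ e := h.range_eq.subset (Set.mem_range_self y)
    rw [← direction_affineSpan]
    simpa [chart] using
      AffineSubspace.vsub_mem_direction hy (subset_affineSpan ℝ e h.base_mem)

lemma IsFaceChart.mem_affineSpan_iff (h : IsFaceChart e x₀ ι) {ν : Pt (m + 1)}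
    (hν : IsUnitNormal ι ν) {x : Pt (m + 1)} :
    x ∈ affineSpan ℝ e ↔ inner ℝ ν (x - x₀) = 0 := by
  rw [← SetLike.mem_coe, ← h.range_eq]
  constructor
  · rintro ⟨y, rfl⟩
    simpa [chart] using hν.orthogonal y
  · intro hx
    obtain ⟨b, hb⟩ := hν.exists_eq_inner_smul_add (x - x₀)
    rw [hx, zero_smul, zero_add] at hb
    exact ⟨b, by rw [chart, ← hb]; abel⟩

lemma IsFaceChart.intrinsicInterior_eq (h : IsFaceChart e x₀ ι) :
    intrinsicInterior ℝ e = chart x₀ ι '' interior (chart x₀ ι ⁻¹' e) := by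
  have hmem : ∀ y, chart x₀ ι y ∈ affineSpan ℝ e := fun y => h.range_eq.subset ⟨y, rfl⟩
  let a : Pt m → affineSpan ℝ e := fun y => ⟨chart x₀ ι y, hmem y⟩
  have ha : Isometry a := fun y z => isometry_chart x₀ ι y z
  have hsurj : Function.Surjective a := fun ⟨x, hx⟩ => by
    obtain ⟨y, rfl⟩ := h.range_eq.superset hx
    exact ⟨y, rfl⟩
  let H : Pt m ≃ₜ affineSpan ℝ e :=
    (IsometryEquiv.mk (Equiv.ofBijective a ⟨ha.injective, hsurj⟩) ha).toHomeomorph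
  rw [show chart x₀ ι ⁻¹' e = H ⁻¹' (Subtype.val ⁻¹' e) from rfl, ← H.preimage_interior,
    show chart x₀ ι = Subtype.val ∘ H from rfl, Set.image_comp,
    Set.image_preimage_eq _ H.surjective, intrinsicInterior]

lemma IsFaceChart.volume_diff_intrinsicInterior (h : IsFaceChart e x₀ ι) (he : IsPolytopal e) :
    volume (chart x₀ ι ⁻¹' (e \ intrinsicInterior ℝ e)) = 0 := by
  obtain ⟨S, hS⟩ := he
  obtain ⟨A, hA⟩ := exists_affineMap_eq_chart x₀ ι
  have hconv : ∀ s : Finset (Pt (m + 1)),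
      Convex ℝ (chart x₀ ι ⁻¹' convexHull ℝ (s : Set (Pt (m + 1)))) := fun s => by
    rw [← hA]
    exact (convex_convexHull ℝ (s : Set (Pt (m + 1)))).affine_preimage A
  have hpiece : ∀ s ∈ S, convexHull ℝ (s : Set (Pt (m + 1))) ⊆ e := fun s hs =>
    hS ▸ Set.subset_iUnion₂_of_subset s hs subset_rfl
  have hsub : chart x₀ ι ⁻¹' (e \ intrinsicInterior ℝ e) ⊆
      ⋃ s ∈ S, frontier (chart x₀ ι ⁻¹' convexHull ℝ (s : Set (Pt (m + 1)))) := by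
    rintro y ⟨hy, hyi⟩
    obtain ⟨s, hs, hys⟩ := Set.mem_iUnion₂.1 (hS ▸ hy)
    refine Set.mem_iUnion₂.2 ⟨s, hs, subset_closure hys, fun hint => hyi ?_⟩
    rw [h.intrinsicInterior_eq]
    exact ⟨y, interior_mono (Set.preimage_mono (hpiece s hs)) hint, rfl⟩
  refine measure_mono_null hsub ?_
  exact (measure_biUnion_null_iff S.countable_toSet).2 fun s _ => (hconv s).addHaar_frontier volume

end FaceChart

/-! ### The divergence theorem on a polytopal element -/

section Line

open Filter Topology

lemma exists_eq_of_eventually_punctured_const {α : Type*} {J : ℝ → α}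
    (h : ∀ v, ∃ a, ∀ᶠ v' in 𝓝[≠] v, J v' = a) : ∃ a, ∀ v, ∀ᶠ v' in 𝓝[≠] v, J v' = a := by
  choose J' hJ' using h
  have hloc : IsLocallyConstant J' := by
    rw [IsLocallyConstant.iff_eventually_eq]
    intro v
    filter_upwards [eventually_eventually_nhds.2 (eventually_nhdsWithin_iff.1 (hJ' v))]
      with v' hv'
    by_cases hvv : v' = v
    · rw [hvv]
    have hnear : ∀ᶠ z in 𝓝[≠] v', J z = J' v := by
      filter_upwards [nhdsWithin_le_nhds hv', nhdsWithin_le_nhds (isOpen_ne.eventually_mem hvv)]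
        with z hz hzv using hz hzv
    obtain ⟨z, hz, hz'⟩ := (hnear.and (hJ' v')).exists
    exact hz'.symm.trans hz
  refine ⟨J' 0, fun v => ?_⟩
  rw [hloc.apply_eq_of_preconnectedSpace 0 v]
  exact hJ' v

variable {m : ℕ} {e : Set (Pt m)} {x w : Pt m} {v : ℝ}

lemma add_smul_mem_halfCylinder_iff :
    x + v • w ∈ halfCylinder e w ↔ ∃ u ≤ v, x + u • w ∈ e := by
  constructor
  · rintro ⟨u, hu, hmem⟩
    exact ⟨v + u, by linarith, by rwa [add_smul, ← add_assoc]⟩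
  · rintro ⟨u, hu, hmem⟩
    exact ⟨u - v, by linarith, by rwa [add_assoc, ← add_smul, add_sub_cancel]⟩

lemma eventually_mem_halfCylinder_iff (he : IsClosed e) (hv : x + v • w ∉ e) :
    ∀ᶠ v' in 𝓝 v, x + v' • w ∈ halfCylinder e w ↔ x + v • w ∈ halfCylinder e w := by
  have hmiss : ∀ᶠ v' in 𝓝 v, x + v' • w ∉ e :=
    (by fun_prop : Continuous fun v' : ℝ => x + v' • w).continuousAt.eventually
      (he.isOpen_compl.eventually_mem hv)
  obtain ⟨l, r, hlr, hsub⟩ := mem_nhds_iff_exists_Ioo_subset.1 hmiss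
  have hleft : ∀ u, x + u • w ∈ e → ∀ v' ∈ Set.Ioo l r, u ≤ v' → u ≤ l := fun u hu v' hv' huv =>
    not_lt.1 fun hlu => hsub ⟨hlu, huv.trans_lt hv'.2⟩ hu
  filter_upwards [Ioo_mem_nhds hlr.1 hlr.2] with v' hv'
  simp only [add_smul_mem_halfCylinder_iff]
  exact ⟨fun ⟨u, huv, hu⟩ => ⟨u, (hleft u hu v' hv' huv).trans hlr.1.le, hu⟩,
    fun ⟨u, huv, hu⟩ => ⟨u, (hleft u hu v hlr huv).trans hv'.1.le, hu⟩⟩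

end Line

section Divergence

open Filter Topology

lemma subset_of_isPreconnected_of_disjoint_frontier {X : Type*} [TopologicalSpace X]
    {s T : Set X} (hs : IsPreconnected s) (hfr : Disjoint s (frontier T))
    (hne : (s ∩ T).Nonempty) : s ⊆ T := by
  have hcover : s ⊆ interior T ∪ (closure T)ᶜ := fun z hz => by
    by_contra h
    simp only [Set.mem_union, Set.mem_compl_iff, not_or, not_not] at h
    exact Set.disjoint_left.1 hfr hz ⟨h.2, h.1⟩
  obtain ⟨x, hxs, hxT⟩ := hne
  have hx : x ∈ interior T :=
    (hcover hxs).resolve_right fun h => h (subset_closure hxT)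
  exact (hs.subset_left_of_subset_union isOpen_interior isClosed_closure.isOpen_compl
    (Set.disjoint_compl_right_iff_subset.2 interior_subset_closure) hcover
    ⟨x, hxs, hx⟩).trans interior_subset

lemma eventually_mem_iff_of_notMem_frontier {X : Type*} [TopologicalSpace X] {T : Set X} {x : X}
    (hx : x ∉ frontier T) : ∀ᶠ y in 𝓝 x, y ∈ T ↔ x ∈ T := by
  by_cases hin : x ∈ interior T
  · filter_upwards [isOpen_interior.eventually_mem hin] with y hy
    exact iff_of_true (interior_subset hy) (interior_subset hin)
  · have hcl : x ∉ closure T := fun h => hx ⟨h, hin⟩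
    filter_upwards [isClosed_closure.isOpen_compl.eventually_mem hcl] with y hy
    exact iff_of_false (fun h => hy (subset_closure h)) fun h => hcl (subset_closure h)

lemma isPreconnected_halfBall {E : Type*} [NormedAddCommGroup E] [InnerProductSpace ℝ E]
    (z ν : E) (ε : ℝ) : IsPreconnected (Metric.ball z ε ∩ {y | 0 < inner ℝ ν (y - z)}) := by
  simp only [inner_sub_right, sub_pos]
  exact ((convex_ball z ε).inter
    (convex_halfSpace_gt (innerₛₗ ℝ ν).isLinear _)).isPreconnected

variable {m : ℕ} {T : Set (Pt m)} {F : Finset (Set (Pt m))} {ν : Set (Pt m) → Pt m}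

lemma IsOutwardNormal.eventually_side {e : Set (Pt m)} {n : Pt m} (hn : IsOutwardNormal T e n)
    {z : Pt m} (hz : z ∈ intrinsicInterior ℝ e)
    (hfr : ∀ᶠ y in 𝓝 z, y ∈ frontier T → inner ℝ n (y - z) = 0) :
    ∀ᶠ y in 𝓝 z, (0 < inner ℝ n (y - z) → y ∉ T) ∧ (inner ℝ n (y - z) < 0 → y ∈ T) := by
  obtain ⟨ε, hε, hball⟩ := Metric.eventually_nhds_iff_ball.1 hfr
  have hinner : ∀ t : ℝ, inner ℝ n (t • n) = t := fun t => by
    rw [inner_smul_right, real_inner_self_eq_norm_sq, hn.unit]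
    simp
  have hmem : ∀ t ∈ Set.Ioo 0 ε, z + t • n ∈ Metric.ball z ε ∧ z - t • n ∈ Metric.ball z ε :=
    fun t ht => by simpa [norm_smul, hn.unit, abs_of_pos ht.1] using ht.2
  obtain ⟨η, hη, hout⟩ := hn.outside z hz
  obtain ⟨η', hη', hin⟩ := hn.inside z hz
  obtain ⟨t, ht0, ht⟩ := exists_between (lt_min hε (lt_min hη hη'))
  simp only [lt_min_iff] at ht
  filter_upwards [Metric.ball_mem_nhds z hε] with y hy
  constructor
  · intro hpos hyT
    refine hout t ht0 ht.2.1 (subset_of_isPreconnected_of_disjoint_frontier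
      (isPreconnected_halfBall z n ε) (Set.disjoint_left.2 fun a ha haf => ?_) ⟨y, ⟨hy, hpos⟩, hyT⟩
      ⟨(hmem t ⟨ht0, ht.1⟩).1, ?_⟩)
    · exact ha.2.ne' (hball a ha.1 haf)
    · simpa [hinner] using ht0
  · intro hneg
    refine subset_of_isPreconnected_of_disjoint_frontier
      (isPreconnected_halfBall z (-n) ε) (Set.disjoint_left.2 fun a ha haf => ?_)
      ⟨z - t • n, ⟨(hmem t ⟨ht0, ht.1⟩).2, ?_⟩, hin t ht0 ht.2.2⟩ ⟨hy, by simpa using hneg⟩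
    · have hpos : 0 < inner ℝ (-n) (a - z) := ha.2
      rw [inner_neg_left, hball a ha.1 haf, neg_zero] at hpos
      exact hpos.false
    · simpa [hinner] using ht0

/-- A closed bounded set whose boundary consists of finitely many flat faces `e ∈ F`, no two of
them in a common hyperplane, with outward unit normals `ν e`. -/
structure IsFacetedBody (T : Set (Pt m)) (F : Finset (Set (Pt m))) (ν : Set (Pt m) → Pt m) :
    Prop where
  isClosed : IsClosed T
  isBounded : Bornology.IsBounded T
  frontier_eq : frontier T = ⋃ e ∈ F, e
  flat : ∀ e ∈ F, IsFlatFace e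
  normal : ∀ e ∈ F, IsOutwardNormal T e (ν e)
  noncoplanar : ∀ e ∈ F, ∀ e' ∈ F, e ≠ e' → ∃ x ∈ e, x ∉ affineSpan ℝ e'

namespace IsFacetedBody

lemma subset_frontier (hT : IsFacetedBody T F ν) {e : Set (Pt m)} (he : e ∈ F) :
    e ⊆ frontier T := by
  rw [hT.frontier_eq]
  exact Set.subset_biUnion_of_mem (u := fun e => e) he

lemma subset (hT : IsFacetedBody T F ν) {e : Set (Pt m)} (he : e ∈ F) : e ⊆ T :=
  (hT.subset_frontier he).trans hT.isClosed.frontier_subset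

lemma inner_eq_zero (hT : IsFacetedBody T F ν) {e : Set (Pt m)} (he : e ∈ F)
    {x z : Pt m} (hx : x ∈ e) (hz : z ∈ e) : inner ℝ (ν e) (x - z) = 0 :=
  (hT.normal e he).orthogonal _ (vsub_mem_vectorSpan ℝ hx hz)

lemma eventually_side (hT : IsFacetedBody T F ν) {e : Set (Pt m)} (he : e ∈ F) {z : Pt m}
    (hz : z ∈ intrinsicInterior ℝ e) (honly : ∀ e' ∈ F, z ∈ e' → e' = e) :
    ∀ᶠ y in 𝓝 z, (0 < inner ℝ (ν e) (y - z) → y ∉ T) ∧ (inner ℝ (ν e) (y - z) < 0 → y ∈ T) := by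
  have hmiss : ∀ᶠ y in 𝓝 z, ∀ e' ∈ F, y ∈ e' → e' = e := by
    refine (eventually_all_finset F).2 fun e' he' => ?_
    by_cases hze' : z ∈ e'
    · exact .of_forall fun _ _ => honly e' he' hze'
    · filter_upwards [(hT.flat e' he').isClosed.isOpen_compl.eventually_mem hze'] with y hy hye'
      exact (hy hye').elim
  refine (hT.normal e he).eventually_side hz (hmiss.mono fun y hy hyf => ?_)
  rw [hT.frontier_eq] at hyf
  obtain ⟨e', he', hye'⟩ := Set.mem_iUnion₂.1 hyf
  obtain rfl := hy e' he' hye'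
  exact hT.inner_eq_zero he hye' (intrinsicInterior_subset hz)

lemma eq_of_add_smul_mem (hT : IsFacetedBody T F ν) {e : Set (Pt m)} (he : e ∈ F)
    {w x : Pt m} (hw : inner ℝ (ν e) w ≠ 0) {u u' : ℝ} (hu : x + u • w ∈ e)
    (hu' : x + u' • w ∈ e) : u = u' := by
  have hzero := hT.inner_eq_zero he hu hu'
  rw [add_sub_add_left_eq_sub, ← sub_smul, inner_smul_right, mul_eq_zero] at hzero
  exact sub_eq_zero.1 (hzero.resolve_right hw)

end IsFacetedBody

/-- The line `x + ℝ w` is in general position: it crosses each face transversally, at a relative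
interior point lying on no other face, and not at its base point `x`. -/
structure IsGenericLine (F : Finset (Set (Pt m))) (ν : Set (Pt m) → Pt m) (w x : Pt m) :
    Prop where
  transverse : ∀ e ∈ F, ∀ u : ℝ, x + u • w ∈ e → inner ℝ (ν e) w ≠ 0
  interior : ∀ e ∈ F, ∀ u : ℝ, x + u • w ∈ e → x + u • w ∈ intrinsicInterior ℝ e
  unique : ∀ e ∈ F, ∀ e' ∈ F, ∀ u : ℝ, x + u • w ∈ e → x + u • w ∈ e' → e' = e
  base : ∀ e ∈ F, x ∉ e

/-- The indicator of `T` plus the number of faces crossed by the half-line `x - [0, ∞) w`, where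
exits from `T` in the direction `w` count `1` and entries `-1`. -/
def crossingBalance (T : Set (Pt m)) (F : Finset (Set (Pt m))) (ν : Set (Pt m) → Pt m)
    (w x : Pt m) : ℝ :=
  T.indicator 1 x + ∑ e ∈ F, Real.sign (inner ℝ (ν e) w) * (halfCylinder e w).indicator 1 x

namespace IsFacetedBody

variable {w x : Pt m} {v : ℝ}

lemma eventually_indicator_halfCylinder_eq (hT : IsFacetedBody T F ν) {e : Set (Pt m)}
    (he : e ∈ F) (hv : x + v • w ∉ e) :
    ∀ᶠ v' in 𝓝 v, (halfCylinder e w).indicator (1 : Pt m → ℝ) (x + v' • w) =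
      (halfCylinder e w).indicator 1 (x + v • w) :=
  (eventually_mem_halfCylinder_iff (hT.flat e he).isClosed hv).mono fun _ hv' =>
    Set.indicator_eq_indicator hv' rfl

lemma eventually_crossingBalance_eq (hT : IsFacetedBody T F ν) (hv : ∀ e ∈ F, x + v • w ∉ e) :
    ∀ᶠ v' in 𝓝 v, crossingBalance T F ν w (x + v' • w) = crossingBalance T F ν w (x + v • w) := by
  have hcont : ContinuousAt (fun v' : ℝ => x + v' • w) v := by fun_prop
  have hfr : x + v • w ∉ frontier T := by
    simpa only [hT.frontier_eq, Set.mem_iUnion, not_exists] using hv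
  filter_upwards [hcont.eventually (eventually_mem_iff_of_notMem_frontier hfr),
    (eventually_all_finset F).2 fun e he => hT.eventually_indicator_halfCylinder_eq he (hv e he)]
    with v' hbody hfaces
  simp only [crossingBalance]
  congr 1
  · exact Set.indicator_eq_indicator hbody rfl
  · exact Finset.sum_congr rfl fun e he => by rw [hfaces e he]

lemma indicator_halfCylinder_of_mem (hT : IsFacetedBody T F ν) {e : Set (Pt m)} (he : e ∈ F)
    (hw : inner ℝ (ν e) w ≠ 0) (hv : x + v • w ∈ e) (v' : ℝ) :
    (halfCylinder e w).indicator (1 : Pt m → ℝ) (x + v' • w) = if v ≤ v' then 1 else 0 := by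
  have hmem : x + v' • w ∈ halfCylinder e w ↔ v ≤ v' := by
    rw [add_smul_mem_halfCylinder_iff]
    exact ⟨fun ⟨u, huv, hu⟩ => hT.eq_of_add_smul_mem he hw hu hv ▸ huv, fun h => ⟨v, h, hv⟩⟩
  simp only [Set.indicator, hmem, Pi.one_apply]

/-- The jumps of the indicator of `T` and of the contribution of `e` cancel. -/
lemma eventually_indicator_add_sign_mul_eq (hT : IsFacetedBody T F ν) {e : Set (Pt m)}
    (he : e ∈ F) (hw : inner ℝ (ν e) w ≠ 0) (hv : x + v • w ∈ intrinsicInterior ℝ e)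
    (honly : ∀ e' ∈ F, x + v • w ∈ e' → e' = e) :
    ∀ᶠ v' in 𝓝[≠] v, T.indicator 1 (x + v' • w) + Real.sign (inner ℝ (ν e) w) *
      (halfCylinder e w).indicator 1 (x + v' • w) = if 0 < inner ℝ (ν e) w then 1 else 0 := by
  have hcont : ContinuousAt (fun v' : ℝ => x + v' • w) v := by fun_prop
  filter_upwards [nhdsWithin_le_nhds (hcont.eventually (hT.eventually_side he hv honly)),
    self_mem_nhdsWithin] with v' hside hne
  rw [add_sub_add_left_eq_sub, ← sub_smul, inner_smul_right] at hside
  rw [hT.indicator_halfCylinder_of_mem he hw (intrinsicInterior_subset hv)]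
  rcases lt_or_gt_of_ne hw with hneg | hpos <;> rcases lt_or_gt_of_ne hne with hlt | hgt
  · have hout := hside.1 (mul_pos_of_neg_of_neg (sub_neg.2 hlt) hneg)
    simp [hout, hlt.not_ge, hneg.not_gt]
  · have hin := hside.2 (mul_neg_of_pos_of_neg (sub_pos.2 hgt) hneg)
    simp [hin, hgt.le, hneg.not_gt, Real.sign_of_neg hneg]
  · have hin := hside.2 (mul_neg_of_neg_of_pos (sub_neg.2 hlt) hpos)
    simp [hin, hlt.not_ge, hpos]
  · have hout := hside.1 (mul_pos (sub_pos.2 hgt) hpos)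
    simp [hout, hgt.le, hpos, Real.sign_of_pos hpos]

lemma exists_eventually_crossingBalance_eq (hT : IsFacetedBody T F ν)
    (hx : IsGenericLine F ν w x) (v : ℝ) :
    ∃ a, ∀ᶠ v' in 𝓝[≠] v, crossingBalance T F ν w (x + v' • w) = a := by
  classical
  by_cases hv : ∀ e ∈ F, x + v • w ∉ e
  · exact ⟨_, nhdsWithin_le_nhds (hT.eventually_crossingBalance_eq hv)⟩
  push Not at hv
  obtain ⟨e, he, hve⟩ := hv
  have honly := fun e' he' => hx.unique e he e' he' v hve
  have hrest : ∀ᶠ v' in 𝓝 v, ∀ e' ∈ F.erase e,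
      (halfCylinder e' w).indicator (1 : Pt m → ℝ) (x + v' • w) =
        (halfCylinder e' w).indicator 1 (x + v • w) :=
    (eventually_all_finset _).2 fun e' he' =>
      hT.eventually_indicator_halfCylinder_eq (Finset.mem_of_mem_erase he')
        fun hve' => Finset.ne_of_mem_erase he' (honly e' (Finset.mem_of_mem_erase he') hve')
  refine ⟨(if 0 < inner ℝ (ν e) w then 1 else 0) + ∑ e' ∈ F.erase e,
    Real.sign (inner ℝ (ν e') w) * (halfCylinder e' w).indicator 1 (x + v • w), ?_⟩
  filter_upwards [nhdsWithin_le_nhds hrest, hT.eventually_indicator_add_sign_mul_eq he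
    (hx.transverse e he v hve) (hx.interior e he v hve) honly] with v' hrest hjump
  rw [crossingBalance, ← Finset.add_sum_erase F _ he, ← add_assoc, hjump]
  exact congrArg _ (Finset.sum_congr rfl fun e' he' => by rw [hrest e' he'])

lemma exists_forall_le_add_smul_notMem (hT : IsFacetedBody T F ν) (hw : w ≠ 0) (x : Pt m) :
    ∃ b : ℝ, ∀ v ≤ b, x + v • w ∉ T := by
  have hcompact : IsCompact T := Metric.isCompact_of_isClosed_isBounded hT.isClosed hT.isBounded
  obtain ⟨b, hb⟩ := ((isClosedEmbedding_add_smul x hw).isCompact_preimage hcompact).bddBelow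
  exact ⟨b - 1, fun v hv hmem => by linarith [hb hmem]⟩

lemma crossingBalance_eq_zero (hT : IsFacetedBody T F ν) (hw : w ≠ 0)
    (hx : IsGenericLine F ν w x) : crossingBalance T F ν w x = 0 := by
  obtain ⟨a, ha⟩ := exists_eq_of_eventually_punctured_const
    (J := fun v => crossingBalance T F ν w (x + v • w)) (hT.exists_eventually_crossingBalance_eq hx)
  have hvalue : ∀ v : ℝ, (∀ e ∈ F, x + v • w ∉ e) → crossingBalance T F ν w (x + v • w) = a := by
    intro v hv
    obtain ⟨v', hv'a, hv'⟩ :=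
      ((ha v).and (nhdsWithin_le_nhds (hT.eventually_crossingBalance_eq hv))).exists
    exact hv'.symm.trans hv'a
  obtain ⟨b, hb⟩ := hT.exists_forall_le_add_smul_notMem hw x
  have hfar : crossingBalance T F ν w (x + b • w) = 0 := by
    rw [crossingBalance, Set.indicator_of_notMem (hb b le_rfl), zero_add]
    refine Finset.sum_eq_zero fun e he => ?_
    rw [Set.indicator_of_notMem, mul_zero]
    rw [add_smul_mem_halfCylinder_iff]
    exact fun ⟨u, hub, hu⟩ => hb u hub (hT.subset he hu)
  have hbase := hvalue 0 (by simpa using hx.base)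
  rw [zero_smul, add_zero] at hbase
  rw [hbase, ← hvalue b fun e he hmem => hb b le_rfl (hT.subset he hmem), hfar]

end IsFacetedBody

end Divergence

section DivergenceTheorem

open Filter Topology

variable {m : ℕ} {T : Set (Pt (m + 1))} {F : Finset (Set (Pt (m + 1)))}
  {ν : Set (Pt (m + 1)) → Pt (m + 1)}

namespace IsFacetedBody

lemma volume_affineSpan_eq_zero (hT : IsFacetedBody T F ν) {e : Set (Pt (m + 1))} (he : e ∈ F) :
    volume (affineSpan ℝ e : Set (Pt (m + 1))) = 0 :=
  Measure.addHaar_affineSubspace volume _ (hT.normal e he).affineSpan_ne_top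

lemma ae_transverse (hT : IsFacetedBody T F ν) (w : Pt (m + 1)) :
    ∀ᵐ x, ∀ e ∈ F, ∀ u : ℝ, x + u • w ∈ e → inner ℝ (ν e) w ≠ 0 := by
  refine (F.eventually_all (l := ae volume)).2 fun e he => ?_
  obtain ⟨x₀, ι, hch⟩ := (hT.flat e he).exists_isFaceChart
  have hν := hch.isUnitNormal (hT.normal e he)
  filter_upwards [measure_eq_zero_iff_ae_notMem.1 (hT.volume_affineSpan_eq_zero he)]
    with x hx u hu hw
  refine hx ((hch.mem_affineSpan_iff hν).2 ?_)
  have hspan := (hch.mem_affineSpan_iff hν).1 (subset_affineSpan ℝ e hu)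
  rwa [add_sub_right_comm, inner_add_right, inner_smul_right, hw, mul_zero, add_zero] at hspan

lemma ae_forall_add_smul_notMem (hT : IsFacetedBody T F ν) {e : Set (Pt (m + 1))} (he : e ∈ F)
    (w : Pt (m + 1)) {Z : Set (Pt (m + 1))} (hZ : Z ⊆ e)
    (hnull : ∀ x₀ ι, IsFaceChart e x₀ ι → volume (chart x₀ ι ⁻¹' Z) = 0) :
    ∀ᵐ x, ∀ u : ℝ, x + u • w ∉ Z := by
  obtain ⟨x₀, ι, hch⟩ := (hT.flat e he).exists_isFaceChart
  by_cases hw : inner ℝ (ν e) w = 0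
  · filter_upwards [hT.ae_transverse w] with x hx u hu using hx e he u (hZ hu) hw
  · exact (hch.isUnitNormal (hT.normal e he)).ae_forall_add_smul_notMem hw
      (hZ.trans hch.subset_range) (hnull x₀ ι hch)

lemma volume_preimage_chart_inter_eq_zero (hT : IsFacetedBody T F ν) {e e' : Set (Pt (m + 1))}
    (he : e ∈ F) (he' : e' ∈ F) (hne : e ≠ e') {x₀ : Pt (m + 1)} {ι : Pt m →ₗᵢ[ℝ] Pt (m + 1)}
    (hch : IsFaceChart e x₀ ι) : volume (chart x₀ ι ⁻¹' (e ∩ e')) = 0 := by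
  obtain ⟨A, hA⟩ := exists_affineMap_eq_chart x₀ ι
  obtain ⟨x, hxe, hxe'⟩ := hT.noncoplanar e he e' he' hne
  obtain ⟨y, rfl⟩ := hch.subset_range hxe
  have hproper : (affineSpan ℝ e').comap A ≠ ⊤ := fun htop => hxe' <| by
    have hy : y ∈ (affineSpan ℝ e').comap A := htop ▸ AffineSubspace.mem_top ℝ _ y
    rwa [AffineSubspace.mem_comap, hA] at hy
  refine measure_mono_null (fun z hz => ?_) (Measure.addHaar_affineSubspace volume _ hproper)
  rw [SetLike.mem_coe, AffineSubspace.mem_comap, hA]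
  exact subset_affineSpan ℝ e' hz.2

lemma ae_isGenericLine (hT : IsFacetedBody T F ν) (w : Pt (m + 1)) :
    ∀ᵐ x, IsGenericLine F ν w x := by
  have hinterior : ∀ᵐ x : Pt (m + 1), ∀ e ∈ F, ∀ u : ℝ,
      x + u • w ∉ e \ intrinsicInterior ℝ e :=
    (F.eventually_all (l := ae volume)).2 fun e he =>
      hT.ae_forall_add_smul_notMem he w Set.sdiff_subset fun _ _ hch =>
        hch.volume_diff_intrinsicInterior (hT.flat e he).polytopal
  have hunique : ∀ᵐ x : Pt (m + 1), ∀ e ∈ F, ∀ e' ∈ F, ∀ u : ℝ, e' ≠ e → x + u • w ∉ e ∩ e' := by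
    refine (F.eventually_all (l := ae volume)).2 fun e he =>
      (F.eventually_all (l := ae volume)).2 fun e' he' => ?_
    by_cases hne : e' = e
    · exact .of_forall fun _ _ h => (h hne).elim
    filter_upwards [hT.ae_forall_add_smul_notMem he w Set.inter_subset_left fun _ _ hch =>
      hT.volume_preimage_chart_inter_eq_zero he he' (Ne.symm hne) hch] with x hx u _ using hx u
  have hbase : ∀ᵐ x : Pt (m + 1), ∀ e ∈ F, x ∉ e :=
    (F.eventually_all (l := ae volume)).2 fun e he => measure_eq_zero_iff_ae_notMem.1
      (measure_mono_null (subset_affineSpan ℝ e) (hT.volume_affineSpan_eq_zero he))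
  filter_upwards [hT.ae_transverse w, hinterior, hunique, hbase] with x htr hint huniq hx
  exact ⟨htr, fun e he u hu => not_not.1 fun h => hint e he u ⟨hu, h⟩,
    fun e he e' he' u hu hu' => not_not.1 fun h => huniq e he e' he' u h ⟨hu, hu'⟩, hx⟩

lemma indicator_eq_neg_sum (hT : IsFacetedBody T F ν) {w x : Pt (m + 1)} (hw : w ≠ 0)
    (hx : IsGenericLine F ν w x) (g : Pt (m + 1) → ℝ) :
    T.indicator g x =
      -∑ e ∈ F, Real.sign (inner ℝ (ν e) w) * (halfCylinder e w).indicator g x := by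
  have hmul : ∀ A : Set (Pt (m + 1)), A.indicator g x = A.indicator 1 x * g x := fun A => by
    by_cases h : x ∈ A <;> simp [h]
  have hzero := hT.crossingBalance_eq_zero hw hx
  rw [crossingBalance, add_eq_zero_iff_eq_neg] at hzero
  simp only [hmul, hzero, neg_mul, Finset.sum_mul, mul_assoc]

lemma integrable_sign_mul_indicator (hT : IsFacetedBody T F ν) {e : Set (Pt (m + 1))}
    (he : e ∈ F) (w : Pt (m + 1)) {g : Pt (m + 1) → ℝ} (hg : Integrable g volume) :
    Integrable (fun x => Real.sign (inner ℝ (ν e) w) * (halfCylinder e w).indicator g x)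
      volume := by
  by_cases hc : inner ℝ (ν e) w = 0
  · simp [hc]
  obtain ⟨x₀, ι, hch⟩ := (hT.flat e he).exists_isFaceChart
  exact (hg.indicator ((hch.isUnitNormal (hT.normal e he)).measurableSet_halfCylinder hc
    hch.subset_range (hT.flat e he).isClosed.measurableSet)).const_mul _

lemma integral_sign_mul_indicator_fderiv (hT : IsFacetedBody T F ν) {e : Set (Pt (m + 1))}
    (he : e ∈ F) (w : Pt (m + 1)) {f : Pt (m + 1) → ℝ} (hf : ContDiff ℝ 1 f)
    (hfs : HasCompactSupport f) :
    ∫ x, Real.sign (inner ℝ (ν e) w) * (halfCylinder e w).indicator (fun x => fderiv ℝ f x w) x =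
      -(inner ℝ (ν e) w * ∫ x in e, f x ∂μHE[m]) := by
  by_cases hc : inner ℝ (ν e) w = 0
  · simp [hc]
  obtain ⟨x₀, ι, hch⟩ := (hT.flat e he).exists_isFaceChart
  have hν := hch.isUnitNormal (hT.normal e he)
  rw [integral_const_mul, integral_indicator (hν.measurableSet_halfCylinder hc hch.subset_range
    (hT.flat e he).isClosed.measurableSet), hν.setIntegral_halfCylinder_fderiv hc hch.subset_range
    hf hfs]
  rcases lt_or_gt_of_ne hc with hneg | hpos
  · rw [Real.sign_of_neg hneg, abs_of_neg hneg]
    ring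
  · rw [Real.sign_of_pos hpos, abs_of_pos hpos]
    ring

theorem setIntegral_fderiv (hT : IsFacetedBody T F ν) (w : Pt (m + 1))
    {f : Pt (m + 1) → ℝ} (hf : ContDiff ℝ 1 f) (hfs : HasCompactSupport f) :
    ∫ x in T, fderiv ℝ f x w = ∑ e ∈ F, inner ℝ (ν e) w * ∫ x in e, f x ∂μHE[m] := by
  rcases eq_or_ne w 0 with rfl | hw
  · simp
  have hae : ∀ᵐ x : Pt (m + 1), T.indicator (fun x => fderiv ℝ f x w) x =
      -∑ e ∈ F, Real.sign (inner ℝ (ν e) w) *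
        (halfCylinder e w).indicator (fun x => fderiv ℝ f x w) x :=
    (hT.ae_isGenericLine w).mono fun x hx => hT.indicator_eq_neg_sum hw hx _
  rw [← integral_indicator hT.isClosed.measurableSet, integral_congr_ae hae, integral_neg,
    integral_finsetSum _ fun e he =>
      hT.integrable_sign_mul_indicator he w (integrable_fderiv_apply hf hfs w),
    Finset.sum_congr rfl fun e he => hT.integral_sign_mul_indicator_fderiv he w hf hfs,
    Finset.sum_neg_distrib, neg_neg]

theorem setIntegral_pderiv (hT : IsFacetedBody T F ν) (p : Poly (m + 1)) (j : Fin (m + 1)) :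
    ∫ x in T, pval (MvPolynomial.pderiv j p) x = ∑ e ∈ F, ν e j * ∫ x in e, pval p x ∂μHE[m] := by
  obtain ⟨R, hR, hTR⟩ := hT.isBounded.subset_ball_lt 0 (0 : Pt (m + 1))
  let χ : ContDiffBump (0 : Pt (m + 1)) := ⟨R, R + 1, hR, by linarith⟩
  set f : Pt (m + 1) → ℝ := fun x => χ x * pval p x
  have hfp : ∀ x ∈ Metric.ball (0 : Pt (m + 1)) R, f x = pval p x := fun x hx => by
    simp only [f, χ.one_of_mem_closedBall (Metric.ball_subset_closedBall hx), one_mul]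
  have hderiv : ∀ x ∈ T, pval (MvPolynomial.pderiv j p) x =
      fderiv ℝ f x (EuclideanSpace.single j 1) := fun x hx => by
    have hlocal : f =ᶠ[𝓝 x] pval p :=
      Filter.mem_of_superset (Metric.isOpen_ball.mem_nhds (hTR hx)) hfp
    rw [hlocal.fderiv_eq, fderiv_pval_single]
  rw [setIntegral_congr_fun hT.isClosed.measurableSet hderiv, hT.setIntegral_fderiv _
    (χ.contDiff.mul (contDiff_pval p)) χ.hasCompactSupport.mul_right]
  refine Finset.sum_congr rfl fun e he => ?_
  rw [setIntegral_congr_fun (hT.flat e he).isClosed.measurableSet fun x hx =>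
    hfp x (hTR (hT.subset he hx))]
  simp [EuclideanSpace.inner_single_right]

end IsFacetedBody

end DivergenceTheorem

/-! ### Estimates on a single element -/

section Packing

lemma exists_card_le_of_lt_dist {X : Type*} [PseudoMetricSpace X] {B : Set X}
    (hB : TotallyBounded B) {ε : ℝ} (hε : 0 < ε) :
    ∃ N : ℕ, ∀ {J : Type*} (I : Finset J) (P : J → X), (∀ i ∈ I, P i ∈ B) →
      (∀ i ∈ I, ∀ j ∈ I, i ≠ j → ε < dist (P i) (P j)) → I.card ≤ N := by
  classical
  lift ε to NNReal using hε.le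
  obtain ⟨C, -, hC, hcover⟩ :=
    Metric.exists_finite_isCover_of_totallyBounded (ε := ε / 2)
      (half_pos (NNReal.coe_pos.1 hε)).ne' hB
  have hle : Metric.packingNumber ε B ≤ (C.ncard : ℕ∞) := by
    have := (Metric.packingNumber_two_mul_le_externalCoveringNumber (ε / 2) B).trans
      hcover.externalCoveringNumber_le_encard
    rwa [mul_div_cancel₀ _ two_ne_zero, ← hC.cast_ncard_eq] at this
  refine ⟨C.ncard, fun I P hP hsep => ?_⟩
  have hinj : Set.InjOn P I := fun i hi j hj hij => by
    by_contra hne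
    have := hsep i hi j hj hne
    rw [hij, dist_self] at this
    exact this.not_ge ε.coe_nonneg
  have hPsep : Metric.IsSeparated ε (P '' I) := by
    rintro _ ⟨i, hi, rfl⟩ _ ⟨j, hj, rfl⟩ hne
    rw [edist_dist, ← ENNReal.ofReal_coe_nnreal]
    exact (ENNReal.ofReal_lt_ofReal_iff_of_nonneg ε.coe_nonneg).2
      (hsep i hi j hj fun h => hne (congrArg P h))
  have := (hPsep.encard_le_packingNumber (Set.image_subset_iff.2 hP)).trans hle
  rw [hinj.encard_image, Set.encard_coe_eq_coe_finsetCard] at this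
  exact_mod_cast this

end Packing

lemma abs_integral_mul_le {X : Type*} [MeasurableSpace X] {μ : Measure X} {a b : X → ℝ}
    (ha : Integrable (fun x => a x ^ 2) μ) (hb : Integrable (fun x => b x ^ 2) μ) {t : ℝ}
    (ht : 0 < t) :
    |∫ x, a x * b x ∂μ| ≤ t * ∫ x, a x ^ 2 ∂μ + 1 / (4 * t) * ∫ x, b x ^ 2 ∂μ := by
  rw [← integral_const_mul, ← integral_const_mul, ← integral_add (ha.const_mul t) (hb.const_mul _),
    ← Real.norm_eq_abs]
  refine norm_integral_le_of_norm_le ((ha.const_mul t).add (hb.const_mul _))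
    (Filter.Eventually.of_forall fun x => ?_)
  have hsq_sub : t * a x ^ 2 + 1 / (4 * t) * b x ^ 2 - a x * b x =
      (2 * t * a x - b x) ^ 2 / (4 * t) := by field_simp; ring
  have hsq_add : t * a x ^ 2 + 1 / (4 * t) * b x ^ 2 + a x * b x =
      (2 * t * a x + b x) ^ 2 / (4 * t) := by field_simp; ring
  have hsub_nonneg : 0 ≤ (2 * t * a x - b x) ^ 2 / (4 * t) := by positivity
  have hadd_nonneg : 0 ≤ (2 * t * a x + b x) ^ 2 / (4 * t) := by positivity
  rw [Real.norm_eq_abs, abs_le]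
  constructor <;> linarith

section Element

variable {m : ℕ}

/-- A faceted body `T` of diameter at most `h`, together with its faces `F`, its outward unit
normals `ν e`, and a chart `y ↦ base e + frame e y` of each face `e`; only the values of `ν`, `base`
and `frame` at the faces matter. -/
structure ScaledElement (m : ℕ) where
  T : Set (Pt (m + 1))
  F : Finset (Set (Pt (m + 1)))
  ν : Set (Pt (m + 1)) → Pt (m + 1)
  base : Set (Pt (m + 1)) → Pt (m + 1)
  frame : Set (Pt (m + 1)) → Pt m →ₗᵢ[ℝ] Pt (m + 1)
  h : ℝ
  isFacetedBody : IsFacetedBody T F ν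
  isFaceChart : ∀ e ∈ F, IsFaceChart e (base e) (frame e)
  nonempty : T.Nonempty
  h_pos : 0 < h
  dist_le : ∀ x ∈ T, ∀ y ∈ T, dist x y ≤ h

namespace ScaledElement

variable (K : ScaledElement m) {e : Set (Pt (m + 1))} {x : Pt (m + 1)}

lemma measurableSet : MeasurableSet K.T := K.isFacetedBody.isClosed.measurableSet

lemma measurableSet_face (he : e ∈ K.F) : MeasurableSet e :=
  (K.isFacetedBody.flat e he).isClosed.measurableSet

lemma base_mem_face (he : e ∈ K.F) : K.base e ∈ e := (K.isFaceChart e he).base_mem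

lemma base_mem (he : e ∈ K.F) : K.base e ∈ K.T := K.isFacetedBody.subset he (K.base_mem_face he)

lemma face_subset_disc (he : e ∈ K.F) : e ⊆ disc (K.base e) (K.frame e) K.h := fun _ hx =>
  ⟨K.dist_le _ (K.isFacetedBody.subset he hx) _ (K.base_mem he),
    (K.isFaceChart e he).subset_range hx⟩

lemma subset_disc (hx : x ∈ K.T) : K.T ⊆ disc x LinearIsometry.id K.h :=
  fun y hy => ⟨K.dist_le _ hy _ hx, y - x, by simp [chart]⟩

lemma integrableOn {f : Pt (m + 1) → ℝ} (hf : Continuous f) : IntegrableOn f K.T :=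
  hf.continuousOn.integrableOn_compact
    (Metric.isCompact_of_isClosed_isBounded K.isFacetedBody.isClosed K.isFacetedBody.isBounded)

lemma integrableOn_face (he : e ∈ K.F) {f : Pt (m + 1) → ℝ} (hf : Continuous f) :
    IntegrableOn f e μHE[m] :=
  integrableOn_of_subset_disc (K.face_subset_disc he) hf

lemma setIntegral_le {f : Pt (m + 1) → ℝ} (hf : Continuous f) {B : ℝ} (hB : 0 ≤ B)
    (hfB : ∀ x ∈ K.T, f x ≤ B) : ∫ x in K.T, f x ≤ B * (ballVol (m + 1) * K.h ^ (m + 1)) := by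
  obtain ⟨x₀, hx₀⟩ := K.nonempty
  calc ∫ x in K.T, f x ≤ ∫ _ in K.T, B := setIntegral_mono_on (K.integrableOn hf)
        (integrableOn_const K.isFacetedBody.isBounded.measure_lt_top.ne) K.measurableSet hfB
    _ = B * volume.real K.T := by simp [mul_comm]
    _ ≤ _ := by
        gcongr
        rw [← EuclideanSpace.euclideanHausdorffMeasure_eq_volume]
        exact measureReal_le_of_subset_disc K.h_pos.le (K.subset_disc hx₀)

lemma setIntegral_face_le (he : e ∈ K.F) {f : Pt (m + 1) → ℝ} (hf : Continuous f) {B : ℝ}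
    (hB : 0 ≤ B) (hfB : ∀ x ∈ e, f x ≤ B) :
    ∫ x in e, f x ∂μHE[m] ≤ B * (ballVol m * K.h ^ m) := by
  have hfin : (μHE[m] : Measure (Pt (m + 1))) e ≠ ⊤ :=
    ((measure_mono (K.face_subset_disc he)).trans_lt (measure_disc_lt_top _ _ _)).ne
  calc ∫ x in e, f x ∂μHE[m] ≤ ∫ _ in e, B ∂μHE[m] := setIntegral_mono_on
        (K.integrableOn_face he hf) (integrableOn_const hfin) (K.measurableSet_face he) hfB
    _ = B * (μHE[m] : Measure (Pt (m + 1))).real e := by simp [mul_comm]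
    _ ≤ _ := by
        gcongr
        exact measureReal_le_of_subset_disc K.h_pos.le (K.face_subset_disc he)

lemma isUnitNormal (he : e ∈ K.F) : IsUnitNormal (K.frame e) (K.ν e) :=
  (K.isFaceChart e he).isUnitNormal (K.isFacetedBody.normal e he)

lemma abs_normal_le (he : e ∈ K.F) (j : Fin (m + 1)) : |K.ν e j| ≤ 1 := by
  rw [← (K.isUnitNormal he).unit]
  exact PiLp.norm_apply_le (K.ν e) j

lemma sum_normal_sq (he : e ∈ K.F) : ∑ j, K.ν e j ^ 2 = 1 := by
  rw [← EuclideanSpace.real_norm_sq_eq, (K.isUnitNormal he).unit, one_pow]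

/-- The affine function `x ↦ ⟪ν, x₀ - x⟫ / h` as a polynomial. It vanishes on the face `e`, and it
is positive on the side of `e` opposite to the outward normal. -/
def planePoly (e : Set (Pt (m + 1))) : Poly (m + 1) :=
  MvPolynomial.C (inner ℝ (K.ν e) (K.base e) / K.h) -
    ∑ i, MvPolynomial.C (K.ν e i / K.h) * MvPolynomial.X i

lemma pval_planePoly (e : Set (Pt (m + 1))) (x : Pt (m + 1)) :
    pval (K.planePoly e) x = inner ℝ (K.ν e) (K.base e - x) / K.h := by
  have hinner : inner ℝ (K.ν e) x = ∑ i, K.ν e i * x i := by simp [PiLp.inner_apply, mul_comm]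
  simp only [planePoly, pval_sub, pval_C, pval_sum, pval_mul]
  rw [inner_sub_right, sub_div, hinner, Finset.sum_div]
  congr 1
  refine Finset.sum_congr rfl fun i _ => ?_
  simp only [pval, MvPolynomial.eval_X]
  ring

lemma pval_planePoly_add (e : Set (Pt (m + 1))) (x w : Pt (m + 1)) :
    pval (K.planePoly e) (x + w) = pval (K.planePoly e) x - inner ℝ (K.ν e) w / K.h := by
  rw [pval_planePoly, pval_planePoly, ← sub_sub, inner_sub_right _ _ w, sub_div]

lemma totalDegree_planePoly_le (e : Set (Pt (m + 1))) : (K.planePoly e).totalDegree ≤ 1 := by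
  refine (MvPolynomial.totalDegree_sub _ _).trans (max_le (by simp) ?_)
  refine MvPolynomial.totalDegree_finsetSum_le fun j _ => ?_
  exact (MvPolynomial.totalDegree_mul _ _).trans (by simp)

lemma abs_pval_planePoly_le (he : e ∈ K.F) (hx : x ∈ K.T) : |pval (K.planePoly e) x| ≤ 1 := by
  rw [pval_planePoly, abs_div, abs_of_pos K.h_pos, div_le_one K.h_pos]
  refine (abs_real_inner_le_norm _ _).trans ?_
  rw [(K.isUnitNormal he).unit, one_mul, ← dist_eq_norm]
  exact K.dist_le _ (K.base_mem he) _ hx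

lemma pval_planePoly_eq_zero (he : e ∈ K.F) (hx : x ∈ e) : pval (K.planePoly e) x = 0 := by
  rw [pval_planePoly, K.isFacetedBody.inner_eq_zero he (K.base_mem_face he) hx, zero_div]

lemma exists_one_le_planePoly (he : e ∈ K.F) (x₀ : Pt (m + 1)) :
    ∃ x ∈ disc x₀ LinearIsometry.id K.h, 1 ≤ |pval (K.planePoly e) x| := by
  have hmem (t : ℝ) (ht : |t| = K.h) :
      x₀ + t • K.ν e ∈ disc x₀ (LinearIsometry.id (R := ℝ)) K.h :=
    ⟨by simp [norm_smul, (K.isUnitNormal he).unit, ht], t • K.ν e, by simp [chart]⟩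
  have hval (t : ℝ) :
      pval (K.planePoly e) (x₀ + t • K.ν e) = pval (K.planePoly e) x₀ - t / K.h := by
    rw [pval_planePoly_add, inner_smul_right, real_inner_self_eq_norm_sq,
      (K.isUnitNormal he).unit, one_pow, mul_one]
  rcases le_total 0 (pval (K.planePoly e) x₀) with hpos | hneg
  · refine ⟨_, hmem (-K.h) (by rw [abs_neg, abs_of_pos K.h_pos]), ?_⟩
    rw [hval, neg_div, div_self K.h_pos.ne', le_abs]
    left
    linarith
  · refine ⟨_, hmem K.h (abs_of_pos K.h_pos), ?_⟩
    rw [hval, div_self K.h_pos.ne', le_abs]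
    right
    linarith

/-- Each face has a point at distance at least `δ h` from the hyperplane of any other face. -/
def IsSeparated (δ : ℝ) : Prop :=
  ∀ e ∈ K.F, ∀ e' ∈ K.F, e ≠ e' → ∃ x ∈ e, δ ≤ |pval (K.planePoly e') x|

lemma IsSeparated.le_two_mul_dist {δ : ℝ} (hδ : K.IsSeparated δ) {x₀ : Pt (m + 1)} (hx₀ : x₀ ∈ K.T)
    {e' : Set (Pt (m + 1))} (he : e ∈ K.F) (he' : e' ∈ K.F) (hne : e ≠ e') :
    δ ≤ 2 * dist (K.ν e, pval (K.planePoly e) x₀) (K.ν e', pval (K.planePoly e') x₀) := by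
  obtain ⟨x, hx, hδx⟩ := hδ e he e' he' hne
  set D := dist (K.ν e, pval (K.planePoly e) x₀) (K.ν e', pval (K.planePoly e') x₀)
  have hvalue (f : Set (Pt (m + 1))) : pval (K.planePoly f) x =
      pval (K.planePoly f) x₀ - inner ℝ (K.ν f) (x - x₀) / K.h := by
    rw [← pval_planePoly_add, add_sub_cancel]
  have hsplit : pval (K.planePoly e') x =
      (pval (K.planePoly e') x₀ - pval (K.planePoly e) x₀) +
        inner ℝ (K.ν e - K.ν e') (x - x₀) / K.h := by
    have hzero := K.pval_planePoly_eq_zero he hx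
    rw [hvalue] at hzero ⊢
    rw [inner_sub_left, sub_div]
    linarith
  have hoffset : |pval (K.planePoly e') x₀ - pval (K.planePoly e) x₀| ≤ D := by
    rw [abs_sub_comm, ← Real.dist_eq]
    exact le_max_right _ _
  have hnormal : |inner ℝ (K.ν e - K.ν e') (x - x₀) / K.h| ≤ D := by
    rw [abs_div, abs_of_pos K.h_pos, div_le_iff₀ K.h_pos]
    refine (abs_real_inner_le_norm _ _).trans ?_
    rw [← dist_eq_norm, ← dist_eq_norm]
    exact mul_le_mul (le_max_left _ _) (K.dist_le _ (K.isFacetedBody.subset he hx) _ hx₀)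
      dist_nonneg dist_nonneg
  rw [hsplit] at hδx
  linarith [hδx.trans (abs_add_le _ _)]

end ScaledElement

open ScaledElement

/-- A face is recorded by its normal and its offset, which range over a compact set. -/
lemma exists_card_faces_le (m : ℕ) {δ : ℝ} (hδ : 0 < δ) :
    ∃ N : ℕ, ∀ K : ScaledElement m, K.IsSeparated δ → K.F.card ≤ N := by
  obtain ⟨N, hN⟩ := exists_card_le_of_lt_dist
    (isCompact_closedBall (0 : Pt (m + 1) × ℝ) 1).totallyBounded (ε := δ / 4) (by positivity)
  refine ⟨N, fun K hK => ?_⟩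
  obtain ⟨x₀, hx₀⟩ := K.nonempty
  refine hN K.F (fun e => (K.ν e, pval (K.planePoly e) x₀)) (fun e he => ?_)
    fun e he e' he' hne => ?_
  · rw [mem_closedBall_zero_iff]
    exact max_le (K.isUnitNormal he).unit.le (K.abs_pval_planePoly_le he hx₀)
  · linarith [hK.le_two_mul_dist K hx₀ he he' hne]

lemma exists_sq_le_setIntegral (m k : ℕ) {ρ : ℝ} (hρ : 0 < ρ) :
    ∃ C > 0, ∀ K : ScaledElement m, ρ * K.h ^ (m + 1) ≤ volume.real K.T →
      ∀ p : Poly (m + 1), p.totalDegree ≤ k → ∀ x ∈ K.T,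
        pval p x ^ 2 * K.h ^ (m + 1) ≤ C * ∫ y in K.T, pval p y ^ 2 := by
  obtain ⟨C, hC, hdisc⟩ := exists_sq_le_setIntegral_disc (m + 1) k hρ
  refine ⟨C, hC, fun K hK p hp x hx => ?_⟩
  have := hdisc (m + 1) x LinearIsometry.id K.h K.h_pos p hp K.T (K.subset_disc hx) K.measurableSet
  rw [EuclideanSpace.euclideanHausdorffMeasure_eq_volume] at this
  exact this hK x (K.subset_disc hx hx)

lemma exists_trace_le (m k : ℕ) {ρ : ℝ} (hρ : 0 < ρ) :
    ∃ C > 0, ∀ K : ScaledElement m, ρ * K.h ^ (m + 1) ≤ volume.real K.T →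
      ∀ p : Poly (m + 1), p.totalDegree ≤ k → ∀ e ∈ K.F,
        ∫ x in e, pval p x ^ 2 ∂μHE[m] ≤ C * K.h⁻¹ * ∫ x in K.T, pval p x ^ 2 := by
  obtain ⟨C, hC, hpoint⟩ := exists_sq_le_setIntegral m k hρ
  have hb := ballVol_nonneg m
  refine ⟨C * (ballVol m + 1), by positivity, fun K hK p hp e he => ?_⟩
  have hh := K.h_pos
  set X := ∫ x in K.T, pval p x ^ 2
  have : 0 ≤ X := integral_nonneg fun x => sq_nonneg _
  have hbound : ∀ x ∈ e, pval p x ^ 2 ≤ C * X / K.h ^ (m + 1) := fun x hx => by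
    rw [le_div_iff₀ (by positivity)]
    exact hpoint K hK p hp x (K.isFacetedBody.subset he hx)
  calc ∫ x in e, pval p x ^ 2 ∂μHE[m] ≤ C * X / K.h ^ (m + 1) * (ballVol m * K.h ^ m) :=
        K.setIntegral_face_le he (by fun_prop) (by positivity) hbound
    _ = C * ballVol m * K.h⁻¹ * X := by field_simp; ring
    _ ≤ C * (ballVol m + 1) * K.h⁻¹ * X := by gcongr; linarith

end Element

/-! ### Local norm equivalence -/

section Local

variable {m : ℕ}

namespace ScaledElement

variable (K : ScaledElement m) {e : Set (Pt (m + 1))} {x : Pt (m + 1)} {s : ℕ}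

/-- Tested against polynomials of degree at most `r`, the polynomial `g` acts as the `j`-th partial
derivative of the scalar weak function `{v, b}`: this is one entry of the weak gradient, after
integration by parts. -/
def IsWeakPderiv (r : ℕ) (v : Poly (m + 1)) (b : Set (Pt (m + 1)) → Poly (m + 1))
    (j : Fin (m + 1)) (g : Poly (m + 1)) : Prop :=
  ∀ ψ : Poly (m + 1), ψ.totalDegree ≤ r →
    ∫ x in K.T, pval g x * pval ψ x =
      (∫ x in K.T, pval (MvPolynomial.pderiv j v) x * pval ψ x) +
        ∑ e ∈ K.F, K.ν e j * ∫ x in e, pval (b e - v) x * pval ψ x ∂μHE[m]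

/-- The exponents `s` that make the powers of the plane polynomials nonnegative on the element and
at least as large as their squares: `s = 2` always, and also `s = 1` on convex elements. -/
structure IsBubbleExponent (s : ℕ) : Prop where
  pos : 0 < s
  le_two : s ≤ 2
  nonneg : ∀ e ∈ K.F, ∀ x ∈ K.T, 0 ≤ pval (K.planePoly e) x ^ s

/-- The face bubble function: the product of the `s`-th powers of the plane polynomials of the faces
in `A`. -/
def bubble (s : ℕ) (A : Finset (Set (Pt (m + 1)))) : Poly (m + 1) := ∏ e ∈ A, K.planePoly e ^ s

variable {A : Finset (Set (Pt (m + 1)))}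

lemma totalDegree_bubble_le (s : ℕ) (A : Finset (Set (Pt (m + 1)))) :
    (K.bubble s A).totalDegree ≤ s * A.card := by
  refine (MvPolynomial.totalDegree_finsetProd _ _).trans ?_
  refine (Finset.sum_le_card_nsmul _ _ s fun e _ => ?_).trans (by simp [mul_comm])
  exact (MvPolynomial.totalDegree_pow _ _).trans
    (mul_le_of_le_one_right s.zero_le (K.totalDegree_planePoly_le e))

lemma pval_bubble_eq_zero (hA : A ⊆ K.F) (hs : s ≠ 0) (he : e ∈ A) (hx : x ∈ e) :
    pval (K.bubble s A) x = 0 := by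
  rw [bubble, pval_prod]
  refine Finset.prod_eq_zero he ?_
  rw [pval_pow, K.pval_planePoly_eq_zero (hA he) hx, zero_pow hs]

namespace IsBubbleExponent

variable {K}

lemma sq_le_pow (hs : K.IsBubbleExponent s) (he : e ∈ K.F) (hx : x ∈ K.T) :
    pval (K.planePoly e) x ^ 2 ≤ pval (K.planePoly e) x ^ s := by
  rw [← sq_abs, ← abs_of_nonneg (hs.nonneg e he x hx), abs_pow]
  exact pow_le_pow_of_le_one (abs_nonneg _) (K.abs_pval_planePoly_le he hx) hs.le_two

lemma pow_le_one (hs : K.IsBubbleExponent s) (he : e ∈ K.F) (hx : x ∈ K.T) :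
    pval (K.planePoly e) x ^ s ≤ 1 := by
  rw [← abs_of_nonneg (hs.nonneg e he x hx), abs_pow]
  exact pow_le_one₀ (abs_nonneg _) (K.abs_pval_planePoly_le he hx)

lemma prod_sq_le_bubble (hs : K.IsBubbleExponent s) (hA : A ⊆ K.F) (hx : x ∈ K.T) :
    ∏ e ∈ A, pval (K.planePoly e) x ^ 2 ≤ pval (K.bubble s A) x := by
  simp only [bubble, pval_prod, pval_pow]
  exact Finset.prod_le_prod (fun _ _ => sq_nonneg _) fun e he => hs.sq_le_pow (hA he) hx

lemma bubble_nonneg (hs : K.IsBubbleExponent s) (hA : A ⊆ K.F) (hx : x ∈ K.T) :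
    0 ≤ pval (K.bubble s A) x :=
  (Finset.prod_nonneg fun _ _ => sq_nonneg _).trans (hs.prod_sq_le_bubble hA hx)

lemma bubble_le_one (hs : K.IsBubbleExponent s) (hA : A ⊆ K.F) (hx : x ∈ K.T) :
    pval (K.bubble s A) x ≤ 1 := by
  simp only [bubble, pval_prod, pval_pow]
  exact Finset.prod_le_one (fun e he => hs.nonneg e (hA he) x hx) fun e he =>
    hs.pow_le_one (hA he) hx

end IsBubbleExponent

end ScaledElement

open ScaledElement

lemma exists_sq_le_setIntegral_bubble (m k N : ℕ) {ρ : ℝ} (hρ : 0 < ρ) :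
    ∃ c > 0, ∀ K : ScaledElement m, ρ * K.h ^ (m + 1) ≤ volume.real K.T → K.F.card ≤ N →
      ∀ s, K.IsBubbleExponent s → ∀ p : Poly (m + 1), p.totalDegree ≤ k → ∀ x ∈ K.T,
        c * (pval p x ^ 2 * K.h ^ (m + 1)) ≤
          ∫ y in K.T, pval (K.bubble s K.F) y * pval p y ^ 2 := by
  obtain ⟨c, hc, hweight⟩ := exists_sq_le_setIntegral_weight (m + 1) 1 k N hρ one_pos
  refine ⟨c, hc, fun K hK hN s hs p hp x hx => ?_⟩
  have := hweight (m + 1) x LinearIsometry.id K.h K.h_pos K.T (K.subset_disc hx) K.measurableSet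
  rw [EuclideanSpace.euclideanHausdorffMeasure_eq_volume] at this
  exact this hK K.F K.planePoly hN
    (fun e he => ⟨K.totalDegree_planePoly_le e, K.exists_one_le_planePoly he x⟩)
    (pval (K.bubble s K.F)) (continuous_pval _)
    (fun y hy => hs.prod_sq_le_bubble subset_rfl hy) p hp x (K.subset_disc hx hx)

open Classical in
lemma exists_sq_le_setIntegral_face_bubble (m k N : ℕ) {ρ δ : ℝ} (hρ : 0 < ρ) (hδ : 0 < δ) :
    ∃ c > 0, ∀ K : ScaledElement m, K.IsSeparated δ → K.F.card ≤ N →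
      ∀ s, K.IsBubbleExponent s → ∀ e ∈ K.F,
      ρ * K.h ^ m ≤ (μHE[m] : Measure (Pt (m + 1))).real e →
      ∀ q : Poly (m + 1), q.totalDegree ≤ k → ∀ x ∈ disc (K.base e) (K.frame e) K.h,
        c * (pval q x ^ 2 * K.h ^ m) ≤
          ∫ y in e, pval (K.bubble s (K.F.erase e)) y * pval q y ^ 2 ∂μHE[m] := by
  obtain ⟨c, hc, hweight⟩ := exists_sq_le_setIntegral_weight m 1 k N hρ hδ
  refine ⟨c, hc, fun K hsep hN s hs e he hρe q hq x hx => ?_⟩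
  refine hweight (m + 1) (K.base e) (K.frame e) K.h K.h_pos e (K.face_subset_disc he)
    (K.measurableSet_face he) hρe (K.F.erase e) K.planePoly
    ((Finset.card_le_card (K.F.erase_subset e)).trans hN)
    (fun e' he' => ⟨K.totalDegree_planePoly_le e', ?_⟩)
    (pval (K.bubble s (K.F.erase e))) (continuous_pval _)
    (fun y hy => hs.prod_sq_le_bubble (K.F.erase_subset e) (K.isFacetedBody.subset he hy))
    q hq x hx
  obtain ⟨hne, he'⟩ := Finset.mem_erase.1 he'
  obtain ⟨y, hy, hδy⟩ := hsep e he e' he' hne.symm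
  exact ⟨y, K.face_subset_disc he hy, hδy⟩

lemma exists_face_term_le (m R N : ℕ) {ρ : ℝ} (hρ : 0 < ρ) :
    ∃ C > 0, ∀ K : ScaledElement m, ρ * K.h ^ (m + 1) ≤ volume.real K.T →
      ∀ (q g : Poly (m + 1)) (j : Fin (m + 1)), g.totalDegree ≤ R → ∀ e ∈ K.F,
        K.ν e j * ∫ x in e, pval q x * pval g x ∂μHE[m] ≤
          C * K.h⁻¹ * ∫ x in e, pval q x ^ 2 ∂μHE[m] +
            1 / (4 * (N + 1)) * ∫ x in K.T, pval g x ^ 2 := by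
  obtain ⟨C, hC, htrace⟩ := exists_trace_le m R hρ
  refine ⟨(N + 1) * C, by positivity, fun K hK q g j hg e he => ?_⟩
  have hh := K.h_pos
  set t : ℝ := (N + 1) * C * K.h⁻¹
  have ht : 0 < t := by positivity
  calc K.ν e j * ∫ x in e, pval q x * pval g x ∂μHE[m]
      ≤ |K.ν e j| * |∫ x in e, pval q x * pval g x ∂μHE[m]| := by
        rw [← abs_mul]
        exact le_abs_self _
    _ ≤ 1 * |∫ x in e, pval q x * pval g x ∂μHE[m]| := by
        gcongr
        exact K.abs_normal_le he j
    _ ≤ t * ∫ x in e, pval q x ^ 2 ∂μHE[m] +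
          1 / (4 * t) * ∫ x in e, pval g x ^ 2 ∂μHE[m] := by
        rw [one_mul]
        exact abs_integral_mul_le (K.integrableOn_face he (by fun_prop))
          (K.integrableOn_face he (by fun_prop)) ht
    _ ≤ t * ∫ x in e, pval q x ^ 2 ∂μHE[m] +
          1 / (4 * t) * (C * K.h⁻¹ * ∫ x in K.T, pval g x ^ 2) := by
        gcongr
        exact htrace K hK g hg e he
    _ = _ := by
        simp only [t]
        field_simp

lemma exists_weakPderiv_le (m R N : ℕ) {ρ : ℝ} (hρ : 0 < ρ) :
    ∃ C > 0, ∀ K : ScaledElement m, ρ * K.h ^ (m + 1) ≤ volume.real K.T → K.F.card ≤ N →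
      ∀ r ≤ R, ∀ v b j g, g.totalDegree ≤ r → K.IsWeakPderiv r v b j g →
        ∫ x in K.T, pval g x ^ 2 ≤ C * ((∫ x in K.T, pval (MvPolynomial.pderiv j v) x ^ 2) +
          K.h⁻¹ * ∑ e ∈ K.F, ∫ x in e, pval (b e - v) x ^ 2 ∂μHE[m]) := by
  obtain ⟨C, hC, hface⟩ := exists_face_term_le m R N hρ
  refine ⟨2 * (1 + C), by positivity, fun K hK hN r hr v b j g hg hgv => ?_⟩
  have hh := K.h_pos
  set X := ∫ x in K.T, pval g x ^ 2
  set G := ∫ x in K.T, pval (MvPolynomial.pderiv j v) x ^ 2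
  set Y := ∑ e ∈ K.F, ∫ x in e, pval (b e - v) x ^ 2 ∂μHE[m]
  have : 0 ≤ X := integral_nonneg fun x => sq_nonneg _
  have hG : 0 ≤ G := integral_nonneg fun x => sq_nonneg _
  have hY : 0 ≤ K.h⁻¹ * Y := mul_nonneg (inv_nonneg.2 hh.le)
    (Finset.sum_nonneg fun e _ => integral_nonneg fun x => sq_nonneg _)
  have hvolume : ∫ x in K.T, pval (MvPolynomial.pderiv j v) x * pval g x ≤ G + 1 / 4 * X := by
    have := (le_abs_self _).trans (abs_integral_mul_le (μ := volume.restrict K.T)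
      (a := pval (MvPolynomial.pderiv j v)) (b := pval g) (K.integrableOn (by fun_prop))
      (K.integrableOn (by fun_prop)) one_pos)
    rwa [one_mul, mul_one] at this
  have hfaces : ∑ e ∈ K.F, K.ν e j * ∫ x in e, pval (b e - v) x * pval g x ∂μHE[m] ≤
      C * (K.h⁻¹ * Y) + 1 / 4 * X :=
    calc _ ≤ ∑ e ∈ K.F, (C * K.h⁻¹ * ∫ x in e, pval (b e - v) x ^ 2 ∂μHE[m] +
          1 / (4 * (N + 1)) * X) :=
          Finset.sum_le_sum fun e he => hface K hK (b e - v) g j (hg.trans hr) e he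
      _ = C * (K.h⁻¹ * Y) + K.F.card * (1 / (4 * (N + 1)) * X) := by
          rw [Finset.sum_add_distrib, ← Finset.mul_sum, Finset.sum_const, nsmul_eq_mul, mul_assoc]
      _ ≤ C * (K.h⁻¹ * Y) + (N + 1) * (1 / (4 * (N + 1)) * X) := by
          gcongr
          exact_mod_cast hN.trans (Nat.le_succ N)
      _ = C * (K.h⁻¹ * Y) + 1 / 4 * X := by field_simp
  have hself : X = (∫ x in K.T, pval (MvPolynomial.pderiv j v) x * pval g x) +
      ∑ e ∈ K.F, K.ν e j * ∫ x in e, pval (b e - v) x * pval g x ∂μHE[m] := by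
    rw [← hgv g hg]
    simp only [X, sq]
  calc X ≤ 2 * G + 2 * C * (K.h⁻¹ * Y) := by linarith
    _ ≤ 2 * (1 + C) * (G + K.h⁻¹ * Y) := by nlinarith [mul_nonneg hC.le hG]

/-- Testing with `ψ = Φ p`, where the bubble function `Φ` vanishes on the boundary, removes the face
terms. -/
lemma ScaledElement.IsWeakPderiv.setIntegral_bubble_mul_sq_le {K : ScaledElement m} {r k s : ℕ}
    {v : Poly (m + 1)} {b : Set (Pt (m + 1)) → Poly (m + 1)} {j : Fin (m + 1)} {g : Poly (m + 1)}
    (hg : K.IsWeakPderiv r v b j g) (hs : K.IsBubbleExponent s) (hr : s * K.F.card + (k - 1) ≤ r)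
    (hv : v.totalDegree ≤ k) :
    ∫ x in K.T, pval (K.bubble s K.F) x * pval (MvPolynomial.pderiv j v) x ^ 2 ≤
      ∫ x in K.T, pval g x ^ 2 := by
  set p := MvPolynomial.pderiv j v
  set Φ := K.bubble s K.F
  set Z := ∫ x in K.T, pval Φ x * pval p x ^ 2
  have hp : p.totalDegree ≤ k - 1 := (totalDegree_pderiv_le v j).trans (Nat.sub_le_sub_right hv 1)
  have hfaces : ∑ e ∈ K.F, K.ν e j * ∫ x in e, pval (b e - v) x * pval (Φ * p) x ∂μHE[m] = 0 := by
    refine Finset.sum_eq_zero fun e he => ?_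
    rw [setIntegral_eq_zero_of_forall_eq_zero, mul_zero]
    intro x hx
    rw [pval_mul, K.pval_bubble_eq_zero subset_rfl hs.pos.ne' he hx, zero_mul, mul_zero]
  have htest : ∫ x in K.T, pval g x * pval (Φ * p) x = Z := by
    rw [hg (Φ * p) ((MvPolynomial.totalDegree_mul _ _).trans
      ((add_le_add (K.totalDegree_bubble_le s K.F) hp).trans hr)), hfaces, add_zero]
    simp only [Z, pval_mul]
    congr 1 with x
    ring
  have hyoung : Z ≤ ∫ x in K.T, (1 / 2 * (pval Φ x * pval p x ^ 2) + 1 / 2 * pval g x ^ 2) := by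
    rw [← htest]
    refine setIntegral_mono_on (K.integrableOn (by fun_prop)) (K.integrableOn (by fun_prop))
      K.measurableSet fun x hx => ?_
    have hΦ₀ : 0 ≤ pval Φ x := hs.bubble_nonneg subset_rfl hx
    have hΦ₁ : pval Φ x ≤ 1 := hs.bubble_le_one subset_rfl hx
    rw [pval_mul]
    nlinarith [mul_nonneg hΦ₀ (sq_nonneg (pval g x - pval p x)),
      mul_nonneg (sub_nonneg.2 hΦ₁) (sq_nonneg (pval g x))]
  rw [integral_add (K.integrableOn (f := fun x => 1 / 2 * (pval Φ x * pval p x ^ 2)) (by fun_prop))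
    (K.integrableOn (f := fun x => 1 / 2 * pval g x ^ 2) (by fun_prop)), integral_const_mul,
    integral_const_mul] at hyoung
  linarith

lemma exists_pderiv_le (m k N : ℕ) {ρ : ℝ} (hρ : 0 < ρ) :
    ∃ C > 0, ∀ K : ScaledElement m, ρ * K.h ^ (m + 1) ≤ volume.real K.T → K.F.card ≤ N →
      ∀ s r, K.IsBubbleExponent s → s * K.F.card + k ≤ r + 1 →
      ∀ v b j g, v.totalDegree ≤ k → K.IsWeakPderiv r v b j g →
        ∫ x in K.T, pval (MvPolynomial.pderiv j v) x ^ 2 ≤ C * ∫ x in K.T, pval g x ^ 2 := by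
  obtain ⟨c, hc, hbubble⟩ := exists_sq_le_setIntegral_bubble m (k - 1) N hρ
  have hb := ballVol_nonneg (m + 1)
  refine ⟨(ballVol (m + 1) + 1) / c, by positivity, fun K hK hN s r hs hr v b j g hv hg => ?_⟩
  have hh := K.h_pos
  set p := MvPolynomial.pderiv j v
  set X := ∫ x in K.T, pval g x ^ 2
  have : 0 ≤ X := integral_nonneg fun x => sq_nonneg _
  rcases k.eq_zero_or_pos with rfl | hk
  · have hp : p = 0 := by
      simp only [p]
      rw [MvPolynomial.totalDegree_eq_zero_iff_eq_C.1 (Nat.le_zero.1 hv), MvPolynomial.pderiv_C]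
    simp only [hp, pval_zero, zero_pow two_ne_zero, integral_zero]
    positivity
  have hp : p.totalDegree ≤ k - 1 := (totalDegree_pderiv_le v j).trans (Nat.sub_le_sub_right hv 1)
  have hpoint : ∀ x ∈ K.T, pval p x ^ 2 ≤ X / (c * K.h ^ (m + 1)) := fun x hx => by
    rw [le_div_iff₀ (by positivity)]
    linarith [hbubble K hK hN s hs p hp x hx, hg.setIntegral_bubble_mul_sq_le hs (by omega) hv]
  calc ∫ x in K.T, pval p x ^ 2
      ≤ X / (c * K.h ^ (m + 1)) * (ballVol (m + 1) * K.h ^ (m + 1)) :=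
        K.setIntegral_le (by fun_prop) (by positivity) hpoint
    _ = ballVol (m + 1) / c * X := by field_simp
    _ ≤ (ballVol (m + 1) + 1) / c * X := by gcongr; linarith

/-- The extension of the trace of `q` on the hyperplane through `x₀` with unit normal `ν` that is
constant in the normal direction, i.e. `q` composed with the orthogonal projection. -/
def normalExt {d : ℕ} (q : Poly d) (ν x₀ : Pt d) : Poly d :=
  affComp q (inner ℝ ν x₀ • ν)
    (LinearMap.id - (LinearMap.toSpanSingleton ℝ (Pt d) ν) ∘ₗ (innerSL ℝ ν).toLinearMap)

lemma pval_normalExt {d : ℕ} (q : Poly d) (ν x₀ x : Pt d) :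
    pval (normalExt q ν x₀) x = pval q (x - inner ℝ ν (x - x₀) • ν) := by
  rw [normalExt, pval_affComp]
  congr 1
  change _ + (x - inner ℝ ν x • ν) = _
  rw [inner_sub_right, sub_smul]
  abel

lemma totalDegree_normalExt_le {d : ℕ} (q : Poly d) (ν x₀ : Pt d) :
    (normalExt q ν x₀).totalDegree ≤ q.totalDegree := totalDegree_affComp_le _ _ _

namespace ScaledElement

variable (K : ScaledElement m) {e : Set (Pt (m + 1))} {x : Pt (m + 1)}

lemma pval_normalExt_eq (he : e ∈ K.F) (q : Poly (m + 1)) (hx : x ∈ e) :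
    pval (normalExt q (K.ν e) (K.base e)) x = pval q x := by
  rw [pval_normalExt, K.isFacetedBody.inner_eq_zero he hx (K.base_mem_face he), zero_smul, sub_zero]

lemma sub_inner_smul_mem_disc (he : e ∈ K.F) (hx : x ∈ K.T) :
    x - inner ℝ (K.ν e) (x - K.base e) • K.ν e ∈ disc (K.base e) (K.frame e) K.h := by
  obtain ⟨y, hy⟩ := (K.isUnitNormal he).exists_eq_inner_smul_add (x - K.base e)
  set a := inner ℝ (K.ν e) (x - K.base e)
  have hproj : x - a • K.ν e = chart (K.base e) (K.frame e) y := by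
    rw [chart, eq_sub_of_add_eq' hy.symm]
    abel
  refine ⟨?_, y, hproj.symm⟩
  rw [hproj, chart_mem_closedBall, mem_closedBall_zero_iff]
  refine le_trans ?_ (K.dist_le _ hx _ (K.base_mem he))
  rw [dist_eq_norm, ← sq_le_sq₀ (norm_nonneg _) (norm_nonneg _), hy, norm_add_sq_real,
    inner_smul_left, (K.isUnitNormal he).orthogonal, (K.frame e).norm_map, mul_zero, mul_zero,
    add_zero]
  exact le_add_of_nonneg_left (sq_nonneg _)

lemma exists_isMaxOn_disc (he : e ∈ K.F) (q : Poly (m + 1)) :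
    ∃ z ∈ disc (K.base e) (K.frame e) K.h,
      ∀ x ∈ disc (K.base e) (K.frame e) K.h, pval q x ^ 2 ≤ pval q z ^ 2 := by
  have hcompact : IsCompact (disc (K.base e) (K.frame e) K.h) :=
    (isCompact_closedBall _ _).inter_right (isometry_chart _ _).isClosedEmbedding.isClosed_range
  obtain ⟨z, hz, hmax⟩ := hcompact.exists_isMaxOn (f := fun x => pval q x ^ 2)
    ⟨_, K.face_subset_disc he (K.base_mem_face he)⟩ (by fun_prop)
  exact ⟨z, hz, fun x hx => hmax hx⟩

variable {K}

lemma IsWeakPderiv.setIntegral_sub_pderiv_mul {r : ℕ} {v : Poly (m + 1)}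
    {b : Set (Pt (m + 1)) → Poly (m + 1)} {j : Fin (m + 1)} {g ψ : Poly (m + 1)}
    (hg : K.IsWeakPderiv r v b j g) (hψ : ψ.totalDegree ≤ r) (he : e ∈ K.F)
    (hψ₀ : ∀ e' ∈ K.F, e' ≠ e → ∀ x ∈ e', pval ψ x = 0) :
    ∫ x in K.T, pval (g - MvPolynomial.pderiv j v) x * pval ψ x =
      K.ν e j * ∫ x in e, pval (b e - v) x * pval ψ x ∂μHE[m] := by
  have hface := hg ψ hψ
  rw [Finset.sum_eq_single_of_mem e he fun e' he' hne => by
    rw [setIntegral_eq_zero_of_forall_eq_zero fun x hx => by rw [hψ₀ e' he' hne x hx, mul_zero],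
      mul_zero], ← sub_eq_iff_eq_add',
    ← integral_sub (K.integrableOn (by fun_prop)) (K.integrableOn (by fun_prop))] at hface
  simpa only [pval_sub, sub_mul] using hface

lemma le_of_forall_setIntegral_mul_eq {ψ : Poly (m + 1)} {D : Fin (m + 1) → Poly (m + 1)}
    {W Y t : ℝ} (he : e ∈ K.F) (hW : ∀ j, ∫ x in K.T, pval (D j) x * pval ψ x = K.ν e j * W)
    (hY : 0 ≤ Y) (hψ : ∀ x ∈ K.T, pval ψ x ^ 2 ≤ Y) (ht : 0 < t) :
    W ≤ t * (∑ j, ∫ x in K.T, pval (D j) x ^ 2) +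
      (m + 1) * (1 / (4 * t) * (Y * (ballVol (m + 1) * K.h ^ (m + 1)))) := by
  set B := Y * (ballVol (m + 1) * K.h ^ (m + 1))
  have hterm (j : Fin (m + 1)) : K.ν e j * (K.ν e j * W) ≤
      t * (∫ x in K.T, pval (D j) x ^ 2) + 1 / (4 * t) * B :=
    calc K.ν e j * (K.ν e j * W) ≤ |K.ν e j| * |K.ν e j * W| := by
          rw [← abs_mul]
          exact le_abs_self _
      _ ≤ 1 * |K.ν e j * W| := by
          gcongr
          exact K.abs_normal_le he j
      _ ≤ t * (∫ x in K.T, pval (D j) x ^ 2) + 1 / (4 * t) * ∫ x in K.T, pval ψ x ^ 2 := by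
          rw [one_mul, ← hW]
          exact abs_integral_mul_le (K.integrableOn (by fun_prop)) (K.integrableOn (by fun_prop)) ht
      _ ≤ _ := by
          gcongr
          exact K.setIntegral_le (by fun_prop) hY hψ
  calc W = ∑ j, K.ν e j * (K.ν e j * W) := by
        simp only [← mul_assoc, ← sq]
        rw [← Finset.sum_mul, K.sum_normal_sq he, one_mul]
    _ ≤ ∑ j, (t * (∫ x in K.T, pval (D j) x ^ 2) + 1 / (4 * t) * B) :=
        Finset.sum_le_sum fun j _ => hterm j
    _ = _ := by
        rw [Finset.sum_add_distrib, ← Finset.mul_sum, Finset.sum_const, Finset.card_univ,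
          Fintype.card_fin, nsmul_eq_mul, Nat.cast_succ]

open Classical in
/-- The test function is the face bubble function of `e` times the normal extension of the jump. -/
lemma setIntegral_face_bubble_mul_sq_le {r k s : ℕ} {v : Poly (m + 1)}
    {b : Set (Pt (m + 1)) → Poly (m + 1)} {g : Fin (m + 1) → Poly (m + 1)}
    (hg : ∀ j, K.IsWeakPderiv r v b j (g j)) (hs : K.IsBubbleExponent s)
    (hr : s * (K.F.card - 1) + k ≤ r) (he : e ∈ K.F) (hq : (b e - v).totalDegree ≤ k) {Y t : ℝ}
    (hY : ∀ x ∈ disc (K.base e) (K.frame e) K.h, pval (b e - v) x ^ 2 ≤ Y) (ht : 0 < t) :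
    ∫ x in e, pval (K.bubble s (K.F.erase e)) x * pval (b e - v) x ^ 2 ∂μHE[m] ≤
      t * (∑ j, ∫ x in K.T, pval (g j - MvPolynomial.pderiv j v) x ^ 2) +
        (m + 1) * (1 / (4 * t) * (Y * (ballVol (m + 1) * K.h ^ (m + 1)))) := by
  have hsub : K.F.erase e ⊆ K.F := K.F.erase_subset e
  set q := b e - v
  set Φ := K.bubble s (K.F.erase e)
  set q' := normalExt q (K.ν e) (K.base e)
  have hdeg : (Φ * q').totalDegree ≤ r := by
    refine (MvPolynomial.totalDegree_mul _ _).trans ((add_le_add ?_ ?_).trans hr)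
    · rw [← Finset.card_erase_of_mem he]
      exact K.totalDegree_bubble_le s _
    · exact (totalDegree_normalExt_le _ _ _).trans hq
  have hvanish : ∀ e' ∈ K.F, e' ≠ e → ∀ x ∈ e', pval (Φ * q') x = 0 := fun e' he' hne x hx => by
    rw [pval_mul, K.pval_bubble_eq_zero hsub hs.pos.ne' (Finset.mem_erase.2 ⟨hne, he'⟩) hx,
      zero_mul]
  have hW : ∫ x in e, pval q x * pval (Φ * q') x ∂μHE[m] =
      ∫ x in e, pval Φ x * pval q x ^ 2 ∂μHE[m] :=
    setIntegral_congr_fun (K.measurableSet_face he) fun x hx => by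
      simp only [pval_mul, q', K.pval_normalExt_eq he q hx]
      ring
  have hY₀ : 0 ≤ Y := (sq_nonneg _).trans (hY _ (K.face_subset_disc he (K.base_mem_face he)))
  refine le_of_forall_setIntegral_mul_eq (ψ := Φ * q') he (fun j => ?_) hY₀ (fun x hx => ?_) ht
  · rw [(hg j).setIntegral_sub_pderiv_mul hdeg he hvanish, hW]
  · rw [pval_mul, mul_pow]
    have hΦ : pval Φ x ^ 2 ≤ 1 := pow_le_one₀ (hs.bubble_nonneg hsub hx) (hs.bubble_le_one hsub hx)
    have hq' : pval q' x ^ 2 ≤ Y := by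
      rw [pval_normalExt]
      exact hY _ (K.sub_inner_smul_mem_disc he hx)
    exact (mul_le_of_le_one_left (sq_nonneg _) hΦ).trans hq'

end ScaledElement

lemma exists_jump_le (m k N : ℕ) {ρ δ : ℝ} (hρ : 0 < ρ) (hδ : 0 < δ) :
    ∃ C > 0, ∀ K : ScaledElement m, K.IsSeparated δ → K.F.card ≤ N →
      ∀ s r, K.IsBubbleExponent s → s * (K.F.card - 1) + k ≤ r →
      ∀ v b (g : Fin (m + 1) → Poly (m + 1)), (∀ j, K.IsWeakPderiv r v b j (g j)) →
      ∀ e ∈ K.F, ρ * K.h ^ m ≤ (μHE[m] : Measure (Pt (m + 1))).real e →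
        (b e - v).totalDegree ≤ k →
        K.h⁻¹ * ∫ x in e, pval (b e - v) x ^ 2 ∂μHE[m] ≤
          C * ∑ j, ∫ x in K.T, pval (g j - MvPolynomial.pderiv j v) x ^ 2 := by
  classical
  obtain ⟨c, hc, hbubble⟩ := exists_sq_le_setIntegral_face_bubble m k N hρ hδ
  have hV := ballVol_nonneg (m + 1)
  have hVm := ballVol_nonneg m
  set L : ℝ := (m + 1) * (ballVol (m + 1) + 1) / (2 * c)
  have hL : 0 < L := by positivity
  refine ⟨2 * L * (ballVol m + 1) / c, by positivity, ?_⟩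
  intro K hsep hN s r hs hr v b g hg e he hρe hq
  have hh := K.h_pos
  obtain ⟨z, hz, hmax⟩ := K.exists_isMaxOn_disc he (b e - v)
  set Y := pval (b e - v) z ^ 2
  set D := ∑ j, ∫ x in K.T, pval (g j - MvPolynomial.pderiv j v) x ^ 2
  have hY : 0 ≤ Y := sq_nonneg _
  have hD : 0 ≤ D := Finset.sum_nonneg fun j _ => integral_nonneg fun x => sq_nonneg _
  have hYD : c * (Y * K.h ^ m) ≤ L * K.h * D + c / 2 * (Y * K.h ^ m) :=
    calc c * (Y * K.h ^ m) ≤ L * K.h * D + (m + 1) *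
          (1 / (4 * (L * K.h)) * (Y * (ballVol (m + 1) * K.h ^ (m + 1)))) :=
          (hbubble K hsep hN s hs e he hρe _ hq z hz).trans
            (setIntegral_face_bubble_mul_sq_le hg hs hr he hq hmax (by positivity))
      _ = L * K.h * D + ballVol (m + 1) / (ballVol (m + 1) + 1) * (c / 2 * (Y * K.h ^ m)) := by
          simp only [L]
          field_simp
          ring
      _ ≤ L * K.h * D + c / 2 * (Y * K.h ^ m) := by
          refine (add_le_add_iff_left _).2 (mul_le_of_le_one_left (by positivity) ?_)
          exact div_le_one_of_le₀ (by linarith) (by linarith)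
  clear_value L Y D
  calc K.h⁻¹ * ∫ x in e, pval (b e - v) x ^ 2 ∂μHE[m] ≤ K.h⁻¹ * (Y * (ballVol m * K.h ^ m)) := by
        gcongr
        exact K.setIntegral_face_le he (by fun_prop) hY
          fun x hx => hmax x (K.face_subset_disc he hx)
    _ = 2 / c * (K.h⁻¹ * ballVol m) * (c / 2 * (Y * K.h ^ m)) := by field_simp
    _ ≤ 2 / c * (K.h⁻¹ * ballVol m) * (L * K.h * D) :=
        mul_le_mul_of_nonneg_left (by linarith) (by positivity)
    _ = 2 * L * ballVol m / c * D := by field_simp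
    _ ≤ 2 * L * (ballVol m + 1) / c * D := by gcongr; linarith

end Local

/-! ### Existence of the discrete weak gradient -/

section Riesz

variable {d : ℕ} {μ : Measure (Pt d)}

/-- The `L²(μ)` inner product of polynomials. -/
def l2Form (μ : Measure (Pt d)) (hμ : ∀ p : Poly d, Integrable (pval p) μ) :
    Poly d →ₗ[ℝ] Poly d →ₗ[ℝ] ℝ :=
  have hmul (p q : Poly d) : Integrable (fun x => pval p x * pval q x) μ :=
    (hμ (p * q)).congr (.of_forall (pval_mul p q))
  LinearMap.mk₂ ℝ (fun p q => ∫ x, pval p x * pval q x ∂μ)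
    (fun p p' q => by simp only [pval_add, add_mul, integral_add (hmul p q) (hmul p' q)])
    (fun c p q => by simp only [pval_smul, mul_assoc, integral_const_mul, smul_eq_mul])
    (fun p q q' => by simp only [pval_add, mul_add, integral_add (hmul p q) (hmul p q')])
    (fun c p q => by simp only [pval_smul, mul_left_comm, integral_const_mul, smul_eq_mul])

lemma l2Form_apply (hμ : ∀ p : Poly d, Integrable (pval p) μ) (p q : Poly d) :
    l2Form μ hμ p q = ∫ x, pval p x * pval q x ∂μ := rfl

lemma exists_forall_integral_mul_eq (hμ : ∀ p : Poly d, Integrable (pval p) μ)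
    (hdef : ∀ p : Poly d, ∫ x, pval p x ^ 2 ∂μ = 0 → p = 0) (r : ℕ) (L : Poly d →ₗ[ℝ] ℝ) :
    ∃ g : Poly d, g.totalDegree ≤ r ∧
      ∀ ψ : Poly d, ψ.totalDegree ≤ r → ∫ x, pval g x * pval ψ x ∂μ = L ψ := by
  let V := MvPolynomial.restrictTotalDegree (Fin d) ℝ r
  let B : V →ₗ[ℝ] V →ₗ[ℝ] ℝ := (l2Form μ hμ).compl₁₂ V.subtype V.subtype
  have hinj : Function.Injective B := (injective_iff_map_eq_zero B).2 fun p hp =>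
    Subtype.ext <| hdef p <| by simpa [B, l2Form_apply, sq] using DFunLike.congr_fun hp p
  have hsurj : Function.Surjective B :=
    (LinearMap.injective_iff_surjective_of_finrank_eq_finrank
      (Subspace.dual_finrank_eq (K := ℝ) (V := V)).symm).1 hinj
  obtain ⟨g, hg⟩ := hsurj (L ∘ₗ V.subtype)
  exact ⟨g, (MvPolynomial.mem_restrictTotalDegree _ _ _).1 g.2, fun ψ hψ =>
    DFunLike.congr_fun hg ⟨ψ, (MvPolynomial.mem_restrictTotalDegree _ _ _).2 hψ⟩⟩

lemma eq_zero_of_setIntegral_sq_eq_zero {T : Set (Pt d)} (hT : MeasurableSet T)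
    (hvol : volume T ≠ 0) {p : Poly d} (hp : IntegrableOn (fun x => pval p x ^ 2) T)
    (hzero : ∫ x in T, pval p x ^ 2 = 0) : p = 0 := by
  by_contra hne
  rw [setIntegral_eq_zero_iff_of_nonneg_ae (Filter.Eventually.of_forall fun x => sq_nonneg _) hp]
    at hzero
  refine hvol (measure_mono_null_ae ?_ (volume_setOf_pval_eq_zero hne))
  filter_upwards [(ae_restrict_iff' hT).1 hzero] with x hx hxT
  exact sq_eq_zero_iff.1 (hx hxT)

end Riesz

namespace ScaledElement

variable {m : ℕ} (K : ScaledElement m)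

lemma exists_isWeakPderiv (hK : volume K.T ≠ 0) (r : ℕ) (v : Poly (m + 1))
    (b : Set (Pt (m + 1)) → Poly (m + 1)) (j : Fin (m + 1)) :
    ∃ g : Poly (m + 1), g.totalDegree ≤ r ∧ K.IsWeakPderiv r v b j g := by
  have hcell (p : Poly (m + 1)) : Integrable (pval p) (volume.restrict K.T) :=
    K.integrableOn (by fun_prop)
  have hface (e : K.F) (p : Poly (m + 1)) : Integrable (pval p) (μHE[m].restrict e.1) :=
    K.integrableOn_face e.2 (by fun_prop)
  obtain ⟨g, hg, hgL⟩ := exists_forall_integral_mul_eq hcell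
    (fun p => eq_zero_of_setIntegral_sq_eq_zero K.measurableSet hK (K.integrableOn (by fun_prop)))
    r (l2Form _ hcell (MvPolynomial.pderiv j v) +
      ∑ e ∈ K.F.attach, K.ν e j • l2Form _ (hface e) (b e - v))
  refine ⟨g, hg, fun ψ hψ => ?_⟩
  rw [hgL ψ hψ, LinearMap.add_apply, LinearMap.sum_apply, l2Form_apply]
  simp only [LinearMap.smul_apply, l2Form_apply, smul_eq_mul]
  rw [K.F.sum_attach fun e => K.ν e j * ∫ x in e, pval (b e - v) x * pval ψ x ∂μHE[m]]

lemma integral_pderiv_mul_add (v ψ : Poly (m + 1)) (b : Set (Pt (m + 1)) → Poly (m + 1))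
    (j : Fin (m + 1)) :
    (∫ x in K.T, pval (MvPolynomial.pderiv j v) x * pval ψ x) +
        ∑ e ∈ K.F, K.ν e j * ∫ x in e, pval (b e - v) x * pval ψ x ∂μHE[m] =
      -(∫ x in K.T, pval v x * pval (MvPolynomial.pderiv j ψ) x) +
        ∑ e ∈ K.F, K.ν e j * ∫ x in e, pval (b e) x * pval ψ x ∂μHE[m] := by
  have hdiv := K.isFacetedBody.setIntegral_pderiv (v * ψ) j
  simp only [Derivation.leibniz, smul_eq_mul, pval_add, pval_mul] at hdiv
  rw [integral_add (K.integrableOn (by fun_prop)) (K.integrableOn (by fun_prop))] at hdiv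
  have hface : ∀ e ∈ K.F, K.ν e j * ∫ x in e, pval (b e - v) x * pval ψ x ∂μHE[m] =
      K.ν e j * ∫ x in e, pval (b e) x * pval ψ x ∂μHE[m] -
        K.ν e j * ∫ x in e, pval v x * pval ψ x ∂μHE[m] := fun e he => by
    simp only [pval_sub, sub_mul]
    rw [integral_sub (K.integrableOn_face he (by fun_prop)) (K.integrableOn_face he (by fun_prop)),
      mul_sub]
  rw [Finset.sum_congr rfl hface, Finset.sum_sub_distrib, ← hdiv]
  simp only [mul_comm (pval ψ _)]
  ring

lemma integral_sum_sum_mul {ι : Type*} [Fintype ι] (G φ : ι → ι → Poly (m + 1)) :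
    ∫ x in K.T, ∑ i, ∑ j, pval (G i j) x * pval (φ i j) x =
      ∑ i, ∑ j, ∫ x in K.T, pval (G i j) x * pval (φ i j) x := by
  rw [integral_finsetSum _ fun i _ => K.integrableOn (by fun_prop)]
  exact Finset.sum_congr rfl fun i _ => integral_finsetSum _ fun j _ => K.integrableOn (by fun_prop)

end ScaledElement

/-! ### The elements of a mesh -/

lemma mem_facesOn {d : ℕ} {F : Finset (Set (Pt d))} {T e : Set (Pt d)} :
    e ∈ facesOn F T ↔ e ∈ F ∧ e ⊆ frontier T := by
  classical
  exact Finset.mem_filter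

section Convex

variable {m : ℕ}

/-- If `x` were beyond the plane of `e`, then `T` would contain a segment leaving the base point
in the normal direction, the other half of the convex combination being absorbed by the face. -/
lemma IsFaceChart.inner_sub_nonneg_of_convex {T e : Set (Pt (m + 1))} {x₀ ν x : Pt (m + 1)}
    {ι : Pt m →ₗᵢ[ℝ] Pt (m + 1)} (h : IsFaceChart e x₀ ι) (hν : IsOutwardNormal T e ν)
    (hT : Convex ℝ T) (he : e ⊆ T) (hx : x ∈ T) : 0 ≤ inner ℝ ν (x₀ - x) := by
  by_contra! hneg
  set c := inner ℝ ν (x - x₀)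
  have hc : 0 < c := by
    rw [← neg_sub, inner_neg_right] at hneg
    linarith
  obtain ⟨y, hy⟩ := (h.isUnitNormal hν).exists_eq_inner_smul_add (x - x₀)
  obtain ⟨ε, hε, hout⟩ := hν.outside x₀ h.base
  have hface : ∀ᶠ u : ℝ in nhds 0, chart x₀ ι (-(u / (1 - u)) • y) ∈ e := by
    have hbase : (0 : Pt m) ∈ interior (chart x₀ ι ⁻¹' e) := by
      obtain ⟨z, hz, hzx⟩ := h.intrinsicInterior_eq ▸ h.base
      have hz₀ : z = 0 := (isometry_chart x₀ ι).injective (hzx.trans (by simp [chart]))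
      exact hz₀ ▸ hz
    have hcont : ContinuousAt (fun u : ℝ => -(u / (1 - u)) • y) 0 :=
      ((continuousAt_id.div (by fun_prop) (by simp)).neg).smul continuousAt_const
    have hnhds : chart x₀ ι ⁻¹' e ∈ nhds (-((0 : ℝ) / (1 - 0)) • y) :=
      mem_interior_iff_mem_nhds.1 (by simpa only [zero_div, neg_zero, zero_smul] using hbase)
    exact hcont hnhds
  have hsmall : ∀ᶠ u : ℝ in nhds 0, u < 1 ∧ u * c < ε :=
    (eventually_lt_nhds one_pos).and
      ((continuousAt_id.mul continuousAt_const).eventually_lt continuousAt_const (by simpa))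
  obtain ⟨u, ⟨hu_face, hu_lt, huc⟩, hu⟩ :=
    (((hface.and hsmall).filter_mono nhdsWithin_le_nhds).and
      (self_mem_nhdsWithin : Set.Ioi (0 : ℝ) ∈ nhdsWithin 0 (Set.Ioi 0))).exists
  refine hout (u * c) (mul_pos hu hc) huc ?_
  convert hT (he hu_face) hx (sub_nonneg.2 hu_lt.le) (le_of_lt hu) (by ring) using 1
  have hne : 1 - u ≠ 0 := (sub_pos.2 hu_lt).ne'
  rw [← sub_add_cancel x x₀, hy, chart]
  simp only [map_neg, map_smul, smul_add, smul_smul, neg_smul, smul_neg, mul_div_cancel₀ _ hne]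
  module

namespace ScaledElement

variable (K : ScaledElement m)

lemma isBubbleExponent_two : K.IsBubbleExponent 2 :=
  ⟨two_pos, le_rfl, fun _ _ _ _ => sq_nonneg _⟩

lemma isBubbleExponent_one (hK : Convex ℝ K.T) : K.IsBubbleExponent 1 where
  pos := one_pos
  le_two := one_le_two
  nonneg e he x hx := by
    rw [pow_one, pval_planePoly]
    exact div_nonneg ((K.isFaceChart e he).inner_sub_nonneg_of_convex (K.isFacetedBody.normal e he)
      hK (K.isFacetedBody.subset he) hx) K.h_pos.le

lemma infDist_affineSpan_le {e : Set (Pt (m + 1))} (he : e ∈ K.F) (x : Pt (m + 1)) :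
    Metric.infDist x (affineSpan ℝ e : Set (Pt (m + 1))) ≤ K.h * |pval (K.planePoly e) x| := by
  have hν := K.isUnitNormal he
  set c : ℝ := inner ℝ (K.ν e) (x - K.base e)
  have hmem : x - c • K.ν e ∈ affineSpan ℝ e := by
    rw [(K.isFaceChart e he).mem_affineSpan_iff hν, sub_right_comm, inner_sub_right,
      inner_smul_right, real_inner_self_eq_norm_sq, hν.unit, one_pow, mul_one, sub_self]
  calc Metric.infDist x (affineSpan ℝ e : Set (Pt (m + 1))) ≤ dist x (x - c • K.ν e) :=
        Metric.infDist_le_dist_of_mem hmem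
    _ = |c| := by rw [dist_eq_norm, sub_sub_cancel, norm_smul, hν.unit, mul_one, Real.norm_eq_abs]
    _ = K.h * |pval (K.planePoly e) x| := by
        rw [pval_planePoly, abs_div, abs_of_pos K.h_pos, mul_div_cancel₀ _ K.h_pos.ne', ← abs_neg,
          ← inner_neg_right, neg_sub]

end ScaledElement

end Convex

lemma IsFacetedBody.nonempty_faces {m : ℕ} {T : Set (Pt (m + 1))} {F : Finset (Set (Pt (m + 1)))}
    {ν : Set (Pt (m + 1)) → Pt (m + 1)} (hT : IsFacetedBody T F ν) (hne : T.Nonempty) :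
    F.Nonempty := by
  have huniv : T ≠ Set.univ := by
    rintro rfl
    exact NoncompactSpace.noncompact_univ
      (Metric.isCompact_of_isClosed_isBounded hT.isClosed hT.isBounded)
  obtain ⟨x, hx⟩ := nonempty_frontier_iff.2 ⟨hne, huniv⟩
  rw [hT.frontier_eq] at hx
  obtain ⟨e, he, -⟩ := Set.mem_iUnion₂.1 hx
  exact ⟨e, he⟩

namespace Mesh

variable {m : ℕ} {Ω : Set (Pt (m + 1))} {M : Mesh (m + 1) Ω} {T : Set (Pt (m + 1))} {δ : ℝ}

lemma isBounded_cell (M : Mesh (m + 1) Ω) (hΩ : Bornology.IsBounded Ω) (hT : T ∈ M.cells) :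
    Bornology.IsBounded T :=
  hΩ.closure.subset (M.cover ▸ Set.subset_biUnion_of_mem (u := fun T => T) hT)

lemma diam_cell_pos (M : Mesh (m + 1) Ω) (hΩ : Bornology.IsBounded Ω) (hT : T ∈ M.cells) :
    0 < Metric.diam T := by
  obtain ⟨x, hx⟩ := (M.isElement T hT).connected.nonempty
  exact Metric.diam_pos (infinite_of_mem_nhds x (mem_interior_iff_mem_nhds.1 hx)).nontrivial
    (M.isBounded_cell hΩ hT)

lemma isFacetedBody_cell (hΩ : Bornology.IsBounded Ω) (hδ : 0 < δ) (hM : M.NoncoplanarFaces δ)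
    (hT : T ∈ M.cells) : IsFacetedBody T (M.facesOf T) (outwardNormal T) where
  isClosed := (M.isElement T hT).regular ▸ isClosed_closure
  isBounded := M.isBounded_cell hΩ hT
  frontier_eq := M.boundary T hT
  flat e he := M.isFlatFace e (mem_facesOn.1 he).1
  normal e he := Classical.epsilon_spec (M.normal T hT e he)
  noncoplanar e he e' he' hne := by
    obtain ⟨x, hx, hxδ⟩ := hM T hT e he e' he' hne
    refine ⟨x, hx, fun hmem => ?_⟩
    rw [Metric.infDist_zero_of_mem (s := (affineSpan ℝ e' : Set (Pt (m + 1)))) hmem] at hxδ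
    exact hxδ.not_gt (mul_pos hδ (M.diam_cell_pos hΩ hT))

/-- `K` is an element of the mesh `M` with its faces, its normals and its diameter. -/
structure IsScaledCell (M : Mesh (m + 1) Ω) (K : ScaledElement m) : Prop where
  mem : K.T ∈ M.cells
  faces_eq : K.F = M.facesOf K.T
  normal_eq : K.ν = outwardNormal K.T
  diam_eq : K.h = Metric.diam K.T

lemma exists_isScaledCell (hΩ : Bornology.IsBounded Ω) (hδ : 0 < δ) (hM : M.NoncoplanarFaces δ)
    (hT : T ∈ M.cells) : ∃ K : ScaledElement m, K.T = T ∧ M.IsScaledCell K := by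
  have hbody := isFacetedBody_cell hΩ hδ hM hT
  have hT₀ : T.Nonempty := (M.isElement T hT).connected.nonempty.mono interior_subset
  obtain ⟨e₀, he₀⟩ := hbody.nonempty_faces hT₀
  obtain ⟨-, ι₀, -⟩ := (hbody.flat e₀ he₀).exists_isFaceChart
  have : Nonempty (Pt m →ₗᵢ[ℝ] Pt (m + 1)) := ⟨ι₀⟩
  choose! base frame hchart using fun e he => (hbody.flat e he).exists_isFaceChart
  let K : ScaledElement m :=
    { T := T
      F := M.facesOf T
      ν := outwardNormal T
      base := base
      frame := frame
      h := Metric.diam T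
      isFacetedBody := hbody
      isFaceChart := hchart
      nonempty := hT₀
      h_pos := M.diam_cell_pos hΩ hT
      dist_le := fun x hx y hy => Metric.dist_le_diam_of_mem (M.isBounded_cell hΩ hT) hx hy }
  exact ⟨K, rfl, hT, rfl, rfl, rfl⟩

namespace IsScaledCell

variable {K : ScaledElement m} {k : ℕ}

lemma isSeparated (hK : M.IsScaledCell K) (hM : M.NoncoplanarFaces δ) : K.IsSeparated δ := by
  intro e he e' he' hne
  obtain ⟨x, hx, hxδ⟩ := hM K.T hK.mem e (hK.faces_eq ▸ he) e' (hK.faces_eq ▸ he') hne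
  refine ⟨x, hx, le_of_mul_le_mul_left ?_ K.h_pos⟩
  rw [mul_comm, hK.diam_eq]
  exact hxδ.trans (hK.diam_eq ▸ K.infDist_affineSpan_le he' x)

lemma exists_isBubbleExponent (hK : M.IsScaledCell K) {r : Set (Pt (m + 1)) → ℕ}
    (hr : M.AdmissibleDegree k r) :
    ∃ s, K.IsBubbleExponent s ∧ r K.T = s * K.F.card + k - 1 := by
  rw [hK.faces_eq]
  rcases hr K.T hK.mem with hr | ⟨hconv, hr⟩
  · exact ⟨2, K.isBubbleExponent_two, hr⟩
  · exact ⟨1, K.isBubbleExponent_one hconv, by rw [one_mul]; exact hr⟩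

end IsScaledCell

end Mesh

/-! ### The two norms -/

lemma forall_sum_eq_sum_iff {ι β M : Type*} [Fintype ι] [Zero β] [AddCommMonoid M] {P : β → Prop}
    (hP : P 0) {A B : ι → β → M} (hA : ∀ i, A i 0 = 0) (hB : ∀ i, B i 0 = 0) :
    (∀ φ : ι → β, (∀ i, P (φ i)) → ∑ i, A i (φ i) = ∑ i, B i (φ i)) ↔
      ∀ i ψ, P ψ → A i ψ = B i ψ := by
  classical
  refine ⟨fun h i ψ hψ => ?_, fun h φ hφ => Finset.sum_congr rfl fun i _ => h i _ (hφ i)⟩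
  have hsingle {A : ι → β → M} (hA : ∀ i, A i 0 = 0) :
      ∑ j, A j ((Pi.single i ψ : ι → β) j) = A i ψ := by
    rw [Fintype.sum_eq_single i fun j hj => by rw [Pi.single_eq_of_ne hj, hA], Pi.single_eq_same]
  rw [← hsingle hA, ← hsingle hB]
  refine h _ fun j => ?_
  rcases eq_or_ne j i with rfl | hj
  · rwa [Pi.single_eq_same]
  · rwa [Pi.single_eq_of_ne hj]

lemma sqrt_sum_le_mul_sqrt_sum {ι : Type*} {s : Finset ι} {a b : ι → ℝ} {C : ℝ} (hC : 0 ≤ C)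
    (h : ∀ i ∈ s, a i ≤ C * b i) : √(∑ i ∈ s, a i) ≤ √C * √(∑ i ∈ s, b i) := by
  rw [← Real.sqrt_mul hC, Finset.mul_sum]
  exact Real.sqrt_le_sqrt (Finset.sum_le_sum h)

namespace Mesh.IsScaledCell

variable {m : ℕ} {Ω : Set (Pt (m + 1))} {M : Mesh (m + 1) Ω} {K : ScaledElement m}

lemma weakGradient_rhs_eq (hK : M.IsScaledCell K) (v : WeakFunction (m + 1))
    (φ : Fin (m + 1) → Fin (m + 1) → Poly (m + 1)) :
    -(∫ x in K.T, ∑ i, pval (v.inner K.T i) x * ∑ j, pval (MvPolynomial.pderiv j (φ i j)) x)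
      + ∑ e ∈ M.facesOf K.T, ∫ x in e,
          ∑ i, pval (v.bdry e i) x * (∑ j, pval (φ i j) x * outwardNormal K.T e j) ∂μHE[m] =
    ∑ i, ∑ j, (-(∫ x in K.T, pval (v.inner K.T i) x * pval (MvPolynomial.pderiv j (φ i j)) x) +
      ∑ e ∈ K.F, K.ν e j * ∫ x in e, pval (v.bdry e i) x * pval (φ i j) x ∂μHE[m]) := by
  have hface : ∀ e ∈ K.F, ∫ x in e,
      ∑ i, pval (v.bdry e i) x * (∑ j, pval (φ i j) x * K.ν e j) ∂μHE[m] =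
      ∑ i, ∑ j, K.ν e j * ∫ x in e, pval (v.bdry e i) x * pval (φ i j) x ∂μHE[m] := fun e he => by
    simp only [Finset.mul_sum, ← mul_assoc, mul_comm _ (K.ν e _)]
    rw [integral_finsetSum _ fun i _ => K.integrableOn_face he (by fun_prop)]
    refine Finset.sum_congr rfl fun i _ => ?_
    rw [integral_finsetSum _ fun j _ => K.integrableOn_face he (by fun_prop)]
    simp only [mul_assoc, integral_const_mul]
  rw [← hK.faces_eq, ← hK.normal_eq, Finset.sum_congr rfl hface]
  simp only [Finset.mul_sum, Finset.sum_add_distrib, Finset.sum_neg_distrib]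
  rw [K.integral_sum_sum_mul (fun i _ => v.inner K.T i) fun i j => MvPolynomial.pderiv j (φ i j),
    Finset.sum_comm]
  simp only [Finset.sum_comm (s := K.F)]

lemma isWeakGradient_iff (hK : M.IsScaledCell K) {r : ℕ} {v : WeakFunction (m + 1)}
    {G : Fin (m + 1) → Fin (m + 1) → Poly (m + 1)} :
    IsWeakGradient M r K.T v G ↔ (∀ i j, (G i j).totalDegree ≤ r) ∧
      ∀ i j, K.IsWeakPderiv r (v.inner K.T i) (fun e => v.bdry e i) j (G i j) := by
  have hdeg₀ : (0 : Poly (m + 1)).totalDegree ≤ r := by simp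
  let A (i j : Fin (m + 1)) (ψ : Poly (m + 1)) : ℝ := ∫ x in K.T, pval (G i j) x * pval ψ x
  let B (i j : Fin (m + 1)) (ψ : Poly (m + 1)) : ℝ :=
    (∫ x in K.T, pval (MvPolynomial.pderiv j (v.inner K.T i)) x * pval ψ x) +
      ∑ e ∈ K.F, K.ν e j * ∫ x in e, pval (v.bdry e i - v.inner K.T i) x * pval ψ x ∂μHE[m]
  have hentries : (∀ φ : Fin (m + 1) → Fin (m + 1) → Poly (m + 1),
      (∀ i j, (φ i j).totalDegree ≤ r) → ∑ i, ∑ j, A i j (φ i j) = ∑ i, ∑ j, B i j (φ i j)) ↔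
      ∀ i j, K.IsWeakPderiv r (v.inner K.T i) (fun e => v.bdry e i) j (G i j) :=
    (forall_sum_eq_sum_iff (P := fun ψ : Fin (m + 1) → Poly (m + 1) => ∀ j, (ψ j).totalDegree ≤ r)
      (A := fun i ψ => ∑ j, A i j (ψ j)) (B := fun i ψ => ∑ j, B i j (ψ j)) (fun _ => hdeg₀)
      (by simp [A]) (by simp [B])).trans <| forall_congr' fun i =>
        forall_sum_eq_sum_iff (P := fun ψ : Poly (m + 1) => ψ.totalDegree ≤ r) (A := A i) (B := B i)
          hdeg₀ (by simp [A]) (by simp [B])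
  refine ⟨fun h => ⟨h.deg, hentries.1 fun φ hφ => ?_⟩, fun h => ⟨h.1, fun φ hφ => ?_⟩⟩
  · simp only [A, B, K.integral_pderiv_mul_add]
    rw [← K.integral_sum_sum_mul, ← hK.weakGradient_rhs_eq]
    exact h.eq φ hφ
  · have hφ_eq := hentries.2 h.2 φ hφ
    simp only [A, B, K.integral_pderiv_mul_add] at hφ_eq
    rw [K.integral_sum_sum_mul]
    exact hφ_eq.trans (hK.weakGradient_rhs_eq v φ).symm

lemma isWeakGradient_weakGradient (hK : M.IsScaledCell K) (hvol : volume K.T ≠ 0) (r : ℕ)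
    (v : WeakFunction (m + 1)) : IsWeakGradient M r K.T v (weakGradient M r K.T v) := by
  choose G hG using fun i j =>
    K.exists_isWeakPderiv hvol r (v.inner K.T i) (fun e => v.bdry e i) j
  exact Classical.epsilon_spec ⟨G, hK.isWeakGradient_iff.2
    ⟨fun i j => (hG i j).1, fun i j => (hG i j).2⟩⟩

end Mesh.IsScaledCell

section LocalEquivalence

variable {m : ℕ}

namespace ScaledElement

variable (K : ScaledElement m)

/-- The shape regularity of an element in terms of its size: bounds from below on its volume, on
the areas of its faces, and on the separation of the planes of its faces. -/
structure IsRegular (ρ ρ' δ : ℝ) : Prop where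
  volume_ge : ρ * K.h ^ (m + 1) ≤ volume.real K.T
  area_ge : ∀ e ∈ K.F, ρ' * K.h ^ m ≤ (μHE[m] : Measure (Pt (m + 1))).real e
  separated : K.IsSeparated δ

/-- The squared `L²` norm on `K` of a vector field. -/
def normSq (g : Fin (m + 1) → Poly (m + 1)) : ℝ := ∑ j, ∫ x in K.T, pval (g j) x ^ 2

/-- The scaled squared `L²` norm on the faces of `K` of the jump `b - v` of a scalar weak function
`{v, b}`. -/
def jumpSq (v : Poly (m + 1)) (b : Set (Pt (m + 1)) → Poly (m + 1)) : ℝ :=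
  K.h⁻¹ * ∑ e ∈ K.F, ∫ x in e, pval (b e - v) x ^ 2 ∂μHE[m]

/-- The contribution of a scalar weak function `{v, b}` on `K` to the square of the discrete `H¹`
norm, without the reaction term. -/
def h1Sq (v : Poly (m + 1)) (b : Set (Pt (m + 1)) → Poly (m + 1)) : ℝ :=
  K.normSq (fun j => MvPolynomial.pderiv j v) + K.jumpSq v b

lemma normSq_nonneg (g : Fin (m + 1) → Poly (m + 1)) : 0 ≤ K.normSq g :=
  Finset.sum_nonneg fun _ _ => integral_nonneg fun _ => sq_nonneg _

lemma jumpSq_nonneg (v : Poly (m + 1)) (b : Set (Pt (m + 1)) → Poly (m + 1)) :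
    0 ≤ K.jumpSq v b :=
  mul_nonneg (inv_nonneg.2 K.h_pos.le)
    (Finset.sum_nonneg fun _ _ => integral_nonneg fun _ => sq_nonneg _)

lemma normSq_sub_le (g p : Fin (m + 1) → Poly (m + 1)) :
    K.normSq (fun j => g j - p j) ≤ 2 * K.normSq g + 2 * K.normSq p := by
  simp only [normSq, Finset.mul_sum, ← Finset.sum_add_distrib, ← integral_const_mul]
  refine Finset.sum_le_sum fun j _ => ?_
  rw [← integral_add (K.integrableOn (by fun_prop)) (K.integrableOn (by fun_prop))]
  refine setIntegral_mono_on (K.integrableOn (by fun_prop)) (K.integrableOn (by fun_prop))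
    K.measurableSet fun x _ => ?_
  rw [pval_sub]
  linarith [sq_nonneg (pval (g j) x + pval (p j) x)]

end ScaledElement

lemma exists_normSq_le (m k : ℕ) {ρ δ : ℝ} (hρ : 0 < ρ) (hδ : 0 < δ) :
    ∃ C > 0, ∀ K : ScaledElement m, ρ * K.h ^ (m + 1) ≤ volume.real K.T → K.IsSeparated δ →
      ∀ s r, K.IsBubbleExponent s → r = s * K.F.card + k - 1 →
      ∀ v b g, (∀ j, (g j).totalDegree ≤ r) → (∀ j, K.IsWeakPderiv r v b j (g j)) →
        K.normSq g ≤ C * K.h1Sq v b := by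
  obtain ⟨N, hN⟩ := exists_card_faces_le m hδ
  obtain ⟨C, hC, hbound⟩ := exists_weakPderiv_le m (2 * N + k) N hρ
  refine ⟨(m + 1) * C, by positivity, fun K hvol hsep s r hs hr v b g hg hgv => ?_⟩
  have hcard := hN K hsep
  have hr' : r ≤ 2 * N + k := by
    have := Nat.mul_le_mul hs.le_two hcard
    omega
  have hentry (j : Fin (m + 1)) : ∫ x in K.T, pval (g j) x ^ 2 ≤ C * K.h1Sq v b := by
    refine (hbound K hvol hcard r hr' v b j _ (hg j) (hgv j)).trans ?_
    refine mul_le_mul_of_nonneg_left ((add_le_add_iff_right _).2 ?_) hC.le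
    exact Finset.single_le_sum
      (f := fun j => ∫ x in K.T, pval (MvPolynomial.pderiv j v) x ^ 2)
      (fun j _ => integral_nonneg fun x => sq_nonneg _) (Finset.mem_univ j)
  calc K.normSq g ≤ ∑ _ : Fin (m + 1), C * K.h1Sq v b := Finset.sum_le_sum fun j _ => hentry j
    _ = (m + 1) * C * K.h1Sq v b := by simp [mul_assoc]

lemma exists_normSq_pderiv_le (m k : ℕ) {ρ δ : ℝ} (hρ : 0 < ρ) (hδ : 0 < δ) :
    ∃ C > 0, ∀ K : ScaledElement m, ρ * K.h ^ (m + 1) ≤ volume.real K.T → K.IsSeparated δ →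
      ∀ s r, K.IsBubbleExponent s → r = s * K.F.card + k - 1 →
      ∀ v b g, v.totalDegree ≤ k → (∀ j, K.IsWeakPderiv r v b j (g j)) →
        K.normSq (fun j => MvPolynomial.pderiv j v) ≤ C * K.normSq g := by
  obtain ⟨N, hN⟩ := exists_card_faces_le m hδ
  obtain ⟨C, hC, hbound⟩ := exists_pderiv_le m k N hρ
  refine ⟨C, hC, fun K hvol hsep s r hs hr v b g hv hgv => ?_⟩
  rw [ScaledElement.normSq, ScaledElement.normSq, Finset.mul_sum]
  exact Finset.sum_le_sum fun j _ => hbound K hvol (hN K hsep) s r hs (by omega) v b j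
    (g j) hv (hgv j)

lemma exists_jumpSq_le (m k : ℕ) {ρ' δ : ℝ} (hρ' : 0 < ρ') (hδ : 0 < δ) :
    ∃ C > 0, ∀ K : ScaledElement m,
      (∀ e ∈ K.F, ρ' * K.h ^ m ≤ (μHE[m] : Measure (Pt (m + 1))).real e) → K.IsSeparated δ →
      ∀ s r, K.IsBubbleExponent s → r = s * K.F.card + k - 1 →
      ∀ v b (g : Fin (m + 1) → Poly (m + 1)), v.totalDegree ≤ k →
        (∀ e ∈ K.F, (b e).totalDegree ≤ k) → (∀ j, K.IsWeakPderiv r v b j (g j)) →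
        K.jumpSq v b ≤ C * K.normSq fun j => g j - MvPolynomial.pderiv j v := by
  obtain ⟨N, hN⟩ := exists_card_faces_le m hδ
  obtain ⟨C, hC, hbound⟩ := exists_jump_le m k N hρ' hδ
  refine ⟨(N + 1) * C, by positivity, fun K harea hsep s r hs hr v b g hv hb hgv => ?_⟩
  have hcard := hN K hsep
  set D := K.normSq fun j => g j - MvPolynomial.pderiv j v
  have hD : 0 ≤ D := K.normSq_nonneg _
  have hdeg : ∀ e ∈ K.F, s * (K.F.card - 1) + k ≤ r := fun e he => by
    obtain ⟨n, hn⟩ := Nat.exists_eq_add_of_le' (Finset.card_pos.2 ⟨e, he⟩)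
    have := hs.pos
    rw [hr, hn, Nat.add_sub_cancel, Nat.mul_add]
    omega
  calc K.jumpSq v b = ∑ e ∈ K.F, K.h⁻¹ * ∫ x in e, pval (b e - v) x ^ 2 ∂μHE[m] :=
        Finset.mul_sum _ _ _
    _ ≤ ∑ _ ∈ K.F, C * D := Finset.sum_le_sum fun e he =>
        hbound K hsep hcard s r hs (hdeg e he) v b g hgv e he (harea e he)
          ((MvPolynomial.totalDegree_sub _ _).trans (max_le (hb e he) hv))
    _ = K.F.card * (C * D) := by simp
    _ ≤ (N + 1) * (C * D) := by
        gcongr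
        exact (Nat.cast_le.2 hcard).trans (by simp)
    _ = (N + 1) * C * D := (mul_assoc _ _ _).symm

lemma exists_h1Sq_le (m k : ℕ) {ρ ρ' δ : ℝ} (hρ : 0 < ρ) (hρ' : 0 < ρ') (hδ : 0 < δ) :
    ∃ C > 0, ∀ K : ScaledElement m, K.IsRegular ρ ρ' δ →
      ∀ s r, K.IsBubbleExponent s → r = s * K.F.card + k - 1 →
      ∀ v b g, v.totalDegree ≤ k → (∀ e ∈ K.F, (b e).totalDegree ≤ k) →
        (∀ j, K.IsWeakPderiv r v b j (g j)) → K.h1Sq v b ≤ C * K.normSq g := by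
  obtain ⟨C₁, hC₁, hgrad⟩ := exists_normSq_pderiv_le m k hρ hδ
  obtain ⟨C₂, hC₂, hjump⟩ := exists_jumpSq_le m k hρ' hδ
  refine ⟨C₁ + C₂ * (2 + 2 * C₁), by positivity, fun K hK s r hs hr v b g hv hb hgv => ?_⟩
  have hG := hgrad K hK.volume_ge hK.separated s r hs hr v b g hv hgv
  calc K.h1Sq v b
      ≤ C₁ * K.normSq g + C₂ * K.normSq fun j => g j - MvPolynomial.pderiv j v :=
        add_le_add hG (hjump K hK.area_ge hK.separated s r hs hr v b g hv hb hgv)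
    _ ≤ C₁ * K.normSq g + C₂ * (2 * K.normSq g + 2 * (C₁ * K.normSq g)) := by
        gcongr
        exact (K.normSq_sub_le _ _).trans (by gcongr)
    _ = _ := by ring

end LocalEquivalence

section GlobalEquivalence

variable {m : ℕ} {Ω : Set (Pt (m + 1))} {M : Mesh (m + 1) Ω} {K : ScaledElement m}

lemma setIntegral_sum_sq_eq_sum_normSq (K : ScaledElement m)
    (G : Fin (m + 1) → Fin (m + 1) → Poly (m + 1)) :
    ∫ x in K.T, ∑ i, ∑ j, pval (G i j) x ^ 2 = ∑ i, K.normSq (G i) := by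
  simpa only [ScaledElement.normSq, sq] using K.integral_sum_sum_mul G G

lemma Mesh.IsScaledCell.jump_eq_sum_jumpSq (hK : M.IsScaledCell K) (v : WeakFunction (m + 1)) :
    (Metric.diam K.T)⁻¹ * ∑ e ∈ M.facesOf K.T,
        ∫ x in e, ∑ i, (pval (v.inner K.T i) x - pval (v.bdry e i) x) ^ 2 ∂μHE[m] =
      ∑ i, K.jumpSq (v.inner K.T i) fun e => v.bdry e i := by
  simp only [ScaledElement.jumpSq, ← Finset.mul_sum]
  rw [← hK.faces_eq, ← hK.diam_eq, Finset.sum_comm]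
  congr 1
  refine Finset.sum_congr rfl fun e he => ?_
  rw [← integral_finsetSum _ fun i _ => K.integrableOn_face he (by fun_prop)]
  simp only [pval_sub, sub_sq_comm]

lemma Mesh.IsScaledCell.isRegular (hK : M.IsScaledCell K) {ρ ρ' δ : ℝ}
    (hvol : ∀ T ∈ M.cells, ρ * Metric.diam T ^ (m + 1) ≤ volume.real T)
    (harea : ∀ T ∈ M.cells, ∀ e ∈ M.facesOf T,
      ρ' * Metric.diam T ^ m ≤ (μHE[m] : Measure (Pt (m + 1))).real e)
    (hsep : M.NoncoplanarFaces δ) : K.IsRegular ρ ρ' δ where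
  volume_ge := hK.diam_eq ▸ hvol K.T hK.mem
  area_ge e he := hK.diam_eq ▸ harea K.T hK.mem e (hK.faces_eq ▸ he)
  separated := hK.isSeparated hsep

lemma reaction_nonneg {d : ℕ} {κ : Matrix (Fin d) (Fin d) ℝ} (hκ : κ.PosDef) (T : Set (Pt d))
    (v : WeakFunction d) : 0 ≤ reaction κ T v := by
  refine integral_nonneg fun x => ?_
  rw [dotProduct_comm]
  simpa using hκ.inv.posSemidef.dotProduct_mulVec_nonneg (fun i => pval (v.inner T i) x)

lemma exists_weakGradient_equiv (m k : ℕ) {ρ ρ' δ : ℝ} (hρ : 0 < ρ) (hρ' : 0 < ρ') (hδ : 0 < δ) :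
    ∃ C > 0, ∀ (Ω : Set (Pt (m + 1))) (M : Mesh (m + 1) Ω) (K : ScaledElement m),
      M.IsScaledCell K → K.IsRegular ρ ρ' δ → ∀ r, M.AdmissibleDegree k r → ∀ v, MemVh M k v →
        let X := ∑ i, K.normSq (weakGradient M (r K.T) K.T v i)
        let Y := ∑ i, K.h1Sq (v.inner K.T i) fun e => v.bdry e i
        X ≤ C * Y ∧ Y ≤ C * X := by
  obtain ⟨C₁, hC₁, hX⟩ := exists_normSq_le m k hρ hδ
  obtain ⟨C₂, _, hY⟩ := exists_h1Sq_le m k hρ hρ' hδ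
  refine ⟨max C₁ C₂, lt_max_of_lt_left hC₁, fun Ω M K hK hreg r hr v hv => ?_⟩
  have hvol : volume K.T ≠ 0 := fun h => by
    have hle := hreg.volume_ge
    rw [measureReal_def, h, ENNReal.toReal_zero] at hle
    exact hle.not_gt (mul_pos hρ (pow_pos K.h_pos _))
  obtain ⟨s, hs, hrs⟩ := hK.exists_isBubbleExponent hr
  obtain ⟨hdeg, hweak⟩ :=
    hK.isWeakGradient_iff.1 (hK.isWeakGradient_weakGradient hvol (r K.T) v)
  have hX₀ (i) := K.normSq_nonneg (weakGradient M (r K.T) K.T v i)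
  have hY₀ (i) : 0 ≤ K.h1Sq (v.inner K.T i) fun e => v.bdry e i :=
    add_nonneg (K.normSq_nonneg _) (K.jumpSq_nonneg _ _)
  have hb (i) : ∀ e ∈ K.F, (v.bdry e i).totalDegree ≤ k := fun e he =>
    hv.bdry_deg e (mem_facesOn.1 (hK.faces_eq ▸ he : e ∈ M.facesOf K.T)).1 i
  simp only [Finset.mul_sum]
  refine ⟨Finset.sum_le_sum fun i _ => ?_, Finset.sum_le_sum fun i _ => ?_⟩
  · exact (hX K hreg.volume_ge hreg.separated s _ hs hrs _ _ _ (hdeg i) (hweak i)).trans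
      (mul_le_mul_of_nonneg_right (le_max_left _ _) (hY₀ i))
  · exact (hY K hreg s _ hs hrs _ _ _ (hv.inner_deg K.T hK.mem i) (hb i) (hweak i)).trans
      (mul_le_mul_of_nonneg_right (le_max_right _ _) (hX₀ i))

end GlobalEquivalence

/-- The square of the energy norm of `v` on `T`. -/
def cellEnergySq {d : ℕ} {Ω : Set (Pt d)} (M : Mesh d Ω) (κ : Matrix (Fin d) (Fin d) ℝ) (r : ℕ)
    (v : WeakFunction d) (T : Set (Pt d)) : ℝ :=
  (∫ x in T, ∑ i, ∑ j, pval (weakGradient M r T v i j) x ^ 2) + reaction κ T v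

/-- The square of the discrete `H¹` norm of `v` on `T`. -/
def cellH1Sq {d : ℕ} {Ω : Set (Pt d)} (M : Mesh d Ω) (κ : Matrix (Fin d) (Fin d) ℝ)
    (v : WeakFunction d) (T : Set (Pt d)) : ℝ :=
  (∫ x in T, ∑ i, ∑ j, pval (MvPolynomial.pderiv j (v.inner T i)) x ^ 2) + reaction κ T v +
    (Metric.diam T)⁻¹ * ∑ e ∈ M.facesOf T,
      ∫ x in e, ∑ i, (pval (v.inner T i) x - pval (v.bdry e i) x) ^ 2 ∂μHE[d - 1]

lemma exists_cellEnergySq_equiv (m k : ℕ) {ρ ρ' δ : ℝ} (hρ : 0 < ρ) (hρ' : 0 < ρ') (hδ : 0 < δ) :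
    ∃ C ≥ 1, ∀ (Ω : Set (Pt (m + 1))) (M : Mesh (m + 1) Ω) (K : ScaledElement m),
      M.IsScaledCell K → K.IsRegular ρ ρ' δ → ∀ r, M.AdmissibleDegree k r →
      ∀ κ : Matrix (Fin (m + 1)) (Fin (m + 1)) ℝ, κ.PosDef → ∀ v, MemVh M k v →
        cellEnergySq M κ (r K.T) v K.T ≤ C * cellH1Sq M κ v K.T ∧
        cellH1Sq M κ v K.T ≤ C * cellEnergySq M κ (r K.T) v K.T := by
  obtain ⟨C, hC, hequiv⟩ := exists_weakGradient_equiv m k hρ hρ' hδ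
  refine ⟨C + 1, by linarith, fun Ω M K hK hreg r hr κ hκ v hv => ?_⟩
  obtain ⟨hX, hY⟩ := hequiv Ω M K hK hreg r hr v hv
  have hX₀ : 0 ≤ ∑ i, K.normSq (weakGradient M (r K.T) K.T v i) :=
    Finset.sum_nonneg fun i _ => K.normSq_nonneg _
  have hY₀ := nonneg_of_mul_nonneg_right (hX₀.trans hX) hC
  have hR := reaction_nonneg hκ K.T v
  have hCR := mul_nonneg hC.le hR
  have hEnergy : cellEnergySq M κ (r K.T) v K.T =
      (∑ i, K.normSq (weakGradient M (r K.T) K.T v i)) + reaction κ K.T v := by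
    rw [cellEnergySq, setIntegral_sum_sq_eq_sum_normSq]
  have hH1 : cellH1Sq M κ v K.T =
      (∑ i, K.h1Sq (v.inner K.T i) fun e => v.bdry e i) + reaction κ K.T v := by
    rw [cellH1Sq, setIntegral_sum_sq_eq_sum_normSq, Nat.add_sub_cancel, hK.jump_eq_sum_jumpSq]
    simp only [ScaledElement.h1Sq, Finset.sum_add_distrib]
    ring
  rw [hEnergy, hH1]
  constructor <;> linarith

lemma Mesh.ShapeRegular.mul_diam_pow_le_area {d : ℕ} {Ω : Set (Pt d)} {M : Mesh d Ω}
    {ρv ρe θ σ : ℝ} (hM : M.ShapeRegular ρv ρe θ σ) (hρe : 0 ≤ ρe) (hθ : 0 ≤ θ) {T e : Set (Pt d)}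
    (hT : T ∈ M.cells) (he : e ∈ M.facesOf T) :
    ρe * θ ^ (d - 1) * Metric.diam T ^ (d - 1) ≤ (μHE[d - 1] : Measure (Pt d)).real e := by
  refine le_trans ?_ (hM.area_ge T hT e he)
  rw [mul_assoc, ← mul_pow]
  exact mul_le_mul_of_nonneg_left
    (pow_le_pow_left₀ (mul_nonneg hθ Metric.diam_nonneg) (hM.diam_ge T hT e he) _) hρe

end WG

end

open WG in
theorem mainTheorem4_general (d : ℕ) (hd : 0 < d) (k : ℕ) {ρ ρ' δ : ℝ} (hρ : 0 < ρ) (hρ' : 0 < ρ')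
    (hδ : 0 < δ) :
    ∃ C₁ C₂ : ℝ, 0 < C₁ ∧ 0 < C₂ ∧
      ∀ Ω : Set (Pt d), Bornology.IsBounded Ω →
      ∀ M : Mesh d Ω, (∀ T ∈ M.cells, ρ * Metric.diam T ^ d ≤ volume.real T) →
      (∀ T ∈ M.cells, ∀ e ∈ M.facesOf T,
        ρ' * Metric.diam T ^ (d - 1) ≤ (μHE[d - 1] : Measure (Pt d)).real e) →
      M.NoncoplanarFaces δ → ∀ r, M.AdmissibleDegree k r →
      ∀ κ : Matrix (Fin d) (Fin d) ℝ, κ.PosDef → ∀ v, MemVh M k v →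
        C₁ * discreteH1Norm M κ v ≤ energyNorm M κ r v ∧
        energyNorm M κ r v ≤ C₂ * discreteH1Norm M κ v := by
  obtain ⟨m, rfl⟩ := Nat.exists_eq_succ_of_ne_zero hd.ne'
  obtain ⟨C, hC, hequiv⟩ := exists_cellEnergySq_equiv m k hρ hρ' hδ
  have hC₀ : 0 < C := one_pos.trans_le hC
  refine ⟨(√C)⁻¹, √C, by positivity, by positivity, ?_⟩
  intro Ω hΩ M hvol harea hsep r hr κ hκ v hv
  have hcell : ∀ T ∈ M.cells, cellEnergySq M κ (r T) v T ≤ C * cellH1Sq M κ v T ∧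
      cellH1Sq M κ v T ≤ C * cellEnergySq M κ (r T) v T := fun T hT => by
    obtain ⟨K, rfl, hK⟩ := Mesh.exists_isScaledCell hΩ hδ hsep hT
    exact hequiv Ω M K hK (hK.isRegular hvol harea hsep) r hr κ hκ v hv
  rw [inv_mul_le_iff₀ (by positivity)]
  exact ⟨sqrt_sum_le_mul_sqrt_sum hC₀.le fun T hT => (hcell T hT).2,
    sqrt_sum_le_mul_sqrt_sum hC₀.le fun T hT => (hcell T hT).1⟩

theorem mainTheorem4 (d : ℕ) (hd : d = 2 ∨ d = 3) (k : ℕ) (hk : 1 ≤ k)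
    (ρv ρe θ σ δ : ℝ) (hρv : 0 < ρv) (hρe : 0 < ρe) (hθ : 0 < θ) (hσ : 0 < σ) (hδ : 0 < δ) :
    ∃ C₁ C₂ : ℝ, 0 < C₁ ∧ 0 < C₂ ∧
      ∀ (Ω : Set (WG.Pt d)), IsOpen Ω → IsConnected Ω → Bornology.IsBounded Ω →
      ∀ M : WG.Mesh d Ω, M.ShapeRegular ρv ρe θ σ → M.NoncoplanarFaces δ →
      ∀ r : Set (WG.Pt d) → ℕ, M.AdmissibleDegree k r →
      ∀ κ : Matrix (Fin d) (Fin d) ℝ, κ.PosDef →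
      ∀ v : WG.WeakFunction d, WG.MemVh M k v →
        C₁ * WG.discreteH1Norm M κ v ≤ WG.energyNorm M κ r v ∧
        WG.energyNorm M κ r v ≤ C₂ * WG.discreteH1Norm M κ v := by
  obtain ⟨C₁, C₂, h₁, h₂, hequiv⟩ := mainTheorem4_general d (by omega) k hρv
    (ρ' := ρe * θ ^ (d - 1)) (by positivity) hδ
  exact ⟨C₁, C₂, h₁, h₂, fun Ω _ _ hΩ M hM => hequiv Ω hΩ M hM.volume_ge fun _ hT _ he =>
    hM.mul_diam_pow_le_area hρe.le hθ.le hT he⟩
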